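/- **Setting.** A finite set of asynchronous processes, any of which may crash, shares a memory with atomic reads, writes and CAS; allocation always returns a fresh address. Keys are drawn from a totally ordered set, extended by $-\infty$ and $\infty$. A multiset has operations $\mathrm{Get}(k)$ (returns the number of occurrences of $k$), $\mathrm{Insert}(k,n)$ with $n>0$ (adds $n$ occurrences of $k$) and $\mathrm{Delete}(k,n)$ with $n>0$ (removes $n$ occurrences of $k$ and returns True if there are at least $n$ of them; otherwise returns False and changes nothing); initially it is empty. It is represented by a singly-linked list of nodes with an immutable $key$, mutable $count$ and $next$, and fields $info$ and $marked$. Initially the list consists of $head$ (key $-\infty$, count $0$) and $tail$ (key $\infty$, count $0$, $next=\mathrm{Nil}$). A node is *in the data structure* if it is reachable from $head$ by $next$ pointers. **Primitives.** An SCX-record has fields $V,R,fld,new,old$, $state\in\{\mathrm{InProgress},\mathrm{Committed},\mathrm{Aborted}\}$, $allFrozen$ and $infoFields$; every $info$ field initially points to a dummy record with state Aborted. - $\mathrm{LLX}(r)$: read $marked_1:=r.marked$, $rinfo:=r.info$, $state:=rinfo.state$, $marked_2:=r.marked$. If $state$ is Aborted, or is Committed with $marked_2$ false, read $r.count$ and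 $r.next$ and, if $r.info$ still equals $rinfo$, store $rinfo$ and the values read in the local table of the process and return the values. Otherwise, if ($rinfo.state=$ Committed, or $rinfo.state=$ InProgress and $\mathrm{Help}(rinfo)$ returns True) and $marked_1$, return Finalized. Otherwise call $\mathrm{Help}(r.info)$ if $r.info.state=$ InProgress, and return Fail. - $\mathrm{SCX}(V,R,fld,new)$: create an SCX-record $U$ (InProgress, $allFrozen$ false) with $old$ and $infoFields$ taken from the local table, and return $\mathrm{Help}(U)$. - $\mathrm{Help}(U)$: for each $r\in U.V$ in order, CAS $r.info$ from $U.infoFields[r]$ to $U$; if the CAS fails and $r.info\ne U$, return True if $U.allFrozen$, else set $U.state:=$ Aborted and return False. After the loop set $U.allFrozen:=$ True, set $r.marked:=$ True for each $r\in U.R$, CAS $U.fld$ from $U.old$ to $U.new$ (the *update CAS*), set $U.state:=$ Committed and return True. **Operations.** $\mathrm{Search}(k)$ follows $next$ pointers from $head$ to the first node $r$ with $r.key\ge k$, and returns $r$ and the preceding node $p$. $\mathrm{Get}(k)$ searches and returns $r.count$ if $r.key=k$, else $0$. $\mathrm{Insert}(k,n)$ and $\mathrm{Delete}(k,n)$ repeat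 the following until they return. - $\mathrm{Insert}(k,n)$: Search. If $r.key=k$, perform $\mathrm{LLX}(r)$ and, if it gives a snapshot, $\mathrm{SCX}(\langle r\rangle,\langle\rangle,\&r.count,c+n)$, where $c$ is the count in the snapshot. Otherwise perform $\mathrm{LLX}(p)$ and, if it gives a snapshot with $next=r$, $\mathrm{SCX}(\langle p\rangle,\langle\rangle,\&p.next,\text{new Node}(k,n,r))$. Return if the SCX succeeds. - $\mathrm{Delete}(k,n)$: Search, $\mathrm{LLX}(p)$, $\mathrm{LLX}(r)$. If both give snapshots and that of $p$ has $next=r$, let $(c,x)$ be the count and next pointer in the snapshot of $r$. If $r.key\ne k$ or $c<n$, return False. If $c>n$, perform $\mathrm{SCX}(\langle p,r\rangle,\langle r\rangle,\&p.next,\text{new Node}(r.key,c-n,x))$. If $c=n$, perform $\mathrm{LLX}(x)$ and, if it gives a snapshot, $\mathrm{SCX}(\langle p,r,x\rangle,\langle r,x\rangle,\&p.next,\text{new copy of }x)$. Return True if the SCX succeeds. **Theorem.** These algorithms implement a non-blocking, linearizable multiset. More precisely, in every execution: 1. At all times $head$ is a node with key $-\infty$, each node with key $\infty$ has $next=\mathrm{Nil}$,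 and the $next$ pointer of every other node points to a node with a strictly larger key (so the list is sorted with strictly increasing keys). 2. The nodes removed from the data structure by a step are exactly those in $R$ if the step is the linearization point (the successful update CAS) of an $\mathrm{SCX}(V,R,fld,new)$, and there are none otherwise. 3. The execution is linearizable: each operation that returns, and some pending ones, can be assigned a linearization point between its invocation and its return, so that all responses are those of the sequential multiset executed in the order of the linearization points. Moreover, the points can be chosen so that at all times the multiset of keys in the data structure equals the result of the operations linearized so far. 4. If infinitely many steps are taken (in particular, if operations are invoked infinitely often), then operations complete infinitely often. -/

import Mathlib

namespace LLXMultiset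

/-! ## The abstract data type: sequential multisets -/

/-- The operations of a multiset with keys in `K`. -/
inductive Op (K : Type*) where
  | get (key : K)
  | insert (key : K) (count : ℕ)
  | delete (key : K) (count : ℕ)

/-- The key an operation is about. -/
def Op.key {K : Type*} : Op K → K
  | .get k => k
  | .insert k _ => k
  | .delete k _ => k

/-- The precondition of an operation: `Insert` and `Delete` require `count > 0`. -/
def Op.Pre {K : Type*} : Op K → Prop
  | .get _ => True
  | .insert _ n => 0 < n
  | .delete _ n => 0 < n

/-- Responses: a number (`Get`), a plain return (`Insert`), a Boolean (`Delete`). -/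
inductive Resp where
  | num (n : ℕ)
  | done
  | bool (b : Bool)
  deriving DecidableEq

/-- The sequential specification: new abstract state and response. -/
def spec {K : Type*} [DecidableEq K] (s : Multiset K) : Op K → Multiset K × Resp
  | .get k => (s, .num (s.count k))
  | .insert k n => (s + Multiset.replicate n k, .done)
  | .delete k n =>
      if n ≤ s.count k then (s - Multiset.replicate n k, .bool true) else (s, .bool false)

/-- The multiset that results from executing a sequence of operations atomically, in order,
starting from the empty multiset. -/
def run {K : Type*} [DecidableEq K] (ops : List (Op K)) : Multiset K :=
  ops.foldl (fun s o => (spec s o).1) 0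

/-! ## Shared memory

Addresses are natural numbers; allocation always returns an address never used before. -/

/-- Address of a node (a Data-record). -/
abbrev Ptr := ℕ

/-- Address of an SCX-record. -/
abbrev RecPtr := ℕ

/-- List nodes. `⊥` and `⊤` are the sentinel keys `-∞` and `∞`; `none` is the pointer `Nil`. -/
structure Node (K : Type*) where
  key : WithBot (WithTop K)
  count : ℕ
  next : Option Ptr
  info : RecPtr
  marked : Bool

/-- The state of an SCX-record. -/
inductive SCXState where
  | inProgress
  | committed
  | aborted
  deriving DecidableEq

/-- Pointers `&r.count` and `&r.next` to the mutable fields of a node `r`. -/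
inductive Fld where
  | count (r : Ptr)
  | next (r : Ptr)
  deriving DecidableEq

/-- Values of mutable fields. -/
inductive Val where
  | num (n : ℕ)
  | ptr (a : Option Ptr)
  deriving DecidableEq

/-- SCX-records. `infoFields` is the table indexed by the nodes in `V`. -/
structure SCXRecord where
  V : List Ptr
  R : List Ptr
  fld : Fld
  new : Val
  old : Val
  state : SCXState
  allFrozen : Bool
  infoFields : Ptr → RecPtr

/-- The shared memory. The allocated nodes are those with address `< numNodes`, the allocated
SCX-records those with address `< numRecs`. -/
structure Heap (K : Type*) where
  node : Ptr → Node K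
  numNodes : ℕ
  scx : RecPtr → SCXRecord
  numRecs : ℕ

/-- The address of the node `tail`. -/
def tail : Ptr := 0

/-- The address of the node `head`. -/
def head : Ptr := 1

/-- The address of the dummy SCX-record. -/
def dummy : RecPtr := 0

/-- The node created by `new Node(key, count, next)`. -/
def mkNode {K : Type*} (key : WithBot (WithTop K)) (count : ℕ) (next : Option Ptr) : Node K where
  key := key
  count := count
  next := next
  info := dummy
  marked := false

/-- The initial memory: `tail`, `head` and the dummy SCX-record, whose state is `aborted`. -/
def Heap.initial (K : Type*) : Heap K where
  node a := if a = head then mkNode ⊥ 0 (some tail) else mkNode (WithBot.some ⊤) 0 none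
  numNodes := 2
  scx _ :=
    { V := [], R := [], fld := .count tail, new := .num 0, old := .num 0, state := .aborted,
      allFrozen := false, infoFields := fun _ => dummy }
  numRecs := 1

/-- Overwrite the node at address `a`. -/
def Heap.setNode {K : Type*} (h : Heap K) (a : Ptr) (x : Node K) : Heap K :=
  { h with node := Function.update h.node a x }

/-- Overwrite the SCX-record at address `u`. -/
def Heap.setSCX {K : Type*} (h : Heap K) (u : RecPtr) (x : SCXRecord) : Heap K :=
  { h with scx := Function.update h.scx u x }

/-- Allocate a node. -/
def Heap.newNode {K : Type*} (h : Heap K) (x : Node K) : Heap K × Ptr :=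
  ({ h.setNode h.numNodes x with numNodes := h.numNodes + 1 }, h.numNodes)

/-- Allocate an SCX-record. -/
def Heap.newRecord {K : Type*} (h : Heap K) (x : SCXRecord) : Heap K × RecPtr :=
  ({ h.setSCX h.numRecs x with numRecs := h.numRecs + 1 }, h.numRecs)

/-- Read a mutable field. -/
def Heap.readFld {K : Type*} (h : Heap K) : Fld → Val
  | .count r => .num (h.node r).count
  | .next r => .ptr (h.node r).next

/-- Write a mutable field. -/
def Heap.writeFld {K : Type*} (h : Heap K) : Fld → Val → Heap K
  | .count r, .num n => h.setNode r { h.node r with count := n }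
  | .next r, .ptr a => h.setNode r { h.node r with next := a }
  | _, _ => h

/-! ## `Help`

Each of the step functions below executes one step, which accesses at most one mutable shared
location (private computation, accesses to immutable fields and the creation of records that
are not yet known to any other process are done together with it). -/

/-- Program counter (with local variables) of an invocation of `Help(u)`. -/
inductive HelpPC where
  /-- loop over `V`: the nodes still to be frozen; freezing CAS on the first one -/
  | freeze (todo : List Ptr)
  /-- the freezing CAS on `r` failed: check whether `r.info = u` -/
  | checkFrozen (r : Ptr) (todo : List Ptr)
  /-- frozen check step -/
  | frozenCheck
  /-- abort step -/
  | abort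
  /-- frozen step -/
  | frozen
  /-- loop over `R`: the nodes still to be marked; mark step on the first one -/
  | mark (todo : List Ptr)
  /-- update CAS -/
  | updateCAS
  /-- commit step -/
  | commit

/-- One step of `Help(u)`; it yields the next program counter or the value returned. -/
def stepHelp {K : Type*} (h : Heap K) (u : RecPtr) : HelpPC → Heap K × (HelpPC ⊕ Bool)
  | .freeze [] => (h, .inl .frozen)
  | .freeze (r :: rs) =>
      if (h.node r).info = (h.scx u).infoFields r then
        (h.setNode r { h.node r with info := u }, .inl (.freeze rs))
      else (h, .inl (.checkFrozen r rs))
  | .checkFrozen r rs =>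
      if (h.node r).info ≠ u then (h, .inl .frozenCheck) else (h, .inl (.freeze rs))
  | .frozenCheck =>
      if (h.scx u).allFrozen = true then (h, .inr true) else (h, .inl .abort)
  | .abort => (h.setSCX u { h.scx u with state := .aborted }, .inr false)
  | .frozen => (h.setSCX u { h.scx u with allFrozen := true }, .inl (.mark (h.scx u).R))
  | .mark [] => (h, .inl .updateCAS)
  | .mark (r :: rs) => (h.setNode r { h.node r with marked := true }, .inl (.mark rs))
  | .updateCAS =>
      if h.readFld (h.scx u).fld = (h.scx u).old then
        (h.writeFld (h.scx u).fld (h.scx u).new, .inl .commit)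
      else (h, .inl .commit)
  | .commit => (h.setSCX u { h.scx u with state := .committed }, .inr true)

/-! ## `LLX` and `SCX` -/

/-- An entry of a process's local table of LLX results. -/
structure Entry where
  info : RecPtr
  count : ℕ
  next : Option Ptr

/-- The local table of LLX results of a process. -/
abbrev Table := Ptr → Entry

/-- Results of `LLX`: a snapshot of the mutable fields, `Finalized` or `Fail`. -/
inductive LLXResult where
  | snapshot (count : ℕ) (next : Option Ptr)
  | finalized
  | fail

/-- Program counter (with local variables) of an invocation of `LLX(r)`. -/
inductive LLXPC where
  /-- `marked1 := r.marked` -/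
  | readMarked1
  /-- `rinfo := r.info` -/
  | readInfo (marked1 : Bool)
  /-- `state := rinfo.state` -/
  | readState (marked1 : Bool) (rinfo : RecPtr)
  /-- `marked2 := r.marked` and the test whether `r` was frozen -/
  | readMarked2 (marked1 : Bool) (rinfo : RecPtr) (state : SCXState)
  /-- read the first mutable field -/
  | readCount (marked1 : Bool) (rinfo : RecPtr)
  /-- read the second mutable field -/
  | readNext (marked1 : Bool) (rinfo : RecPtr) (count : ℕ)
  /-- reread `r.info`; if unchanged, store the result in the table and return it -/
  | reread (marked1 : Bool) (rinfo : RecPtr) (count : ℕ) (next : Option Ptr)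
  /-- test `rinfo.state = Committed` -/
  | testCommitted (marked1 : Bool) (rinfo : RecPtr)
  /-- test `rinfo.state = InProgress` -/
  | testInProgress (marked1 : Bool) (rinfo : RecPtr)
  /-- in `Help(rinfo)`, called to decide whether `r` is finalized -/
  | helpFinal (marked1 : Bool) (rinfo : RecPtr) (pc : HelpPC)
  /-- read `r.info` in the test `r.info.state = InProgress` -/
  | failInfo
  /-- read the state in the test `r.info.state = InProgress` -/
  | failState (x : RecPtr)
  /-- read `r.info` again, to call `Help(r.info)` -/
  | failInfoAgain
  /-- in `Help(y)`, called before returning `Fail` -/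
  | helpFail (y : RecPtr) (pc : HelpPC)

/-- The program counter at the start of `Help(u)`. -/
def startHelp {K : Type*} (h : Heap K) (u : RecPtr) : HelpPC := .freeze (h.scx u).V

/-- One step of `LLX(r)`. -/
def stepLLX {K : Type*} (h : Heap K) (tbl : Table) (r : Ptr) :
    LLXPC → Heap K × Table × (LLXPC ⊕ LLXResult)
  | .readMarked1 => (h, tbl, .inl (.readInfo (h.node r).marked))
  | .readInfo m => (h, tbl, .inl (.readState m (h.node r).info))
  | .readState m i => (h, tbl, .inl (.readMarked2 m i (h.scx i).state))
  | .readMarked2 m i st =>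
      if st = .aborted ∨ (st = .committed ∧ (h.node r).marked = false) then
        (h, tbl, .inl (.readCount m i))
      else (h, tbl, .inl (.testCommitted m i))
  | .readCount m i => (h, tbl, .inl (.readNext m i (h.node r).count))
  | .readNext m i c => (h, tbl, .inl (.reread m i c (h.node r).next))
  | .reread m i c nx =>
      if (h.node r).info = i then
        (h, Function.update tbl r { info := i, count := c, next := nx }, .inr (.snapshot c nx))
      else (h, tbl, .inl (.testCommitted m i))
  | .testCommitted m i =>
      if (h.scx i).state = .committed then
        (h, tbl, if m = true then .inr .finalized else .inl .failInfo)
      else (h, tbl, .inl (.testInProgress m i))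
  | .testInProgress m i =>
      if (h.scx i).state = .inProgress then (h, tbl, .inl (.helpFinal m i (startHelp h i)))
      else (h, tbl, .inl .failInfo)
  | .helpFinal m i pc =>
      match stepHelp h i pc with
      | (h₁, .inl pc₁) => (h₁, tbl, .inl (.helpFinal m i pc₁))
      | (h₁, .inr b) =>
          (h₁, tbl, if b = true ∧ m = true then .inr .finalized else .inl .failInfo)
  | .failInfo => (h, tbl, .inl (.failState (h.node r).info))
  | .failState x =>
      if (h.scx x).state = .inProgress then (h, tbl, .inl .failInfoAgain)
      else (h, tbl, .inr .fail)
  | .failInfoAgain =>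
      (h, tbl, .inl (.helpFail (h.node r).info (startHelp h (h.node r).info)))
  | .helpFail y pc =>
      match stepHelp h y pc with
      | (h₁, .inl pc₁) => (h₁, tbl, .inl (.helpFail y pc₁))
      | (h₁, .inr _) => (h₁, tbl, .inr .fail)

/-- The value of a mutable field stored in the local table of LLX results. -/
def Table.value (tbl : Table) : Fld → Val
  | .count r => .num (tbl r).count
  | .next r => .ptr (tbl r).next

/-- The first step of `SCX(V, R, fld, new)`: create the SCX-record from the local table of LLX
results. `SCX` then executes `Help` on that record and returns its result. -/
def newSCX {K : Type*} (h : Heap K) (tbl : Table) (V R : List Ptr) (fld : Fld) (new : Val) :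
    Heap K × RecPtr :=
  h.newRecord
    { V := V, R := R, fld := fld, new := new, old := tbl.value fld, state := .inProgress,
      allFrozen := false, infoFields := fun r => (tbl r).info }

/-! ## `Get`, `Insert` and `Delete` -/

/-- Program counter (with local variables) of a multiset operation. -/
inductive PC where
  /-- `Search`: `p := head; r := p.next` (also the start of each iteration of the main loop) -/
  | start
  /-- `Search`: the test `key > r.key` and the body of the loop -/
  | search (p r : Ptr)
  /-- `Search` has returned `r` and `p` -/
  | found (p r : Ptr)
  /-- `Insert`: in `localr := LLX(r)` -/
  | insLLXr (r : Ptr) (pc : LLXPC)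
  /-- `Insert`: the lines after `localr := LLX(r)` -/
  | insR (r : Ptr) (localr : LLXResult)
  /-- `Insert`: in `localp := LLX(p)` -/
  | insLLXp (p r : Ptr) (pc : LLXPC)
  /-- `Insert`: the lines after `localp := LLX(p)` -/
  | insP (p r : Ptr) (localp : LLXResult)
  /-- `Delete`: in `localp := LLX(p)` -/
  | delLLXp (p r : Ptr) (pc : LLXPC)
  /-- `Delete`: in `localr := LLX(r)` -/
  | delLLXr (p r : Ptr) (localp : LLXResult) (pc : LLXPC)
  /-- `Delete`: the tests after `localr := LLX(r)` -/
  | delTest (p r : Ptr) (localp localr : LLXResult)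
  /-- `Delete`: in `LLX(localr.next)`, where `localr.next = n` -/
  | delLLXn (p r n : Ptr) (pc : LLXPC)
  /-- `Delete`: the lines after `LLX(localr.next)` -/
  | delN (p r n : Ptr) (localn : LLXResult)
  /-- in the call of `Help(u)` by an `SCX`; the operation returns `ret` if the `SCX` returns
  true, and starts its main loop anew otherwise -/
  | scx (u : RecPtr) (pc : HelpPC) (ret : Resp)
  /-- the process has followed the pointer `Nil`; it is stuck in this operation forever -/
  | fault

/-- Invoke `SCX(V, R, fld, new)`, to return `ret` from the operation if it succeeds. -/
def callSCX {K : Type*} (h : Heap K) (tbl : Table) (V R : List Ptr) (fld : Fld) (new : Val)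
    (ret : Resp) : Heap K × Table × (PC ⊕ Resp) :=
  let c := newSCX h tbl V R fld new
  (c.1, tbl, .inl (.scx c.2 (startHelp c.1 c.2) ret))

/-- What follows when `Search` has returned `r` and `p`. -/
def stepFound {K : Type*} [LinearOrder K] (h : Heap K) (p r : Ptr) : Op K → PC ⊕ Resp
  | .get k => if (k : WithBot (WithTop K)) = (h.node r).key then .inr (.num (h.node r).count)
      else .inr (.num 0)
  | .insert k _ =>
      if (k : WithBot (WithTop K)) = (h.node r).key then .inl (.insLLXr r .readMarked1)
      else .inl (.insLLXp p r .readMarked1)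
  | .delete _ _ => .inl (.delLLXp p r .readMarked1)

/-- `Insert(key, n)`, after `localr := LLX(r)`. -/
def stepInsR {K : Type*} (h : Heap K) (tbl : Table) (n : ℕ) (r : Ptr) :
    LLXResult → Heap K × Table × (PC ⊕ Resp)
  | .snapshot c _ => callSCX h tbl [r] [] (.count r) (.num (c + n)) .done
  | _ => (h, tbl, .inl .start)

/-- `Insert(key, n)`, after `localp := LLX(p)`. -/
def stepInsP {K : Type*} (h : Heap K) (tbl : Table) (k : K) (n : ℕ) (p r : Ptr) :
    LLXResult → Heap K × Table × (PC ⊕ Resp)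
  | .snapshot _ nx =>
      if nx = some r then
        let a := h.newNode (mkNode (k : WithBot (WithTop K)) n (some r))
        callSCX a.1 tbl [p] [] (.next p) (.ptr (some a.2)) .done
      else (h, tbl, .inl .start)
  | _ => (h, tbl, .inl .start)

/-- `Delete(key, n)`, after `localr := LLX(r)`. -/
def stepDelTest {K : Type*} [LinearOrder K] (h : Heap K) (tbl : Table) (k : K) (n : ℕ)
    (p r : Ptr) : LLXResult → LLXResult → Heap K × Table × (PC ⊕ Resp)
  | .snapshot _ pnext, .snapshot c rnext =>
      if pnext = some r then
        if (k : WithBot (WithTop K)) ≠ (h.node r).key ∨ c < n then (h, tbl, .inr (.bool false))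
        else if n < c then
          let a := h.newNode (mkNode (h.node r).key (c - n) rnext)
          callSCX a.1 tbl [p, r] [r] (.next p) (.ptr (some a.2)) (.bool true)
        else
          match rnext with
          | some x => (h, tbl, .inl (.delLLXn p r x .readMarked1))
          | none => (h, tbl, .inl .fault)
      else (h, tbl, .inl .start)
  | _, _ => (h, tbl, .inl .start)

/-- `Delete(key, n)`, after `LLX(localr.next)`, where `localr.next = x`. The copy of `x` is made
from the immutable key and the snapshot of the mutable fields. -/
def stepDelN {K : Type*} (h : Heap K) (tbl : Table) (p r x : Ptr) :
    LLXResult → Heap K × Table × (PC ⊕ Resp)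
  | .snapshot c nx =>
      let a := h.newNode (mkNode (h.node x).key c nx)
      callSCX a.1 tbl [p, r, x] [r, x] (.next p) (.ptr (some a.2)) (.bool true)
  | _ => (h, tbl, .inl .start)

/-- Run one step of an `LLX` inside an operation. -/
def inLLX {K : Type*} (h : Heap K) (tbl : Table) (r : Ptr) (pc : LLXPC) (stay : LLXPC → PC)
    (exit : LLXResult → PC) : Heap K × Table × (PC ⊕ Resp) :=
  match stepLLX h tbl r pc with
  | (h₁, tbl₁, .inl pc₁) => (h₁, tbl₁, .inl (stay pc₁))
  | (h₁, tbl₁, .inr res) => (h₁, tbl₁, .inl (exit res))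

/-- One step of a multiset operation; it yields the next program counter or the response. -/
def stepOp {K : Type*} [LinearOrder K] (h : Heap K) (tbl : Table) (op : Op K) :
    PC → Heap K × Table × (PC ⊕ Resp)
  | .start =>
      match (h.node head).next with
      | some r => (h, tbl, .inl (.search head r))
      | none => (h, tbl, .inl .fault)
  | .search p r =>
      if (h.node r).key < (op.key : WithBot (WithTop K)) then
        match (h.node r).next with
        | some x => (h, tbl, .inl (.search r x))
        | none => (h, tbl, .inl .fault)
      else (h, tbl, .inl (.found p r))
  | .found p r => (h, tbl, stepFound h p r op)
  | .insLLXr r pc => inLLX h tbl r pc (.insLLXr r) (.insR r)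
  | .insR r localr =>
      match op with
      | .insert _ n => stepInsR h tbl n r localr
      | _ => (h, tbl, .inl .fault)
  | .insLLXp p r pc => inLLX h tbl p pc (.insLLXp p r) (.insP p r)
  | .insP p r localp =>
      match op with
      | .insert k n => stepInsP h tbl k n p r localp
      | _ => (h, tbl, .inl .fault)
  | .delLLXp p r pc =>
      inLLX h tbl p pc (.delLLXp p r) (fun localp => .delLLXr p r localp .readMarked1)
  | .delLLXr p r localp pc => inLLX h tbl r pc (.delLLXr p r localp) (.delTest p r localp)
  | .delTest p r localp localr =>
      match op with
      | .delete k n => stepDelTest h tbl k n p r localp localr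
      | _ => (h, tbl, .inl .fault)
  | .delLLXn p r x pc => inLLX h tbl x pc (.delLLXn p r x) (.delN p r x)
  | .delN p r x localn => stepDelN h tbl p r x localn
  | .scx u pc ret =>
      match stepHelp h u pc with
      | (h₁, .inl pc₁) => (h₁, tbl, .inl (.scx u pc₁ ret))
      | (h₁, .inr true) => (h₁, tbl, .inr ret)
      | (h₁, .inr false) => (h₁, tbl, .inl .start)
  | .fault => (h, tbl, .inl .fault)

/-! ## Executions -/

/-- The local state of a process: its pending operation, if any, and its table. -/
structure Local (K : Type*) where
  cur : Option (Op K × PC)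
  table : Table

/-- Configurations of a system with the set `P` of processes. -/
structure Config (P K : Type*) where
  heap : Heap K
  proc : P → Local K

/-- The initial configuration. -/
def Config.initial (P K : Type*) : Config P K where
  heap := Heap.initial K
  proc _ := { cur := none, table := fun _ => { info := dummy, count := 0, next := none } }

/-- What happens between two consecutive configurations: nothing, the invocation of an
operation, an internal step of a pending operation, or the step at which it returns. -/
inductive Action (P K : Type*) where
  | stutter
  | invoke (p : P) (op : Op K)
  | internal (p : P)
  | respond (p : P) (v : Resp)

/-- Replace the memory and the local state of `p`. -/
def Config.set {P K : Type*} [DecidableEq P] (c : Config P K) (h : Heap K) (p : P)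
    (l : Local K) : Config P K where
  heap := h
  proc := Function.update c.proc p l

/-- The transition relation. -/
def Next {P K : Type*} [DecidableEq P] [LinearOrder K] (c : Config P K) :
    Action P K → Config P K → Prop
  | .stutter, d => d = c
  | .invoke p op, d => (c.proc p).cur = none ∧ op.Pre ∧
      d = c.set c.heap p { cur := some (op, .start), table := (c.proc p).table }
  | .internal p, d => ∃ op pc h tbl pc₁, (c.proc p).cur = some (op, pc) ∧
      stepOp c.heap (c.proc p).table op pc = (h, tbl, .inl pc₁) ∧
      d = c.set h p { cur := some (op, pc₁), table := tbl }
  | .respond p v, d => ∃ op pc h tbl, (c.proc p).cur = some (op, pc) ∧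
      stepOp c.heap (c.proc p).table op pc = (h, tbl, .inr v) ∧
      d = c.set h p { cur := none, table := tbl }

/-- Executions, with an arbitrary asynchronous scheduler and arbitrary process failures. A finite
execution is one with only `stutter` from some time on. Step `t` leads from configuration `t`
to configuration `t + 1`. -/
structure Execution (P K : Type*) [DecidableEq P] [LinearOrder K] where
  conf : ℕ → Config P K
  act : ℕ → Action P K
  conf_zero : conf 0 = Config.initial P K
  next : ∀ t, Next (conf t) (act t) (conf (t + 1))

section Properties

variable {P K : Type*} [DecidableEq P] [LinearOrder K]

/-! ## Sorted list, and removal of exactly the finalized nodes -/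

/-- The node at address `a` is in the data structure: it is reachable from `head`. -/
inductive InList (h : Heap K) : Ptr → Prop
  | head : InList h head
  | next {a b : Ptr} : InList h a → (h.node a).next = some b → InList h b

/-- `head` is a node with key `-∞`, nodes with key `∞` have next pointer `Nil`, and the next
pointer of every other node points to a node with a strictly larger key. -/
def Sorted (h : Heap K) : Prop :=
  head < h.numNodes ∧ (h.node head).key = ⊥ ∧
  ∀ a < h.numNodes,
    ((h.node a).key = WithBot.some ⊤ → (h.node a).next = none) ∧
    ((h.node a).key ≠ WithBot.some ⊤ →
      ∃ b < h.numNodes, (h.node a).next = some b ∧ (h.node a).key < (h.node b).key)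

/-- A process with program counter `pc` is about to perform the update CAS of `Help(u)`. -/
def PC.AtUpdateCAS (pc : PC) (u : RecPtr) : Prop :=
  (∃ ret, pc = .scx u .updateCAS ret) ∨
  ∃ l : LLXPC, ((∃ m, l = .helpFinal m u .updateCAS) ∨ l = .helpFail u .updateCAS) ∧
    ((∃ r, pc = .insLLXr r l) ∨ (∃ p r, pc = .insLLXp p r l) ∨ (∃ p r, pc = .delLLXp p r l) ∨
      (∃ p r x, pc = .delLLXr p r x l) ∨ (∃ p r x, pc = .delLLXn p r x l))

/-- Step `t` is a successful update CAS belonging to the SCX-record at address `u`. This is the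
linearization point of the `SCX` that created this record. -/
def Execution.UpdatesAt (E : Execution P K) (t : ℕ) (u : RecPtr) : Prop :=
  ∃ p op pc, E.act t = .internal p ∧ ((E.conf t).proc p).cur = some (op, pc) ∧
    pc.AtUpdateCAS u ∧
    (E.conf t).heap.readFld ((E.conf t).heap.scx u).fld = ((E.conf t).heap.scx u).old

/-- The `SCX`s remove exactly the nodes that they finalize: a node is removed from the data
structure by a step iff the step linearizes an `SCX(V, R, fld, new)` with the node in `R`. -/
def Execution.RemovesFinalized (E : Execution P K) : Prop :=
  ∀ t a, (InList (E.conf t).heap a ∧ ¬ InList (E.conf (t + 1)).heap a) ↔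
    ∃ u, E.UpdatesAt t u ∧ a ∈ ((E.conf t).heap.scx u).R

/-- `s` is the multiset of keys in the data structure: a key occurs `r.count` times if there is
a node `r` in the data structure with this key, and does not occur otherwise. -/
def IsContents (h : Heap K) (s : Multiset K) : Prop :=
  ∀ k : K,
    (∀ a, InList h a → (h.node a).key = (k : WithBot (WithTop K)) →
      s.count k = (h.node a).count) ∧
    ((¬ ∃ a, InList h a ∧ (h.node a).key = (k : WithBot (WithTop K))) → s.count k = 0)

/-! ## Linearizability and progress

An operation instance is identified with the time of its invocation. -/

/-- `i` is the time of an invocation of `op`. -/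
def Execution.Invokes (E : Execution P K) (i : ℕ) (op : Op K) : Prop :=
  ∃ p, E.act i = .invoke p op

/-- The operation invoked at time `i` returns `v` at time `j`. -/
def Execution.Returns (E : Execution P K) (i j : ℕ) (v : Resp) : Prop :=
  ∃ p op, E.act i = .invoke p op ∧ i < j ∧ E.act j = .respond p v ∧
    ∀ m, i < m → m < j → ∀ w, E.act m ≠ .respond p w

/-- The operation invoked at time `i`. -/
def Execution.opAt (E : Execution P K) (i : ℕ) : Option (Op K) :=
  match E.act i with
  | .invoke _ op => some op
  | _ => none

/-- The multiset that results from the atomic execution of a sequence of operation instances. -/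
def Execution.runOps (E : Execution P K) (l : List ℕ) : Multiset K := run (l.filterMap E.opAt)

/-- `σ` is a linearization of `E`: `σ t` is the sequence of the operation instances linearized up
to configuration `t`. Each instance is linearized at most once, after its invocation; each
instance that returns is linearized no later than its return, and its response is the one of the
sequential specification. (Pending instances may or may not be linearized.) -/
structure Execution.IsLinearization (E : Execution P K) (σ : ℕ → List ℕ) : Prop where
  zero : σ 0 = []
  mono : ∀ t, σ t <+: σ (t + 1)
  nodup : ∀ t, (σ t).Nodup
  invoked : ∀ t, ∀ i ∈ σ t, i < t ∧ ∃ op, E.Invokes i op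
  complete : ∀ i j v, E.Returns i j v → i ∈ σ (j + 1)
  legal : ∀ t l i op j v, l ++ [i] <+: σ t → E.Invokes i op → E.Returns i j v →
    v = (spec (E.runOps l) op).2

/-- Non-blocking: if infinitely many steps are taken (in particular if operations are invoked
infinitely often), then operations complete infinitely often. -/
def Execution.NonBlocking (E : Execution P K) : Prop :=
  (∀ T, ∃ t, T ≤ t ∧ E.act t ≠ .stutter) → ∀ T, ∃ t, T ≤ t ∧ ∃ p v, E.act t = .respond p v

end Properties

end LLXMultiset

/-! The proof is a rely-guarantee argument about the memory enriched by its history (`Ghost`): the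
records for which each node has been frozen, the nodes that have been in the list, the records whose
update CAS has succeeded, and the operation that creates each record. Every step of every process
has one of the few effects listed in `Effect`. Each effect preserves `Ghost.Inv` (`Effect.inv`) and
respects `Mono` (`Effect.mono`), and all that a process remembers between two of its steps
(`Execution.PCInv`) is stable under `Mono`.

The central fact is `Ghost.Inv.at_update`. Two quantities exclude ABA problems. Records are numbered
in order of allocation and a freezing CAS always installs a newer record, so `info` fields only
grow. The value of a mutable field has a rank that an update strictly increases: a count grows in
place, and a next pointer moves to a newer address, which is why `Delete` installs a copy of the
successor instead of the successor itself. A freezing CAS expects an `info` value seen by a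
successful `LLX`, whose record is done and did not finalize the node; a node frozen for a record in
progress cannot be frozen for another one. Hence at a successful update CAS for `u` all nodes of `V`
are still frozen for `u`, the snapshots in the record are the present values, and the CAS replaces
exactly the run `R` behind `p` by the new node (`NextRecord.ready`, `ReadyToReplace.inList_iff`). A
removed node stays frozen for the record that removed it, so it never changes again.

An update is linearized at the successful update CAS of its record, possibly executed by a helper.
An operation instance abandons a record only if it is aborted, so at most one of its records is ever
updated (`Execution.UpdatesAt.unique`), and that update changes the contents as the sequential
specification prescribes (`Effect.contents`). A `Get` or a failing `Delete` is linearized at some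
configuration in its interval. A search may walk through removed nodes, but a node that has been in
the list since the invocation was, at some moment since then, in the list with its present fields
(`Execution.History.past`); this supplies the configuration.

For progress, suppose that responses cease. As there are finitely many processes, invocations cease,
and since each instance updates at most once, updates cease too. The nodes that have been in the
list are then a fixed finite set. Their `info` fields become constant, by induction from large keys
to small ones: a record that loses a frozen node must have aborted, hence failed at a node later in
`V`, that is with a larger key, whose `info` is already constant and known to all late records
(`Execution.QuietFrom.info_eventually_const`). Now take a process with infinitely many steps. It
creates no record, since its first freezing CAS would succeed and change an `info` field. As
iterations have bounded length it returns to the start of its main loop, but an iteration that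
begins in this situation neither fails nor ends, a contradiction. -/

namespace LLXMultiset

set_option linter.unusedSectionVars false

/-! ### Sorted linked lists and the replacement of a segment. -/

section ListStructure

variable {K : Type*}

/-- The `n`-th node of the list. -/
def nth (h : Heap K) : ℕ → Option Ptr
  | 0 => some head
  | n + 1 => (nth h n).bind fun a => (h.node a).next

/-- Reachability carries no position. The index makes two nodes of the list comparable, so that keys
can be compared along the list. -/
lemma inList_iff_nth {h : Heap K} {a : Ptr} : InList h a ↔ ∃ n, nth h n = some a := by
  constructor
  · intro H
    induction H with
    | head => exact ⟨0, rfl⟩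
    | next _ hb ih =>
      obtain ⟨n, hn⟩ := ih
      exact ⟨n + 1, by simp [nth, hn, hb]⟩
  · rintro ⟨n, hn⟩
    induction n generalizing a with
    | zero => cases hn; exact .head
    | succ n ih =>
      simp only [nth, Option.bind_eq_some_iff] at hn
      obtain ⟨b, hb, hba⟩ := hn
      exact (ih hb).next hba

lemma Sorted.next_spec [LinearOrder K] {h : Heap K} (hs : Sorted h) {a b : Ptr} (ha : a < h.numNodes)
    (hab : (h.node a).next = some b) : b < h.numNodes ∧ (h.node a).key < (h.node b).key := by
  have h2 := hs.2.2 a ha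
  by_cases hk : (h.node a).key = WithBot.some ⊤
  · rw [h2.1 hk] at hab; cases hab
  · obtain ⟨c, hc, hac, hlt⟩ := h2.2 hk
    rw [hab] at hac; cases hac
    exact ⟨hc, hlt⟩

lemma InList.lt_numNodes [LinearOrder K] {h : Heap K} (hs : Sorted h) {a : Ptr} (ha : InList h a) :
    a < h.numNodes := by
  induction ha with
  | head => exact hs.1
  | next _ hb ih => exact (hs.next_spec ih hb).1

lemma nth_key_lt [LinearOrder K] {h : Heap K} (hs : Sorted h) {n m : ℕ} (hnm : n < m) {a b : Ptr}
    (ha : nth h n = some a) (hb : nth h m = some b) : (h.node a).key < (h.node b).key := by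
  induction m, hnm using Nat.le_induction generalizing b with
  | base =>
    simp only [nth, ha, Option.bind_some] at hb
    exact (hs.next_spec (InList.lt_numNodes hs (inList_iff_nth.2 ⟨n, ha⟩)) hb).2
  | succ m hm ih =>
    simp only [nth, Option.bind_eq_some_iff] at hb
    obtain ⟨c, hc, hcb⟩ := hb
    exact (ih hc).trans (hs.next_spec (InList.lt_numNodes hs (inList_iff_nth.2 ⟨m, hc⟩)) hcb).2

lemma InList.eq_of_key_eq [LinearOrder K] {h : Heap K} (hs : Sorted h) {a b : Ptr} (ha : InList h a)
    (hb : InList h b) (hab : (h.node a).key = (h.node b).key) : a = b := by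
  obtain ⟨n, hn⟩ := inList_iff_nth.1 ha
  obtain ⟨m, hm⟩ := inList_iff_nth.1 hb
  rcases lt_trichotomy n m with hlt | rfl | hlt
  · exact absurd hab (nth_key_lt hs hlt hn hm).ne
  · rw [hn] at hm; exact Option.some.inj hm
  · exact absurd hab.symm (nth_key_lt hs hlt hm hn).ne

/-- No key of the list lies strictly between those of two consecutive nodes. -/
lemma InList.key_le_of_next [LinearOrder K] {h : Heap K} (hs : Sorted h) {a b c : Ptr} (ha : InList h a)
    (hb : InList h b) (hac : (h.node a).next = some c) (hab : (h.node a).key < (h.node b).key) :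
    (h.node c).key ≤ (h.node b).key := by
  obtain ⟨n, hn⟩ := inList_iff_nth.1 ha
  obtain ⟨m, hm⟩ := inList_iff_nth.1 hb
  have hc : nth h (n + 1) = some c := by simp [nth, hn, hac]
  rcases lt_trichotomy (n + 1) m with hlt | rfl | hlt
  · exact (nth_key_lt hs hlt hc hm).le
  · rw [hc] at hm; cases hm; rfl
  · rcases (Nat.lt_succ_iff.1 hlt).lt_or_eq with hlt | rfl
    · exact absurd hab (nth_key_lt hs hlt hm hn).asymm
    · rw [hn] at hm; cases hm; exact absurd hab (lt_irrefl _)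

/-- If the keys differed, the common successor would have a key at most the larger of the two, since
nothing lies between consecutive nodes, yet it must exceed both. -/
lemma InList.eq_of_next_eq [LinearOrder K] {h : Heap K} (hs : Sorted h) {a b c : Ptr} (ha : InList h a)
    (hb : InList h b) (hac : (h.node a).next = some c) (hbc : (h.node b).next = some c) :
    a = b := by
  have h1 := (hs.next_spec (ha.lt_numNodes hs) hac).2
  have h2 := (hs.next_spec (hb.lt_numNodes hs) hbc).2
  refine ha.eq_of_key_eq hs hb (le_antisymm ?_ ?_)
  · by_contra! hlt
    exact absurd (hb.key_le_of_next hs ha hbc hlt) h1.not_ge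
  · by_contra! hlt
    exact absurd (ha.key_le_of_next hs hb hac hlt) h2.not_ge

lemma inList_mono_of_next {h h' : Heap K}
    (hn : ∀ a, InList h a → (h'.node a).next = (h.node a).next) {a : Ptr} (ha : InList h a) :
    InList h' a := by
  induction ha with
  | head => exact .head
  | next ha hb ih => exact ih.next ((hn _ ha).trans hb)

lemma inList_congr {h h' : Heap K}
    (hn : ∀ a, InList h a → (h'.node a).next = (h.node a).next) {a : Ptr} :
    InList h' a ↔ InList h a := by
  refine ⟨fun ha => ?_, inList_mono_of_next hn⟩
  induction ha with
  | head => exact .head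
  | next _ hb ih => exact ih.next ((hn _ ih).symm.trans hb)

/-- Replacing the segment `R` of the list that follows `p` by the single node `a`. -/
lemma inList_splice {h h' : Heap K} {p a : Ptr} {R : List Ptr} {y : Option Ptr}
    (hp : InList h p) (hpR : p ∉ R) (haL : ¬ InList h a) (hhR : head ∉ R)
    (hpn : (h'.node p).next = some a) (han : (h'.node a).next = y)
    (hoth : ∀ b, InList h b → b ≠ p → (h'.node b).next = (h.node b).next)
    (hin : ∀ b d, InList h b → b ≠ p → b ∉ R → (h.node b).next = some d → d ∉ R)
    (hR : ∀ b ∈ R, InList h b → (∃ d ∈ R, (h.node b).next = some d) ∨ (h.node b).next = y)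
    (hpy : (∃ d ∈ R, (h.node p).next = some d) ∨ (h.node p).next = y)
    (hy : ∀ d, y = some d → InList h d ∧ d ∉ R) (b : Ptr) :
    InList h' b ↔ (InList h b ∧ b ∉ R) ∨ b = a := by
  constructor
  · intro hb
    induction hb with
    | head => exact .inl ⟨.head, hhR⟩
    | @next b d _ hbd ih =>
      rcases ih with ⟨hb, hbR⟩ | rfl
      · by_cases hbp : b = p
        · subst hbp; rw [hpn] at hbd; cases hbd; exact .inr rfl
        · rw [hoth b hb hbp] at hbd
          exact .inl ⟨hb.next hbd, hin b d hb hbp hbR hbd⟩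
      · rw [han] at hbd; exact .inl (hy d hbd)
  -- Follow the old list: outside `R` the new list visits the same nodes, and while the old walk is
  -- inside `R` the new one waits at `p`. On leaving `R` the old walk reaches `y`, which the new one
  -- reaches through `a`.
  · have key : ∀ b, InList h b → (b ∉ R → InList h' b) ∧ (b ∈ R → InList h' p) := by
      intro b hb
      induction hb with
      | head => exact ⟨fun _ => .head, fun hh => absurd hh hhR⟩
      | @next b d hb hbd ih =>
        have hpa (hp' : InList h' p) : InList h' a := hp'.next hpn
        constructor
        · intro hd
          by_cases hbR : b ∈ R
          · have hp' := ih.2 hbR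
            rcases hR b hbR hb with ⟨d', hd', hbd'⟩ | hbd'
            · rw [hbd] at hbd'; cases hbd'; exact absurd hd' hd
            · exact (hpa hp').next (han.trans (hbd'.symm.trans hbd))
          · by_cases hbp : b = p
            · subst hbp
              rcases hpy with ⟨d', hd', hbd'⟩ | hbd'
              · rw [hbd] at hbd'; cases hbd'; exact absurd hd' hd
              · exact (hpa (ih.1 hbR)).next (han.trans (hbd'.symm.trans hbd))
            · exact (ih.1 hbR).next ((hoth b hb hbp).trans hbd)
        · intro hd
          by_cases hbR : b ∈ R
          · exact ih.2 hbR
          · by_cases hbp : b = p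
            · subst hbp; exact ih.1 hbR
            · exact absurd hd (hin b d hb hbp hbR hbd)
    rintro (⟨hb, hbR⟩ | rfl)
    · exact (key b hb).1 hbR
    · exact ((key p hp).1 hpR).next hpn

lemma IsContents.congr [LinearOrder K] {h h' : Heap K} {s : Multiset K} (hc : IsContents h s)
    (hI : ∀ a, InList h' a ↔ InList h a)
    (hn : ∀ a, InList h a → (h'.node a).key = (h.node a).key ∧
      (h'.node a).count = (h.node a).count) : IsContents h' s := by
  intro k
  refine ⟨fun a ha hk => ?_, fun hne => (hc k).2 ?_⟩
  · have ha := (hI a).1 ha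
    rw [(hn a ha).2]
    exact (hc k).1 a ha ((hn a ha).1 ▸ hk)
  · rintro ⟨a, ha, hk⟩
    exact hne ⟨a, (hI a).2 ha, (hn a ha).1.trans hk⟩

end ListStructure

/-! ### The memory with its history, its invariant, and the rely-guarantee vocabulary. -/

section Ghost

/-- A measure under which the value of a mutable field never decreases. -/
def Val.rank : Val → ℕ
  | .num n => n
  | .ptr none => 0
  | .ptr (some a) => a + 1

/-- The node a field belongs to. -/
def Fld.node : Fld → Ptr
  | .count r => r
  | .next r => r

/-- The memory together with the part of the history that the invariants mention. -/
structure Ghost (K : Type*) where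
  heap : Heap K
  /-- `froze r u`: the node `r` has been frozen for the record `u` -/
  froze : Ptr → RecPtr → Prop
  /-- the node has been in the list -/
  listed : Ptr → Prop
  /-- an update CAS for the record has succeeded -/
  updated : RecPtr → Prop
  /-- the operation that creates the record -/
  opOf : RecPtr → Option (Op K)

variable {K : Type*}

/-- The node at address `r`. -/
abbrev Ghost.node (S : Ghost K) (r : Ptr) : Node K := S.heap.node r

/-- The SCX-record at address `u`. -/
abbrev Ghost.scx (S : Ghost K) (u : RecPtr) : SCXRecord := S.heap.scx u

/-- The history after a step that leads to memory `h`; `l` is the record for which the step is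
a successful update CAS, if any. -/
def Ghost.next (S : Ghost K) (h : Heap K) (l : Option RecPtr) : Ghost K where
  heap := h
  froze r u := S.froze r u ∨ (h.node r).info = u
  listed a := S.listed a ∨ InList h a
  updated u := S.updated u ∨ l = some u
  opOf := S.opOf

@[simp] lemma Ghost.next_heap (S : Ghost K) (h : Heap K) (l : Option RecPtr) :
    (S.next h l).heap = h := rfl

@[simp] lemma Ghost.next_node (S : Ghost K) (h : Heap K) (l : Option RecPtr) (r : Ptr) :
    (S.next h l).node r = h.node r := rfl

@[simp] lemma Ghost.next_scx (S : Ghost K) (h : Heap K) (l : Option RecPtr) (u : RecPtr) :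
    (S.next h l).scx u = h.scx u := rfl

/-- Some node of `V` has been frozen for another record, and can no longer be frozen for `u`. -/
def CannotFreeze (S : Ghost K) (u : RecPtr) : Prop :=
  ∃ r ∈ (S.scx u).V, (S.scx u).infoFields r < (S.node r).info ∧ ¬ S.froze r u

/-- The record `i`, for which `r` was frozen, is done and did not finalize `r`. -/
structure Settled (S : Ghost K) (r : Ptr) (i : RecPtr) : Prop where
  froze : S.froze r i
  state : (S.scx i).state ≠ .inProgress
  not_mem : (S.scx i).state = .committed → r ∉ (S.scx i).R

/-- The node `a` has key `key`, and count `c` and next pointer `y` before it is in the list. -/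
structure NewNode (S : Ghost K) (a : Ptr) (key : WithBot (WithTop K)) (c : ℕ)
    (y : Option Ptr) : Prop where
  lt : a < S.heap.numNodes
  key : (S.node a).key = key
  fields : ¬ S.listed a → (S.node a).count = c ∧ (S.node a).next = y

variable [LinearOrder K]

/-- `nx` was a legitimate next pointer of `r` at some time. -/
def NextOK (S : Ghost K) (r : Ptr) (nx : Option Ptr) : Prop :=
  ((S.node r).key = WithBot.some ⊤ → nx = none) ∧
  ((S.node r).key ≠ WithBot.some ⊤ → ∃ b < S.heap.numNodes, nx = some b ∧
    (S.node r).key < (S.node b).key ∧ S.listed b)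

/-- `(c, nx)` is a snapshot of the fields of `r`, valid as long as `r.info = i`. -/
structure Snapshot (S : Ghost K) (r : Ptr) (i : RecPtr) (c : ℕ) (nx : Option Ptr) : Prop where
  lt : r < S.heap.numNodes
  listed : S.listed r
  settled : Settled S r i
  same : (S.node r).info = i → (S.node r).count = c ∧ (S.node r).next = nx
  next : NextOK S r nx

/-- `(c, nx)` is the snapshot of `r` on which the record `u` is based. -/
structure RecSnapshot (S : Ghost K) (u : RecPtr) (r : Ptr) (c : ℕ) (nx : Option Ptr) : Prop where
  snapshot : Snapshot S r ((S.scx u).infoFields r) c nx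
  -- Once frozen for `u`, the node can change only through the update CAS of `u` itself.
  same : (S.node r).info = u → ¬ S.updated u → (S.node r).count = c ∧ (S.node r).next = nx

/-- The record `u` is for an insertion of `n` occurrences of the key `k` of the node `r`. -/
structure CountRecord (S : Ghost K) (u : RecPtr) (r : Ptr) (k : K) (n c : ℕ)
    (nx : Option Ptr) : Prop where
  op : S.opOf u = some (.insert k n)
  pos : 0 < n
  V : (S.scx u).V = [r]
  R : (S.scx u).R = []
  fld : (S.scx u).fld = .count r
  old : (S.scx u).old = .num c
  new : (S.scx u).new = .num (c + n)
  key : (S.node r).key = (k : WithBot (WithTop K))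
  snap : RecSnapshot S u r c nx

/-- The three kinds of changes of a next pointer from `r` to a new node with key `key`, count `c`
and next pointer `y`. -/
inductive Replacement (S : Ghost K) (u : RecPtr) (r : Ptr) (key : WithBot (WithTop K)) (c : ℕ)
    (y : Option Ptr) : Prop
  | insert (k : K) (op : S.opOf u = some (.insert k c)) (R : (S.scx u).R = []) (hk : key = k)
      (hy : y = some r) (lt : key < (S.node r).key)
  | decrease (k : K) (n c' : ℕ) (op : S.opOf u = some (.delete k n)) (R : (S.scx u).R = [r])
      (hk : key = k) (key_r : (S.node r).key = key) (snap : RecSnapshot S u r c' y)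
      (lt : n < c') (hc : c = c' - n)
  | remove (k : K) (n : ℕ) (x : Ptr) (op : S.opOf u = some (.delete k n))
      (R : (S.scx u).R = [r, x]) (key_r : (S.node r).key = (k : WithBot (WithTop K)))
      (key_x : (S.node x).key = key) (snap_r : RecSnapshot S u r n (some x))
      (snap_x : RecSnapshot S u x c y)

/-- The record `u` replaces the next pointer of `p` by `a`. -/
structure NextRecord (S : Ghost K) (u : RecPtr) (p r a : Ptr) (key : WithBot (WithTop K)) (c : ℕ)
    (y : Option Ptr) : Prop where
  V : (S.scx u).V = p :: (S.scx u).R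
  fld : (S.scx u).fld = .next p
  old : (S.scx u).old = .ptr (some r)
  new : (S.scx u).new = .ptr (some a)
  -- This makes next pointers increase in rank; the new node is allocated after everything that the
  -- snapshots mention.
  lt : r < a
  key_lt : (S.node p).key < key
  snap : ∃ c₀, RecSnapshot S u p c₀ (some r)
  new_node : NewNode S a key c y
  repl : Replacement S u r key c y

/-- What is known about an allocated SCX-record. -/
structure RecordOK (S : Ghost K) (u : RecPtr) : Prop where
  info_lt : ∀ r ∈ (S.scx u).V, (S.scx u).infoFields r < u
  kind : (∃ r k n c nx, CountRecord S u r k n c nx) ∨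
    ∃ p r a key c y, NextRecord S u p r a key c y

/-- The invariant of the shared memory. -/
structure Ghost.Inv (S : Ghost K) : Prop where
  sorted : Sorted S.heap
  recs_pos : 0 < S.heap.numRecs
  dummy_state : (S.scx dummy).state = .aborted
  dummy_allFrozen : (S.scx dummy).allFrozen = false
  froze_info : ∀ r, S.froze r (S.node r).info
  froze_dummy : ∀ r, S.froze r dummy
  froze_le : ∀ r u, S.froze r u → u ≤ (S.node r).info
  froze_lt : ∀ r u, S.froze r u → u < S.heap.numRecs
  froze_mem : ∀ r u, S.froze r u → u ≠ dummy → r ∈ (S.scx u).V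
  froze_done : ∀ r u, S.froze r u → (S.node r).info ≠ u → (S.scx u).state ≠ .inProgress
  -- Nodes are frozen in the order of `V`. Progress needs this: a record that holds a node can only
  -- have failed at a later one.
  froze_prefix : ∀ u l₁ r l₂, u ≠ dummy → (S.scx u).V = l₁ ++ r :: l₂ → S.froze r u →
    ∀ r' ∈ l₁, S.froze r' u
  -- Memory is a total function, so unallocated addresses have fields too. They look like new nodes
  -- as far as `info` and `marked` are concerned, hence allocation changes neither.
  unallocated : ∀ r, S.heap.numNodes ≤ r → (S.node r).info = dummy ∧ (S.node r).marked = false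
  aborted : ∀ u < S.heap.numRecs, u ≠ dummy → (S.scx u).state = .aborted → CannotFreeze S u
  committed : ∀ u < S.heap.numRecs, (S.scx u).state = .committed → S.updated u
  updated_lt : ∀ u, S.updated u → u < S.heap.numRecs
  updated_allFrozen : ∀ u, S.updated u → (S.scx u).allFrozen = true
  updated_marked : ∀ u, S.updated u → ∀ r ∈ (S.scx u).R, (S.node r).marked = true
  -- After the update the field never holds `old` again, so a second update CAS for `u` must fail.
  updated_rank : ∀ u, S.updated u →
    (S.scx u).old.rank < (S.heap.readFld (S.scx u).fld).rank
  allFrozen : ∀ u < S.heap.numRecs, (S.scx u).allFrozen = true → ∀ r ∈ (S.scx u).V, S.froze r u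
  listed : ∀ a, InList S.heap a → S.listed a
  listed_lt : ∀ a, S.listed a → a < S.heap.numNodes
  listed_next : ∀ a b, S.listed a → (S.node a).next = some b → S.listed b
  -- A node that has left the list still points to the record that removed it.
  listed_cases : ∀ a, S.listed a → InList S.heap a ∨
    a ∈ (S.scx (S.node a).info).R ∧ S.updated (S.node a).info
  removed : ∀ u a, S.updated u → a ∈ (S.scx u).R → ¬ InList S.heap a
  removed_info : ∀ u a, S.updated u → a ∈ (S.scx u).R → (S.node a).info = u
  marked : ∀ a, (S.node a).marked = true →
    ∃ u < S.heap.numRecs, (S.scx u).allFrozen = true ∧ a ∈ (S.scx u).R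
  record : ∀ u < S.heap.numRecs, u ≠ dummy → RecordOK S u
  -- Together with `new_inj`: only the update of its own record can bring a new node into the list.
  fresh : ∀ u < S.heap.numRecs, ∀ a, u ≠ dummy → (S.scx u).new = .ptr (some a) →
    ¬ S.updated u → ¬ S.listed a
  new_inj : ∀ u < S.heap.numRecs, ∀ v < S.heap.numRecs, ∀ a, u ≠ dummy → v ≠ dummy →
    (S.scx u).new = .ptr (some a) → (S.scx v).new = .ptr (some a) → u = v

/-- The memory `h'` arises from `h` by allocating a record `x` and perhaps a node. -/
structure Allocates (h h' : Heap K) (x : SCXRecord) : Prop where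
  nodes_le : h.numNodes ≤ h'.numNodes
  node : ∀ r < h.numNodes, h'.node r = h.node r
  info : ∀ r, h.numNodes ≤ r → (h'.node r).info = dummy ∧ (h'.node r).marked = false
  recs : h'.numRecs = h.numRecs + 1
  scx : h'.scx = Function.update h.scx h.numRecs x
  state : x.state = .inProgress
  allFrozen : x.allFrozen = false

/-- The effects of the steps on the shared memory, with the record for which the step is a
successful update CAS. -/
inductive Effect (S : Ghost K) : Heap K → Option RecPtr → Prop
  | skip : Effect S S.heap none
  | freeze (u r l₁ l₂) (lt : u < S.heap.numRecs) (ne : u ≠ dummy)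
      (hV : (S.scx u).V = l₁ ++ r :: l₂) (hl : ∀ r' ∈ l₁, S.froze r' u)
      (info : (S.node r).info = (S.scx u).infoFields r) :
      Effect S (S.heap.setNode r { S.heap.node r with info := u }) none
  | abort (u) (lt : u < S.heap.numRecs) (ne : u ≠ dummy) (h : CannotFreeze S u) :
      Effect S (S.heap.setSCX u { S.heap.scx u with state := .aborted }) none
  | frozen (u) (lt : u < S.heap.numRecs) (ne : u ≠ dummy)
      (h : ∀ r ∈ (S.scx u).V, S.froze r u) :
      Effect S (S.heap.setSCX u { S.heap.scx u with allFrozen := true }) none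
  | mark (u r) (lt : u < S.heap.numRecs) (ne : u ≠ dummy) (af : (S.scx u).allFrozen = true)
      (hr : r ∈ (S.scx u).R) :
      Effect S (S.heap.setNode r { S.heap.node r with marked := true }) none
  | update (u) (lt : u < S.heap.numRecs) (ne : u ≠ dummy) (af : (S.scx u).allFrozen = true)
      (hR : ∀ r ∈ (S.scx u).R, (S.node r).marked = true)
      (old : S.heap.readFld (S.scx u).fld = (S.scx u).old) :
      Effect S (S.heap.writeFld (S.scx u).fld (S.scx u).new) (some u)
  | commit (u) (h : S.updated u) :
      Effect S (S.heap.setSCX u { S.heap.scx u with state := .committed }) none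
  | allocate (h' x) (ha : Allocates S.heap h' x) (sorted : Sorted h')
      (rec : RecordOK (S.next h' none) S.heap.numRecs)
      (fresh : ∀ a, x.new = .ptr (some a) → S.heap.numNodes ≤ a) :
      Effect S h' none

/-- What every step guarantees. -/
structure Mono (S T : Ghost K) : Prop where
  nodes_le : S.heap.numNodes ≤ T.heap.numNodes
  recs_le : S.heap.numRecs ≤ T.heap.numRecs
  key : ∀ r < S.heap.numNodes, (T.node r).key = (S.node r).key
  info_le : ∀ r, (S.node r).info ≤ (T.node r).info
  V : ∀ u < S.heap.numRecs, (T.scx u).V = (S.scx u).V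
  R : ∀ u < S.heap.numRecs, (T.scx u).R = (S.scx u).R
  fld : ∀ u < S.heap.numRecs, (T.scx u).fld = (S.scx u).fld
  old : ∀ u < S.heap.numRecs, (T.scx u).old = (S.scx u).old
  new : ∀ u < S.heap.numRecs, (T.scx u).new = (S.scx u).new
  infoFields : ∀ u < S.heap.numRecs, (T.scx u).infoFields = (S.scx u).infoFields
  state : ∀ u < S.heap.numRecs, (S.scx u).state ≠ .inProgress →
    (T.scx u).state = (S.scx u).state
  allFrozen : ∀ u < S.heap.numRecs, (S.scx u).allFrozen = true → (T.scx u).allFrozen = true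
  marked : ∀ r, (S.node r).marked = true → (T.node r).marked = true
  froze : ∀ r u, S.froze r u → T.froze r u
  listed : ∀ a, S.listed a → T.listed a
  updated : ∀ u, S.updated u → T.updated u
  opOf : T.opOf = S.opOf
  froze_info : ∀ r, T.froze r (T.node r).info
  -- A freezing CAS leaves the fields alone and finds `info` as the `LLX` saw it, so the snapshot of
  -- the `LLX` is still valid when the node gets frozen.
  froze_new : ∀ r, ∀ u < S.heap.numRecs, T.froze r u → ¬ S.froze r u →
    (S.node r).info = (S.scx u).infoFields r ∧ (T.node r).count = (S.node r).count ∧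
      (T.node r).next = (S.node r).next
  rank : ∀ f : Fld, f.node < S.heap.numNodes →
    (S.heap.readFld f).rank ≤ (T.heap.readFld f).rank
  -- Freezing acts as a lock: fields are written only on behalf of the record in progress for which
  -- the node is frozen.
  changed : ∀ r < S.heap.numNodes,
    ((T.node r).count = (S.node r).count ∧ (T.node r).next = (S.node r).next) ∨
    ((S.scx (S.node r).info).state = .inProgress ∧ T.updated (S.node r).info)

end Ghost

/-! ### Consequences of the form of the SCX-records. -/

section RecordFacts

variable {K : Type*} [LinearOrder K] {S : Ghost K} {u : RecPtr}

lemma NextOK.key_lt {r b : Ptr} (h : NextOK S r (some b)) :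
    (S.node r).key < (S.node b).key ∧ b < S.heap.numNodes ∧ S.listed b := by
  by_cases hk : (S.node r).key = WithBot.some ⊤
  · exact absurd (h.1 hk) (by simp)
  · obtain ⟨c, hc, hbc, h1, h2⟩ := h.2 hk
    cases hbc
    exact ⟨h1, hc, h2⟩

lemma RecordOK.snap (h : RecordOK S u) {r : Ptr} (hr : r ∈ (S.scx u).V) :
    ∃ c nx, RecSnapshot S u r c nx := by
  rcases h.kind with ⟨r', k, n, c, nx, hc⟩ | ⟨p, r', a, key, c, y, hc⟩
  · rw [hc.V, List.mem_singleton] at hr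
    subst hr; exact ⟨_, _, hc.snap⟩
  · rw [hc.V] at hr
    rcases List.mem_cons.1 hr with rfl | hr
    · obtain ⟨c₀, h₀⟩ := hc.snap; exact ⟨_, _, h₀⟩
    · rcases hc.repl with ⟨k, h1, h2⟩ | ⟨k, n, c', op, R, h1, h2, h3⟩ | ⟨k, n, x, op, R, h1, h2, h3, h4⟩
      · rw [h2] at hr; cases hr
      · rw [R, List.mem_singleton] at hr; subst hr; exact ⟨_, _, h3⟩
      · rw [R] at hr
        simp only [List.mem_cons, List.not_mem_nil, or_false] at hr
        rcases hr with rfl | rfl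
        · exact ⟨_, _, h3⟩
        · exact ⟨_, _, h4⟩

/-- Each node of `V` is the successor of the preceding one in a snapshot. So all records freeze in
key order, which rules out cyclic conflicts. -/
lemma RecordOK.pairwise (h : RecordOK S u) :
    (S.scx u).V.Pairwise fun a b => (S.node a).key < (S.node b).key := by
  rcases h.kind with ⟨r', k, n, c, nx, hc⟩ | ⟨p, r', a, key, c, y, hc⟩
  · simp [hc.V]
  · obtain ⟨c₀, h₀⟩ := hc.snap
    have hpr := h₀.snapshot.next.key_lt.1
    rw [hc.V]
    rcases hc.repl with ⟨k, h1, h2⟩ | ⟨k, n, c', op, R, h1, h2, h3⟩ | ⟨k, n, x, op, R, h1, h2, h3, h4⟩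
    · simp [h2]
    · simpa [R] using hpr
    · have hrx := h3.snapshot.next.key_lt.1
      simp [R, hpr, hrx, hpr.trans hrx]

lemma RecordOK.nodup (h : RecordOK S u) : (S.scx u).V.Nodup :=
  h.pairwise.imp fun hab => by rintro rfl; exact lt_irrefl _ hab

lemma RecordOK.R_subset (h : RecordOK S u) {r : Ptr} (hr : r ∈ (S.scx u).R) :
    r ∈ (S.scx u).V := by
  rcases h.kind with ⟨r', k, n, c, nx, hc⟩ | ⟨p, r', a, key, c, y, hc⟩
  · rw [hc.R] at hr; cases hr
  · rw [hc.V]; exact List.mem_cons_of_mem _ hr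

lemma RecordOK.fld_mem (h : RecordOK S u) : (S.scx u).fld.node ∈ (S.scx u).V := by
  rcases h.kind with ⟨r', k, n, c, nx, hc⟩ | ⟨p, r', a, key, c, y, hc⟩
  · simp [hc.V, hc.fld, Fld.node]
  · simp [hc.V, hc.fld, Fld.node]

lemma RecordOK.fld_not_mem (h : RecordOK S u) : (S.scx u).fld.node ∉ (S.scx u).R := by
  have hn := h.nodup
  rcases h.kind with ⟨r', k, n, c, nx, hc⟩ | ⟨p, r', a, key, c, y, hc⟩
  · simp [hc.R]
  · rw [hc.V] at hn
    rw [hc.fld]; exact (List.nodup_cons.1 hn).1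

/-- A count grows because `n > 0`, and a next pointer moves to a newer address. A decreasing count
is realized by a new node and thus falls under the second case. -/
lemma RecordOK.rank_lt (h : RecordOK S u) : (S.scx u).old.rank < (S.scx u).new.rank := by
  rcases h.kind with ⟨r', k, n, c, nx, hc⟩ | ⟨p, r', a, key, c, y, hc⟩
  · rw [hc.old, hc.new]; exact Nat.lt_add_of_pos_right hc.pos
  · rw [hc.old, hc.new]; exact Nat.succ_lt_succ hc.lt

lemma RecordOK.length_le (h : RecordOK S u) :
    (S.scx u).V.length ≤ 3 ∧ (S.scx u).R.length ≤ 2 := by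
  rcases h.kind with ⟨r', k, n, c, nx, hc⟩ | ⟨p, r', a, key, c, y, hc⟩
  · simp [hc.V, hc.R]
  · rw [hc.V]
    rcases hc.repl with ⟨k, h1, h2⟩ | ⟨k, n, c', op, R, h1, h2, h3⟩ | ⟨k, n, x, op, R, h1, h2, h3, h4⟩
    · simp [h2]
    · simp [R]
    · simp [R]

/-- A write of the new value of a record reads back. -/
lemma RecordOK.readFld_writeFld (h : RecordOK S u) (hp : Heap K) :
    (hp.writeFld (S.scx u).fld (S.scx u).new).readFld (S.scx u).fld = (S.scx u).new := by
  rcases h.kind with ⟨r', k, n, c, nx, hc⟩ | ⟨p, r', a, key, c, y, hc⟩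
  · simp [hc.fld, hc.new, Heap.writeFld, Heap.readFld, Heap.setNode]
  · simp [hc.fld, hc.new, Heap.writeFld, Heap.readFld, Heap.setNode]

end RecordFacts

/-! ### Reading and writing fields. -/

section HeapLemmas

variable {K : Type*}

lemma Heap.writeFld_scx (h : Heap K) (f : Fld) (v : Val) : (h.writeFld f v).scx = h.scx := by
  cases f <;> cases v <;> rfl

lemma Heap.writeFld_numRecs (h : Heap K) (f : Fld) (v : Val) :
    (h.writeFld f v).numRecs = h.numRecs := by
  cases f <;> cases v <;> rfl

lemma Heap.writeFld_numNodes (h : Heap K) (f : Fld) (v : Val) :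
    (h.writeFld f v).numNodes = h.numNodes := by
  cases f <;> cases v <;> rfl

lemma Heap.writeFld_node_of_ne (h : Heap K) {f : Fld} (v : Val) {r : Ptr} (hr : r ≠ f.node) :
    (h.writeFld f v).node r = h.node r := by
  cases f <;> cases v <;> simp_all [Heap.writeFld, Heap.setNode, Fld.node]

lemma Heap.writeFld_node (h : Heap K) (f : Fld) (v : Val) (r : Ptr) :
    ((h.writeFld f v).node r).key = (h.node r).key ∧
    ((h.writeFld f v).node r).info = (h.node r).info ∧
    ((h.writeFld f v).node r).marked = (h.node r).marked := by
  cases f <;> cases v <;> simp only [Heap.writeFld, Heap.setNode, Function.update_apply,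
    and_self] <;> split_ifs with h <;> simp [h]

lemma Heap.writeFld_readFld_of_ne (h : Heap K) {f g : Fld} (v : Val) (hfg : g ≠ f) :
    (h.writeFld f v).readFld g = h.readFld g := by
  cases f <;> cases v <;> cases g <;>
    simp only [Heap.writeFld, Heap.setNode, Heap.readFld, Function.update_apply] <;>
    split_ifs <;> simp_all

lemma Heap.readFld_congr {h h' : Heap K} (f : Fld)
    (hn : (h'.node f.node).count = (h.node f.node).count ∧
      (h'.node f.node).next = (h.node f.node).next) : h'.readFld f = h.readFld f := by
  cases f
  · exact congrArg Val.num hn.1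
  · exact congrArg Val.ptr hn.2

end HeapLemmas

/-! ### Stability of assertions under the steps of other processes. -/

section Stability

variable {K : Type*} [LinearOrder K] {S T : Ghost K}

lemma Settled.mono (hS : S.Inv) (hT : Mono S T) {r : Ptr} {i : RecPtr} (h : Settled S r i) :
    Settled T r i := by
  have hi := hS.froze_lt _ _ h.froze
  have hst := hT.state i hi h.state
  exact ⟨hT.froze _ _ h.froze, hst ▸ h.state, by rw [hst, hT.R i hi]; exact h.not_mem⟩

lemma NextOK.mono (hT : Mono S T) {r : Ptr} (hr : r < S.heap.numNodes) {nx : Option Ptr}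
    (h : NextOK S r nx) : NextOK T r nx := by
  rw [NextOK, hT.key r hr]
  refine ⟨h.1, fun hk => ?_⟩
  obtain ⟨b, hb, h1, h2, h3⟩ := h.2 hk
  exact ⟨b, hb.trans_le hT.nodes_le, h1, by rwa [hT.key b hb], hT.listed _ h3⟩

/-- As long as `r.info` is a record that is done, the fields of `r` do not change. -/
lemma Mono.fields_eq_of_state (hT : Mono S T) {r : Ptr} (hr : r < S.heap.numNodes)
    (h : (S.scx (S.node r).info).state ≠ .inProgress) :
    (T.node r).count = (S.node r).count ∧ (T.node r).next = (S.node r).next :=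
  (hT.changed r hr).resolve_right fun h' => h h'.1

/-- There is no ABA on `info`: having been frozen for `i` bounds `info` below by `i`, and `info`
only grows, so a node with `info = i` now already had it before. -/
lemma Mono.info_eq (hS : S.Inv) (hT : Mono S T) {r : Ptr} {i : RecPtr} (hf : S.froze r i)
    (hi : (T.node r).info = i) : (S.node r).info = i :=
  le_antisymm (hi ▸ hT.info_le r) (hS.froze_le _ _ hf)

lemma Settled.fields_mono (hS : S.Inv) (hT : Mono S T) {r : Ptr} (hr : r < S.heap.numNodes)
    {i : RecPtr} (h : Settled S r i) (hi : (T.node r).info = i) :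
    (S.node r).info = i ∧ (T.node r).count = (S.node r).count ∧
      (T.node r).next = (S.node r).next := by
  have h1 := hT.info_eq hS h.froze hi
  exact ⟨h1, hT.fields_eq_of_state hr (h1 ▸ h.state)⟩

lemma Snapshot.mono (hS : S.Inv) (hT : Mono S T) {r : Ptr} {i : RecPtr} {c : ℕ}
    {nx : Option Ptr} (h : Snapshot S r i c nx) : Snapshot T r i c nx where
  lt := h.lt.trans_le hT.nodes_le
  listed := hT.listed _ h.listed
  settled := h.settled.mono hS hT
  same hi := by
    obtain ⟨h1, h2, h3⟩ := h.settled.fields_mono hS hT h.lt hi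
    rw [h2, h3]; exact h.same h1
  next := h.next.mono hT h.lt

/-- If the node was already frozen for `u`, it can be changed only by the update of `u`. If this
step freezes it, then `info` was as in the snapshot just before, and the snapshot applies. -/
lemma RecSnapshot.mono (hS : S.Inv) (hT : Mono S T) {u : RecPtr} (hu : u < S.heap.numRecs)
    {r : Ptr} {c : ℕ} {nx : Option Ptr} (h : RecSnapshot S u r c nx) :
    RecSnapshot T u r c nx where
  snapshot := by rw [hT.infoFields u hu]; exact h.snapshot.mono hS hT
  same hi hup := by
    by_cases hf : S.froze r u
    · have h1 := hT.info_eq hS hf hi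
      rcases hT.changed r h.snapshot.lt with ⟨h2, h3⟩ | ⟨_, h3⟩
      · rw [h2, h3]; exact h.same h1 fun h => hup (hT.updated _ h)
      · exact absurd (h1 ▸ h3) hup
    · obtain ⟨h1, h2, h3⟩ := hT.froze_new r u hu (hi ▸ hT.froze_info r) hf
      rw [h2, h3]; exact h.snapshot.same h1

lemma Ghost.Inv.mem_V_spec (hS : S.Inv) {r : Ptr} {u : RecPtr} (hu : u < S.heap.numRecs)
    (hd : u ≠ dummy) (hr : r ∈ (S.scx u).V) : r < S.heap.numNodes ∧ S.listed r := by
  obtain ⟨c, nx, h⟩ := (hS.record u hu hd).snap hr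
  exact ⟨h.snapshot.lt, h.snapshot.listed⟩

lemma Ghost.Inv.info_lt (hS : S.Inv) (r : Ptr) : (S.node r).info < S.heap.numRecs :=
  hS.froze_lt _ _ (hS.froze_info r)

lemma Ghost.Inv.info_ne_dummy (hS : S.Inv) {r : Ptr}
    (h : (S.scx (S.node r).info).state = .inProgress) : (S.node r).info ≠ dummy := by
  intro hd
  rw [hd, hS.dummy_state] at h
  cases h

/-- A change requires that the node be frozen for a record in progress, and records freeze only
nodes that have been in the list. -/
lemma Ghost.Inv.fields_eq_of_not_listed (hS : S.Inv) (hT : Mono S T) {a : Ptr}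
    (ha : a < S.heap.numNodes) (hl : ¬ S.listed a) :
    (T.node a).count = (S.node a).count ∧ (T.node a).next = (S.node a).next := by
  refine hT.fields_eq_of_state ha fun h => hl ?_
  have hd := hS.info_ne_dummy h
  exact (hS.mem_V_spec (hS.info_lt a) hd (hS.froze_mem _ _ (hS.froze_info a) hd)).2

lemma NewNode.mono (hS : S.Inv) (hT : Mono S T) {a : Ptr} {key : WithBot (WithTop K)} {c : ℕ}
    {y : Option Ptr} (h : NewNode S a key c y) : NewNode T a key c y where
  lt := h.lt.trans_le hT.nodes_le
  key := (hT.key a h.lt).trans h.key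
  fields hl := by
    have hl' : ¬ S.listed a := fun h => hl (hT.listed _ h)
    obtain ⟨h1, h2⟩ := hS.fields_eq_of_not_listed hT h.lt hl'
    rw [h1, h2]; exact h.fields hl'

/-- The `info` field has moved beyond the value that the freezing CAS expects and will not come
back, so the failure is permanent. -/
lemma CannotFreeze.mono (hT : Mono S T) {u : RecPtr} (hu : u < S.heap.numRecs)
    (h : CannotFreeze S u) : CannotFreeze T u := by
  obtain ⟨r, hr, hlt, hf⟩ := h
  refine ⟨r, by rwa [hT.V u hu], ?_, fun hf' => ?_⟩
  · rw [hT.infoFields u hu]; exact hlt.trans_le (hT.info_le r)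
  · exact hlt.ne' (hT.froze_new r u hu hf' hf).1

lemma CountRecord.mono (hS : S.Inv) (hT : Mono S T) {u : RecPtr} (hu : u < S.heap.numRecs)
    {r : Ptr} {k : K} {n c : ℕ} {nx : Option Ptr} (h : CountRecord S u r k n c nx) :
    CountRecord T u r k n c nx where
  op := hT.opOf ▸ h.op
  pos := h.pos
  V := (hT.V u hu).trans h.V
  R := (hT.R u hu).trans h.R
  fld := (hT.fld u hu).trans h.fld
  old := (hT.old u hu).trans h.old
  new := (hT.new u hu).trans h.new
  key := (hT.key r h.snap.snapshot.lt).trans h.key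
  snap := h.snap.mono hS hT hu

lemma Replacement.mono (hS : S.Inv) (hT : Mono S T) {u : RecPtr} (hu : u < S.heap.numRecs)
    {r : Ptr} (hr : r < S.heap.numNodes) {key : WithBot (WithTop K)} {c : ℕ} {y : Option Ptr}
    (h : Replacement S u r key c y) : Replacement T u r key c y := by
  rcases h with ⟨k, op, R, h1, h2, h3⟩ | ⟨k, n, c', op, R, h1, h2, h3, h4, h5⟩ |
    ⟨k, n, x, op, R, h1, h2, h3, h4⟩
  · exact .insert k (hT.opOf ▸ op) ((hT.R u hu).trans R) h1 h2 (by rwa [hT.key r hr])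
  · exact .decrease k n c' (hT.opOf ▸ op) ((hT.R u hu).trans R) h1 ((hT.key r hr).trans h2)
      (h3.mono hS hT hu) h4 h5
  · exact .remove k n x (hT.opOf ▸ op) ((hT.R u hu).trans R) ((hT.key r hr).trans h1)
      ((hT.key x h4.snapshot.lt).trans h2) (h3.mono hS hT hu) (h4.mono hS hT hu)

lemma NextRecord.mono (hS : S.Inv) (hT : Mono S T) {u : RecPtr} (hu : u < S.heap.numRecs)
    {p r a : Ptr} {key : WithBot (WithTop K)} {c : ℕ} {y : Option Ptr}
    (h : NextRecord S u p r a key c y) : NextRecord T u p r a key c y := by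
  obtain ⟨c₀, h₀⟩ := h.snap
  exact {
    V := by rw [hT.V u hu, hT.R u hu]; exact h.V
    fld := (hT.fld u hu).trans h.fld
    old := (hT.old u hu).trans h.old
    new := (hT.new u hu).trans h.new
    lt := h.lt
    key_lt := by rw [hT.key p h₀.snapshot.lt]; exact h.key_lt
    snap := ⟨c₀, h₀.mono hS hT hu⟩
    new_node := h.new_node.mono hS hT
    repl := h.repl.mono hS hT hu h₀.snapshot.next.key_lt.2.1 }

lemma RecordOK.mono (hS : S.Inv) (hT : Mono S T) {u : RecPtr} (hu : u < S.heap.numRecs)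
    (h : RecordOK S u) : RecordOK T u where
  info_lt := by rw [hT.V u hu, hT.infoFields u hu]; exact h.info_lt
  kind := by
    rcases h.kind with ⟨r', k, n, c, nx, hc⟩ | ⟨p, r', a, key, c, y, hc⟩
    · exact .inl ⟨_, _, _, _, _, hc.mono hS hT hu⟩
    · exact .inr ⟨_, _, _, _, _, _, hc.mono hS hT hu⟩

end Stability

/-! ### Every effect respects `Mono`. -/

section Guarantee

variable {K : Type*} [LinearOrder K] {S : Ghost K}

/-- The situation at a successful update CAS. -/
lemma Ghost.Inv.at_update (hS : S.Inv) {u : RecPtr} (hu : u < S.heap.numRecs) (hd : u ≠ dummy)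
    (haf : (S.scx u).allFrozen = true)
    (hold : S.heap.readFld (S.scx u).fld = (S.scx u).old) :
    ¬ S.updated u ∧ (S.scx u).state = .inProgress ∧ ∀ r ∈ (S.scx u).V, (S.node r).info = u := by
  -- After an earlier update the field would have a rank above that of `old`.
  have h1 : ¬ S.updated u := fun h => by
    have := hS.updated_rank u h
    rw [hold] at this; exact lt_irrefl _ this
  have hf := hS.allFrozen u hu haf
  -- A committed record has been updated. An aborted one has a node that was never frozen for it,
  -- contrary to `allFrozen`.
  have h2 : (S.scx u).state = .inProgress := by
    cases hst : (S.scx u).state with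
    | inProgress => rfl
    | committed => exact absurd (hS.committed u hu hst) h1
    | aborted =>
      obtain ⟨r, hr, _, hnf⟩ := hS.aborted u hu hd hst
      exact absurd (hf r hr) hnf
  refine ⟨h1, h2, fun r hr => ?_⟩
  by_contra h
  exact hS.froze_done r u (hf r hr) h h2

/-- A step that changes neither keys, counts and next pointers nor the immutable fields of
records satisfies the guarantee. -/
lemma Mono.of_frame (hS : S.Inv) {h : Heap K} {l : Option RecPtr}
    (nodes : S.heap.numNodes = h.numNodes) (recs : S.heap.numRecs = h.numRecs)
    (node : ∀ r, (h.node r).key = (S.node r).key ∧ (h.node r).count = (S.node r).count ∧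
      (h.node r).next = (S.node r).next)
    (info : ∀ r, (h.node r).info = (S.node r).info ∨ (S.node r).info ≤ (h.node r).info ∧
      (S.node r).info = (S.scx (h.node r).info).infoFields r)
    (marked : ∀ r, (S.node r).marked = true → (h.node r).marked = true)
    (scx : ∀ u, (h.scx u).V = (S.scx u).V ∧ (h.scx u).R = (S.scx u).R ∧
      (h.scx u).fld = (S.scx u).fld ∧ (h.scx u).old = (S.scx u).old ∧
      (h.scx u).new = (S.scx u).new ∧ (h.scx u).infoFields = (S.scx u).infoFields ∧
      ((S.scx u).state ≠ .inProgress → (h.scx u).state = (S.scx u).state) ∧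
      ((S.scx u).allFrozen = true → (h.scx u).allFrozen = true)) :
    Mono S (S.next h l) where
  nodes_le := nodes.le
  recs_le := recs.le
  key r _ := (node r).1
  info_le r := by rcases info r with h | h; exacts [h.ge, h.1]
  V u _ := (scx u).1
  R u _ := (scx u).2.1
  fld u _ := (scx u).2.2.1
  old u _ := (scx u).2.2.2.1
  new u _ := (scx u).2.2.2.2.1
  infoFields u _ := (scx u).2.2.2.2.2.1
  state u _ := (scx u).2.2.2.2.2.2.1
  allFrozen u _ := (scx u).2.2.2.2.2.2.2
  marked := marked
  froze _ _ h := .inl h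
  listed _ h := .inl h
  updated _ h := .inl h
  opOf := rfl
  froze_info _ := .inr rfl
  froze_new r u _ hf hnf := by
    rcases hf with hf | rfl
    · exact absurd hf hnf
    · rcases info r with h | h
      · exact absurd (h ▸ hS.froze_info r) hnf
      · exact ⟨h.2, (node r).2⟩
  rank f _ := by
    rw [Ghost.next_heap, Heap.readFld_congr f (node _).2]
  changed r _ := .inl (node r).2

lemma Mono.of_allocates (hS : S.Inv) {h : Heap K} {x : SCXRecord} (ha : Allocates S.heap h x) :
    Mono S (S.next h none) := by
  have hscx : ∀ u < S.heap.numRecs, h.scx u = S.scx u := fun u hu => by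
    rw [ha.scx, Function.update_of_ne hu.ne]
  -- A new node starts with the dummy record, which is also what unallocated addresses hold.
  have hinfo : ∀ r, (h.node r).info = (S.node r).info := fun r => by
    rcases lt_or_ge r S.heap.numNodes with hr | hr
    · rw [ha.node r hr]
    · rw [(ha.info r hr).1, (hS.unallocated r hr).1]
  exact {
    nodes_le := ha.nodes_le
    recs_le := by simp [ha.recs]
    key := fun r hr => by simp [ha.node r hr]
    info_le := fun r => (hinfo r).ge
    V := fun u hu => by simp [hscx u hu]
    R := fun u hu => by simp [hscx u hu]
    fld := fun u hu => by simp [hscx u hu]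
    old := fun u hu => by simp [hscx u hu]
    new := fun u hu => by simp [hscx u hu]
    infoFields := fun u hu => by simp [hscx u hu]
    state := fun u hu _ => by simp [hscx u hu]
    allFrozen := fun u hu _ => by simpa [hscx u hu]
    marked := fun r hm => by
      rcases lt_or_ge r S.heap.numNodes with hr | hr
      · simpa [ha.node r hr] using hm
      · rw [(hS.unallocated r hr).2] at hm; cases hm
    froze := fun _ _ h => .inl h
    listed := fun _ h => .inl h
    updated := fun _ h => .inl h
    opOf := rfl
    froze_info := fun _ => .inr rfl
    froze_new := fun r u _ hf hnf => by
      rcases hf with hf | rfl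
      · exact absurd hf hnf
      · exact absurd (hinfo r ▸ hS.froze_info r) hnf
    rank := fun f hf => by
      rw [Ghost.next_heap, Heap.readFld_congr (h := S.heap) (h' := h) f
        (by rw [ha.node _ hf]; exact ⟨rfl, rfl⟩)]
    changed := fun r hr => .inl (by simp [ha.node r hr]) }

lemma Mono.of_update (hS : S.Inv) {u : RecPtr} (hu : u < S.heap.numRecs) (hd : u ≠ dummy)
    (haf : (S.scx u).allFrozen = true)
    (hold : S.heap.readFld (S.scx u).fld = (S.scx u).old) :
    Mono S (S.next (S.heap.writeFld (S.scx u).fld (S.scx u).new) (some u)) := by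
  obtain ⟨hup, hst, hinfo⟩ := hS.at_update hu hd haf hold
  have hrec := hS.record u hu hd
  have hn := S.heap.writeFld_node (S.scx u).fld (S.scx u).new
  -- The only node written to is the one owning the field, and it belongs to `V`, hence is frozen
  -- for `u`.
  have hch (r : Ptr) : ((S.heap.writeFld (S.scx u).fld (S.scx u).new).node r).count =
        (S.node r).count ∧ ((S.heap.writeFld (S.scx u).fld (S.scx u).new).node r).next =
        (S.node r).next ∨ (S.node r).info = u := by
    by_cases hr : r = (S.scx u).fld.node
    · exact .inr (hinfo r (hr ▸ hrec.fld_mem))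
    · rw [S.heap.writeFld_node_of_ne _ hr]; exact .inl ⟨rfl, rfl⟩
  exact {
    nodes_le := by simp [Heap.writeFld_numNodes]
    recs_le := by simp [Heap.writeFld_numRecs]
    key := fun r _ => (hn r).1
    info_le := fun r => (hn r).2.1.ge
    V := fun u hu => by simp [Heap.writeFld_scx]
    R := fun u hu => by simp [Heap.writeFld_scx]
    fld := fun u hu => by simp [Heap.writeFld_scx]
    old := fun u hu => by simp [Heap.writeFld_scx]
    new := fun u hu => by simp [Heap.writeFld_scx]
    infoFields := fun u hu => by simp [Heap.writeFld_scx]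
    state := fun u hu _ => by simp [Heap.writeFld_scx]
    allFrozen := fun u hu _ => by simpa [Heap.writeFld_scx]
    marked := fun r hm => (hn r).2.2.trans hm
    froze := fun _ _ h => .inl h
    listed := fun _ h => .inl h
    updated := fun _ h => .inl h
    opOf := rfl
    froze_info := fun _ => .inr rfl
    froze_new := fun r v _ hf hnf => by
      rcases hf with hf | rfl
      · exact absurd hf hnf
      · exact absurd ((hn r).2.1 ▸ hS.froze_info r) hnf
    rank := fun f _ => by
      by_cases hf : f = (S.scx u).fld
      · subst hf
        simp only [Ghost.next_heap, hrec.readFld_writeFld]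
        rw [hold]; exact hrec.rank_lt.le
      · simp only [Ghost.next_heap, S.heap.writeFld_readFld_of_ne _ hf, le_refl]
    changed := fun r _ => (hch r).imp_right fun h => by
      rw [h]; exact ⟨hst, .inr rfl⟩ }

lemma Effect.mono (hS : S.Inv) {h : Heap K} {l : Option RecPtr} (he : Effect S h l) :
    Mono S (S.next h l) := by
  cases he with
  | skip => exact .of_frame hS rfl rfl (by simp) (by simp) (by simp) (by simp)
  | freeze u r l₁ l₂ lt ne hV hl info =>
    have hlt := (hS.record u lt ne).info_lt r (by simp [hV])
    refine .of_frame hS rfl rfl ?_ ?_ ?_ (by simp [Heap.setNode]) <;> intro r' <;>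
      by_cases hr : r' = r <;> simp [Heap.setNode, hr]
    exact .inr ⟨info ▸ hlt.le, info⟩
  | abort u lt ne hc =>
    refine .of_frame hS rfl rfl (by simp [Heap.setSCX]) (by simp [Heap.setSCX])
      (by simp [Heap.setSCX]) fun v => ?_
    by_cases hv : v = u
    · subst hv
      simp only [Heap.setSCX, Function.update_self, true_and, imp_self, and_true]
      intro hst
      cases h : (S.scx v).state with
      | inProgress => exact absurd h hst
      | aborted => rfl
      -- A committed record had all of `V` frozen, so a helper that cannot freeze some node cannot
      -- overwrite this state.
      | committed =>
        have hup := hS.committed v lt h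
        obtain ⟨r, hr, _, hnf⟩ := hc
        exact absurd (hS.allFrozen v lt (hS.updated_allFrozen v hup) r hr) hnf
    · simp [Heap.setSCX, hv]
  | frozen u lt ne hf =>
    refine .of_frame hS rfl rfl (by simp [Heap.setSCX]) (by simp [Heap.setSCX])
      (by simp [Heap.setSCX]) fun v => ?_
    by_cases hv : v = u
    · subst hv; simp [Heap.setSCX]
    · simp [Heap.setSCX, hv]
  | mark u r lt ne af hr =>
    refine .of_frame hS rfl rfl ?_ ?_ ?_ (by simp [Heap.setNode]) <;> intro r' <;>
      by_cases hr : r' = r <;> simp [Heap.setNode, hr]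
  | update u lt ne af hR old => exact .of_update hS lt ne af old
  | commit u hup =>
    refine .of_frame hS rfl rfl (by simp [Heap.setSCX]) (by simp [Heap.setSCX])
      (by simp [Heap.setSCX]) fun v => ?_
    by_cases hv : v = u
    · subst hv
      simp only [Heap.setSCX, Function.update_self, true_and, imp_self, and_true]
      intro hst
      cases h : (S.scx v).state with
      | inProgress => exact absurd h hst
      | committed => rfl
      -- Symmetrically, an updated record had all of `V` frozen and cannot have been aborted.
      | aborted =>
        have hlt := hS.updated_lt v hup
        have hd : v ≠ dummy := by
          rintro rfl
          have := hS.updated_allFrozen _ hup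
          rw [hS.dummy_allFrozen] at this; cases this
        obtain ⟨r, hr, _, hnf⟩ := hS.aborted v hlt hd h
        exact absurd (hS.allFrozen v hlt (hS.updated_allFrozen v hup) r hr) hnf
    · simp [Heap.setSCX, hv]
  | allocate h' x ha _ _ _ => exact .of_allocates hS ha

end Guarantee

/-! ### The list at a successful update CAS. -/

section UpdateCAS

variable {K : Type*} [LinearOrder K] {S : Ghost K}

/-- What holds just before a successful update CAS that changes a next pointer. -/
structure ReadyToReplace (S : Ghost K) (u : RecPtr) (p a : Ptr) (y : Option Ptr) : Prop where
  p_mem : InList S.heap p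
  R_mem : ∀ b ∈ (S.scx u).R, InList S.heap b
  a_lt : a < S.heap.numNodes
  a_fresh : ¬ S.listed a
  a_next : (S.node a).next = y
  p_not_mem : p ∉ (S.scx u).R
  key_lt : ∀ b ∈ (S.scx u).R, (S.node p).key < (S.node b).key
  key_a : (S.node p).key < (S.node a).key
  succ_p : (∃ d ∈ (S.scx u).R, (S.node p).next = some d) ∨ (S.node p).next = y
  succ_R : ∀ b ∈ (S.scx u).R,
    (∃ d ∈ (S.scx u).R, (S.node b).next = some d) ∨ (S.node b).next = y
  pred_R : ∀ d ∈ (S.scx u).R,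
    (S.node p).next = some d ∨ ∃ b ∈ (S.scx u).R, (S.node b).next = some d
  pred_y : ∀ d, y = some d →
    ((S.node p).next = some d ∨ ∃ b ∈ (S.scx u).R, (S.node b).next = some d) ∧
    ∀ b ∈ (S.scx u).R, (S.node b).key < (S.node d).key

/-- A node that has left the list has an updated record as its `info`; here `info` is `u`, which is
not yet updated. -/
lemma Ghost.Inv.inList_of_mem_V (hS : S.Inv) {u : RecPtr} (hu : u < S.heap.numRecs)
    (hd : u ≠ dummy) (haf : (S.scx u).allFrozen = true)
    (hold : S.heap.readFld (S.scx u).fld = (S.scx u).old) {r : Ptr} (hr : r ∈ (S.scx u).V) :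
    InList S.heap r := by
  obtain ⟨hup, -, hinfo⟩ := hS.at_update hu hd haf hold
  rcases hS.listed_cases r (hS.mem_V_spec hu hd hr).2 with h | ⟨_, h⟩
  · exact h
  · rw [hinfo r hr] at h; exact absurd h hup

/-- All of `V` is frozen for `u` and `u` is not updated, so the snapshots stored in the record
describe the present memory. The rest is read off from the three kinds of replacement. -/
lemma NextRecord.ready (hS : S.Inv) {u : RecPtr} (hu : u < S.heap.numRecs) (hd : u ≠ dummy)
    (haf : (S.scx u).allFrozen = true)
    (hold : S.heap.readFld (S.scx u).fld = (S.scx u).old) {p r a : Ptr}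
    {key : WithBot (WithTop K)} {c : ℕ} {y : Option Ptr} (h : NextRecord S u p r a key c y) :
    ReadyToReplace S u p a y ∧ (S.node p).next = some r ∧ (S.node a).count = c := by
  obtain ⟨hup, -, hinfo⟩ := hS.at_update hu hd haf hold
  have hin {r} := hS.inList_of_mem_V hu hd haf hold (r := r)
  have hrec := hS.record u hu hd
  have hpV : p ∈ (S.scx u).V := by simp [h.V]
  have hfresh := hS.fresh u hu a hd h.new hup
  obtain ⟨hac, hay⟩ := h.new_node.fields hfresh
  obtain ⟨c₀, h₀⟩ := h.snap
  have hpr := (h₀.same (hinfo p hpV) hup).2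
  have hpw := hrec.pairwise
  have hnd := hrec.nodup
  rw [h.V, List.pairwise_cons] at hpw
  rw [h.V, List.nodup_cons] at hnd
  have hR : ∀ b ∈ (S.scx u).R, b ∈ (S.scx u).V := fun b hb => hrec.R_subset hb
  refine ⟨?_, hpr, hac⟩
  refine {
    p_mem := hin hpV
    R_mem := fun b hb => hin (hR b hb)
    a_lt := h.new_node.lt
    a_fresh := hfresh
    a_next := hay
    p_not_mem := hnd.1
    key_lt := hpw.1
    key_a := h.new_node.key ▸ h.key_lt
    succ_p := ?_, succ_R := ?_, pred_R := ?_, pred_y := ?_ }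
  all_goals
    rcases h.repl with ⟨k, op, R, h1, h2, h3⟩ | ⟨k, n, c', op, R, h1, h2, h3, h4⟩ |
      ⟨k, n, x, op, R, h1, h2, h3, h4⟩
  · simp [R, hpr, h2]
  · simp [R, hpr]
  · simp [R, hpr]
  · simp [R]
  · have := (h3.same (hinfo r (hR r (by simp [R]))) hup).2
    simp [R, this]
  · have h5 := (h3.same (hinfo r (hR r (by simp [R]))) hup).2
    have h6 := (h4.same (hinfo x (hR x (by simp [R]))) hup).2
    simp [R, h5, h6]
  · simp [R]
  · simp [R, hpr]
  · have h5 := (h3.same (hinfo r (hR r (by simp [R]))) hup).2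
    simp [R, hpr, h5]
  · simp [R, hpr, h2]
  · intro d hy
    subst hy
    have := (h3.same (hinfo r (hR r (by simp [R]))) hup).2
    simp [R, this, h3.snapshot.next.key_lt.1]
  · intro d hy
    subst hy
    have h5 := (h3.same (hinfo r (hR r (by simp [R]))) hup).2
    have h6 := (h4.same (hinfo x (hR x (by simp [R]))) hup).2
    have h7 := h3.snapshot.next.key_lt.1
    have h8 := h4.snapshot.next.key_lt.1
    simp [R, h6, h8, h7.trans h8]

lemma NextRecord.writeFld_eq {u : RecPtr} {p r a : Ptr}
    {key : WithBot (WithTop K)} {c : ℕ} {y : Option Ptr} (h : NextRecord S u p r a key c y) :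
    S.heap.writeFld (S.scx u).fld (S.scx u).new =
      S.heap.setNode p { S.heap.node p with next := some a } := by
  rw [h.fld, h.new]; rfl

lemma CountRecord.writeFld_eq {u : RecPtr} {r : Ptr} {k : K} {n c : ℕ} {nx : Option Ptr}
    (h : CountRecord S u r k n c nx) : S.heap.writeFld (S.scx u).fld (S.scx u).new =
      S.heap.setNode r { S.heap.node r with count := c + n } := by
  rw [h.fld, h.new]; rfl

lemma ReadyToReplace.sorted (hS : S.Inv) {u : RecPtr} {p a : Ptr} {y : Option Ptr}
    (h : ReadyToReplace S u p a y) :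
    Sorted (S.heap.setNode p { S.heap.node p with next := some a }) := by
  have hkey : ∀ b, ((S.heap.setNode p { S.heap.node p with next := some a }).node b).key =
      (S.node b).key := fun b => by
    by_cases hb : b = p <;> simp [Heap.setNode, hb]
  refine ⟨hS.sorted.1, (hkey _).trans hS.sorted.2.1, fun b hb => ?_⟩
  simp only [hkey]
  by_cases hbp : b = p
  · subst hbp
    refine ⟨fun hk => ?_, fun _ => ⟨a, h.a_lt, by simp [Heap.setNode], h.key_a⟩⟩
    have := h.key_a
    rw [hk] at this
    exact absurd this (not_lt.2 le_top)
  · have hn : (S.heap.setNode p { S.heap.node p with next := some a }).node b = S.node b := by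
      simp [Heap.setNode, hbp]
    rw [hn]; exact hS.sorted.2.2 b hb

lemma ReadyToReplace.inList_iff (hS : S.Inv) {u : RecPtr} {p a : Ptr} {y : Option Ptr}
    (h : ReadyToReplace S u p a y) (b : Ptr) :
    InList (S.heap.setNode p { S.heap.node p with next := some a }) b ↔
      (InList S.heap b ∧ b ∉ (S.scx u).R) ∨ b = a := by
  have haL : ¬ InList S.heap a := fun ha => h.a_fresh (hS.listed a ha)
  have hap : a ≠ p := fun hap => haL (hap ▸ h.p_mem)
  refine inList_splice (y := y) h.p_mem h.p_not_mem haL ?_ ?_ ?_ ?_ ?_ ?_ h.succ_p ?_ b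
  · intro hh
    have := h.key_lt _ hh
    rw [hS.sorted.2.1] at this
    exact absurd this (not_lt.2 bot_le)
  · simp [Heap.setNode]
  · simp [Heap.setNode, hap, h.a_next]
  · intro b _ hbp; simp [Heap.setNode, hbp]
  -- Nothing outside `p` and `R` points into `R`, because predecessors in the list are unique.
  · intro b d hb hbp hbR hbd hd
    rcases h.pred_R d hd with hd' | ⟨b', hb', hd'⟩
    · exact hbp (hb.eq_of_next_eq hS.sorted h.p_mem hbd hd')
    · exact hbR (hb.eq_of_next_eq hS.sorted (h.R_mem b' hb') hbd hd' ▸ hb')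
  · exact fun b hb _ => h.succ_R b hb
  · intro d hy
    obtain ⟨h1, h2⟩ := h.pred_y d hy
    refine ⟨?_, fun hd => lt_irrefl _ (h2 d hd)⟩
    rcases h1 with h1 | ⟨b, hb, h1⟩
    · exact h.p_mem.next h1
    · exact (h.R_mem b hb).next h1

end UpdateCAS

/-! ### The general scheme for preservation of the invariant. -/

section Preservation

/-- Used to see that the place in `V` at which a helper freezes a node is the only place where the
node occurs. -/
lemma _root_.List.Nodup.prefix_eq {α : Type*} {r : α} {l₁ l₂ m₁ m₂ : List α}
    (hnd : (l₁ ++ r :: l₂).Nodup) (h : l₁ ++ r :: l₂ = m₁ ++ r :: m₂) : l₁ = m₁ := by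
  induction l₁ generalizing m₁ with
  | nil =>
    cases m₁ with
    | nil => rfl
    | cons y ys =>
      simp only [List.nil_append, List.cons_append, List.cons.injEq] at h
      simp [h.2] at hnd
  | cons x xs ih =>
    cases m₁ with
    | nil =>
      simp only [List.nil_append, List.cons_append, List.cons.injEq] at h
      simp [h.1] at hnd
    | cons y ys =>
      simp only [List.cons_append, List.cons.injEq] at h
      rw [h.1, ih (List.nodup_cons.1 hnd).2 h.2]

variable {K : Type*} [LinearOrder K] {S : Ghost K}

/-- The facts about a step from which the preservation of the invariant follows. -/
lemma Ghost.Inv.next_of (hS : S.Inv) {h : Heap K} {l : Option RecPtr}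
    (hT : Mono S (S.next h l)) (sorted : Sorted h)
    (info : ∀ r, (h.node r).info = (S.node r).info ∨ ∃ u l₁ l₂, u < S.heap.numRecs ∧ u ≠ dummy ∧
      (S.scx u).V = l₁ ++ r :: l₂ ∧ (∀ r' ∈ l₁, S.froze r' u) ∧
      (S.node r).info = (S.scx u).infoFields r ∧ (h.node r).info = u)
    (unalloc : ∀ r, h.numNodes ≤ r → (h.node r).info = dummy ∧ (h.node r).marked = false)
    (dummy_af : (h.scx dummy).allFrozen = false)
    (aborted : ∀ u < h.numRecs, u ≠ dummy → (h.scx u).state = .aborted →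
      u < S.heap.numRecs ∧ CannotFreeze S u)
    (committed : ∀ u < h.numRecs, (h.scx u).state = .committed → S.updated u)
    (allFrozen : ∀ u < h.numRecs, (h.scx u).allFrozen = true → u < S.heap.numRecs ∧
      ∀ r ∈ (S.scx u).V, S.froze r u)
    (marked : ∀ a, (h.node a).marked = true → (S.node a).marked = true ∨
      ∃ u < S.heap.numRecs, (S.scx u).allFrozen = true ∧ a ∈ (S.scx u).R)
    (lbl : ∀ u, l = some u → u < S.heap.numRecs ∧ u ≠ dummy ∧ (S.scx u).allFrozen = true ∧
      (∀ r ∈ (S.scx u).R, (S.node r).marked = true ∧ (S.node r).info = u ∧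
        (h.node r).info = u) ∧
      (S.scx u).old.rank < (h.readFld (S.scx u).fld).rank)
    (listed_next : ∀ a b, (S.listed a ∨ InList h a) → (h.node a).next = some b →
      S.listed b ∨ InList h b)
    (listed_cases : ∀ a, (S.listed a ∨ InList h a) → InList h a ∨
      a ∈ (S.scx (S.node a).info).R ∧ (S.updated (S.node a).info ∨ l = some (S.node a).info))
    (removed : ∀ u a, S.updated u ∨ l = some u → a ∈ (S.scx u).R → ¬ InList h a)
    (record : ∀ u < h.numRecs, S.heap.numRecs ≤ u → RecordOK (S.next h l) u)
    (fresh : ∀ u < h.numRecs, ∀ a, u ≠ dummy → (h.scx u).new = .ptr (some a) →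
      ¬ (S.updated u ∨ l = some u) → ¬ (S.listed a ∨ InList h a))
    (new_inj : ∀ u < h.numRecs, ∀ v < h.numRecs, ∀ a, u ≠ dummy → v ≠ dummy →
      (h.scx u).new = .ptr (some a) → (h.scx v).new = .ptr (some a) → u = v) :
    (S.next h l).Inv := by
  have hpos : dummy < S.heap.numRecs := hS.recs_pos
  -- An `info` field is overwritten only by a freezing CAS. Its expected value comes from a
  -- snapshot, whose record is done and did not finalize the node.
  have hinfo_done : ∀ r, (h.node r).info ≠ (S.node r).info →
      Settled S r (S.node r).info := by
    intro r hr
    rcases info r with h1 | ⟨u, l₁, l₂, hu, hd, hV, -, h2, h3⟩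
    · exact absurd h1 hr
    · obtain ⟨c, nx, h4⟩ := (hS.record u hu hd).snap (r := r) (by simp [hV])
      exact h2 ▸ h4.snapshot.settled
  have hupd_lt : ∀ u, (S.updated u ∨ l = some u) → u < S.heap.numRecs := by
    rintro u (h | h)
    · exact hS.updated_lt u h
    · exact (lbl u h).1
  -- A node finalized by `u` keeps `info = u` forever: to lose it, `u` would have to be settled for
  -- this node, which membership in `R` forbids.
  have hupd_info : ∀ u a, S.updated u → a ∈ (S.scx u).R → (h.node a).info = u := by
    intro u a hu ha
    by_contra hne
    have h1 := hS.removed_info u a hu ha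
    have h2 := hinfo_done a (by rw [h1]; exact hne)
    rw [h1] at h2
    have hlt := hS.updated_lt u hu
    have haf := hS.updated_allFrozen u hu
    cases hst : (S.scx u).state with
    | inProgress => exact h2.state hst
    | committed => exact h2.not_mem hst ha
    | aborted =>
      have hd : u ≠ dummy := by rintro rfl; rw [hS.dummy_allFrozen] at haf; cases haf
      obtain ⟨r, hr, _, hnf⟩ := hS.aborted u hlt hd hst
      exact hnf (hS.allFrozen u hlt haf r hr)
  exact {
    sorted := sorted
    recs_pos := hS.recs_pos.trans_le hT.recs_le
    dummy_state := (hT.state _ hpos (by simp [hS.dummy_state])).trans hS.dummy_state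
    dummy_allFrozen := dummy_af
    froze_info := fun _ => .inr rfl
    froze_dummy := fun r => .inl (hS.froze_dummy r)
    froze_le := by
      rintro r u (hf | rfl)
      · exact (hS.froze_le r u hf).trans (hT.info_le r)
      · exact le_rfl
    froze_lt := by
      rintro r u (hf | rfl)
      · exact (hS.froze_lt r u hf).trans_le hT.recs_le
      · rcases info r with h1 | ⟨u, l₁, l₂, hu, hd, hV, -, h2, h3⟩
        · rw [h1]; exact (hS.info_lt r).trans_le hT.recs_le
        · rw [h3]; exact hu.trans_le hT.recs_le
    froze_mem := by
      rintro r u (hf | rfl) hd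
      · rw [hT.V u (hS.froze_lt r u hf)]; exact hS.froze_mem r u hf hd
      · rcases info r with h1 | ⟨u, l₁, l₂, hu, hd', hV, -, h2, h3⟩
        · rw [h1] at hd ⊢
          rw [hT.V _ (hS.info_lt r)]; exact hS.froze_mem r _ (hS.froze_info r) hd
        · rw [h3, hT.V u hu, hV]; simp
    froze_done := by
      intro r u hf hne
      rcases hf with hf | hf
      · have hlt := hS.froze_lt r u hf
        by_cases h1 : (S.node r).info = u
        · have h2 := (hinfo_done r (by rw [h1]; exact hne)).state
          rw [h1] at h2
          rw [hT.state u hlt h2]; exact h2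
        · have h2 := hS.froze_done r u hf h1
          rw [hT.state u hlt h2]; exact h2
      · exact absurd hf hne
    froze_prefix := by
      intro u l₁ r l₂ hd hV hf r' hr'
      by_cases hf' : S.froze r u
      · rw [hT.V u (hS.froze_lt r u hf')] at hV
        exact .inl (hS.froze_prefix u l₁ r l₂ hd hV hf' r' hr')
      · have hf := hf.resolve_left hf'
        rcases info r with h1 | ⟨v, m₁, m₂, hv, hd', hV', h0, h2, h3⟩
        · exact absurd (hf ▸ h1 ▸ hS.froze_info r) hf'
        · rw [hf] at h3
          subst h3
          rw [hT.V u hv] at hV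
          -- The step freezes the node at some position of `V`. Without repetitions this is the
          -- given position, so the given prefix is the one already frozen.
          have hnd := (hS.record u hv hd).nodup
          rw [hV'] at hV
          rw [hV'] at hnd
          have : l₁ = m₁ := hnd.prefix_eq hV |>.symm
          exact .inl (h0 r' (this ▸ hr'))
    unallocated := unalloc
    aborted := fun u hu hd hst => by
      obtain ⟨h1, h2⟩ := aborted u hu hd hst
      exact h2.mono hT h1
    committed := fun u hu hst => .inl (committed u hu hst)
    updated_lt := fun u hu => (hupd_lt u hu).trans_le hT.recs_le
    updated_allFrozen := by
      intro u hu
      refine hT.allFrozen u (hupd_lt u hu) ?_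
      rcases hu with hu | hu
      · exact hS.updated_allFrozen u hu
      · exact (lbl u hu).2.2.1
    updated_marked := by
      intro u hu r hr
      rw [hT.R u (hupd_lt u hu)] at hr
      rcases hu with hu | hu
      · exact hT.marked r (hS.updated_marked u hu r hr)
      · exact hT.marked r ((lbl u hu).2.2.2.1 r hr).1
    updated_rank := by
      intro u hu
      rw [hT.fld u (hupd_lt u hu), hT.old u (hupd_lt u hu)]
      rcases hu with hu | hu
      · have hlt := hS.updated_lt u hu
        refine (hS.updated_rank u hu).trans_le (hT.rank _ ?_)
        have haf := hS.updated_allFrozen u hu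
        have hd : u ≠ dummy := by rintro rfl; rw [hS.dummy_allFrozen] at haf; cases haf
        exact (hS.mem_V_spec hlt hd (hS.record u hlt hd).fld_mem).1
      · exact (lbl u hu).2.2.2.2
    allFrozen := by
      intro u hu haf r hr
      obtain ⟨h1, h2⟩ := allFrozen u hu haf
      rw [hT.V u h1] at hr
      exact .inl (h2 r hr)
    listed := fun a ha => .inr ha
    listed_lt := by
      rintro a (ha | ha)
      · exact (hS.listed_lt a ha).trans_le hT.nodes_le
      · exact ha.lt_numNodes sorted
    listed_next := listed_next
    listed_cases := by
      intro a ha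
      rcases listed_cases a ha with h1 | ⟨h1, h2⟩
      · exact .inl h1
      · right
        have hinfo : (h.node a).info = (S.node a).info := by
          rcases h2 with h2 | h2
          · exact hupd_info _ a h2 h1
          · exact ((lbl _ h2).2.2.2.1 a h1).2.2
        rw [Ghost.next_node, hinfo, hT.R _ (hS.info_lt a)]
        exact ⟨h1, h2⟩
    removed := by
      intro u a hu ha
      rw [hT.R u (hupd_lt u hu)] at ha
      exact removed u a hu ha
    removed_info := by
      intro u a hu ha
      rw [hT.R u (hupd_lt u hu)] at ha
      rcases hu with hu | hu
      · exact hupd_info u a hu ha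
      · exact ((lbl u hu).2.2.2.1 a ha).2.2
    marked := by
      intro a ha
      obtain ⟨u, hu, h1, h2⟩ : ∃ u < S.heap.numRecs, (S.scx u).allFrozen = true ∧
          a ∈ (S.scx u).R := by
        rcases marked a ha with h1 | h1
        · exact hS.marked a h1
        · exact h1
      exact ⟨u, hu.trans_le hT.recs_le, hT.allFrozen u hu h1, by rwa [hT.R u hu]⟩
    record := by
      intro u hu hd
      rcases lt_or_ge u S.heap.numRecs with h1 | h1
      · exact (hS.record u h1 hd).mono hS hT h1
      · exact record u hu h1
    fresh := fresh
    new_inj := new_inj }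

/-- Preservation of the invariant by steps that do not change the list. -/
lemma Ghost.Inv.next_of_frame (hS : S.Inv) {h : Heap K} (hT : Mono S (S.next h none))
    (sorted : Sorted h)
    (node : ∀ r < S.heap.numNodes, (h.node r).next = (S.node r).next)
    (info : ∀ r, (h.node r).info = (S.node r).info ∨ ∃ u l₁ l₂, u < S.heap.numRecs ∧ u ≠ dummy ∧
      (S.scx u).V = l₁ ++ r :: l₂ ∧ (∀ r' ∈ l₁, S.froze r' u) ∧
      (S.node r).info = (S.scx u).infoFields r ∧ (h.node r).info = u)
    (unalloc : ∀ r, h.numNodes ≤ r → (h.node r).info = dummy ∧ (h.node r).marked = false)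
    (dummy_af : (h.scx dummy).allFrozen = false)
    (aborted : ∀ u < h.numRecs, u ≠ dummy → (h.scx u).state = .aborted →
      u < S.heap.numRecs ∧ CannotFreeze S u)
    (committed : ∀ u < h.numRecs, (h.scx u).state = .committed → S.updated u)
    (allFrozen : ∀ u < h.numRecs, (h.scx u).allFrozen = true → u < S.heap.numRecs ∧
      ∀ r ∈ (S.scx u).V, S.froze r u)
    (marked : ∀ a, (h.node a).marked = true → (S.node a).marked = true ∨
      ∃ u < S.heap.numRecs, (S.scx u).allFrozen = true ∧ a ∈ (S.scx u).R)
    (record : ∀ u < h.numRecs, S.heap.numRecs ≤ u → RecordOK (S.next h none) u)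
    (fresh : ∀ u < h.numRecs, S.heap.numRecs ≤ u → ∀ a, (h.scx u).new = .ptr (some a) →
      S.heap.numNodes ≤ a)
    (recs : h.numRecs ≤ S.heap.numRecs + 1) :
    (S.next h none).Inv := by
  have hin : ∀ a, InList h a ↔ InList S.heap a := fun a =>
    inList_congr fun a ha => node a (ha.lt_numNodes hS.sorted)
  have hl : ∀ a, S.listed a ∨ InList h a ↔ S.listed a := fun a => by
    rw [hin]; exact ⟨fun h => h.elim id (hS.listed a), .inl⟩
  refine hS.next_of hT sorted info unalloc dummy_af aborted committed allFrozen marked (by simp)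
    ?_ ?_ ?_ record ?_ ?_
  · intro a b ha hb
    rw [hl] at ha ⊢
    rw [node a (hS.listed_lt a ha)] at hb
    exact hS.listed_next a b ha hb
  · intro a ha
    rw [hl] at ha
    rw [hin]
    exact (hS.listed_cases a ha).imp_right fun h => ⟨h.1, .inl h.2⟩
  · intro u a hu ha
    rw [hin]
    exact hS.removed u a (hu.resolve_right (by simp)) ha
  · intro u hu a hd hn hup
    rw [hl]
    rcases lt_or_ge u S.heap.numRecs with h1 | h1
    · rw [← Ghost.next_scx S h none, hT.new u h1] at hn
      exact hS.fresh u h1 a hd hn fun h => hup (.inl h)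
    · exact fun h => (hS.listed_lt a h).not_ge (fresh u hu h1 a hn)
  · intro u hu v hv a hud hvd hnu hnv
    -- The new node of an old record is already allocated, so it differs from a node allocated by
    -- this step.
    have key : ∀ w < S.heap.numRecs, w ≠ dummy → (h.scx w).new = .ptr (some a) →
        (S.scx w).new = .ptr (some a) ∧ a < S.heap.numNodes := by
      intro w hw hwd hn
      rw [← Ghost.next_scx S h none, hT.new w hw] at hn
      refine ⟨hn, ?_⟩
      rcases (hS.record w hw hwd).kind with ⟨r', k, n, c, nx, hc⟩ | ⟨p, r', a', key, c, y, hc⟩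
      · rw [hc.new] at hn; cases hn
      · rw [hc.new] at hn; cases hn; exact hc.new_node.lt
    rcases lt_or_ge u S.heap.numRecs with h1 | h1 <;>
      rcases lt_or_ge v S.heap.numRecs with h2 | h2
    · exact hS.new_inj u h1 v h2 a hud hvd (key u h1 hud hnu).1 (key v h2 hvd hnv).1
    · exact absurd (key u h1 hud hnu).2 (fresh v hv h2 a hnv).not_gt
    · exact absurd (key v h2 hvd hnv).2 (fresh u hu h1 a hnu).not_gt
    -- Both records are new, and at most one record is allocated per step.
    · omega

end Preservation

/-! ### Preservation of the invariant by each effect. -/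

section Preservation

variable {K : Type*} [LinearOrder K] {S : Ghost K}

lemma Ghost.Inv.ne_dummy_of_updated (hS : S.Inv) {u : RecPtr} (h : S.updated u) : u ≠ dummy := by
  rintro rfl
  have := hS.updated_allFrozen _ h
  rw [hS.dummy_allFrozen] at this
  cases this

lemma Sorted.frame {h h' : Heap K} (hs : Sorted h) (hn : h'.numNodes = h.numNodes)
    (node : ∀ r, (h'.node r).key = (h.node r).key ∧ (h'.node r).next = (h.node r).next) :
    Sorted h' := by
  refine ⟨hn ▸ hs.1, (node _).1.trans hs.2.1, fun a ha => ?_⟩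
  simp only [hn, (node _).1, (node _).2] at ha ⊢
  exact hs.2.2 a ha

/-- Preservation of the invariant by steps that change only `state` and `allFrozen` of a
record. -/
lemma Ghost.Inv.next_of_setSCX (hS : S.Inv) {u : RecPtr} (hu : u < S.heap.numRecs)
    (hd : u ≠ dummy) {x : SCXRecord}
    (hT : Mono S (S.next (S.heap.setSCX u x) none))
    (aborted : x.state = .aborted → CannotFreeze S u)
    (committed : x.state = .committed → S.updated u)
    (allFrozen : x.allFrozen = true → ∀ r ∈ (S.scx u).V, S.froze r u) :
    (S.next (S.heap.setSCX u x) none).Inv := by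
  have hx : ∀ v, (S.heap.setSCX u x).scx v = if v = u then x else S.scx v := fun v => by
    simp [Heap.setSCX, Function.update_apply]
  refine hS.next_of_frame hT (hS.sorted.frame rfl fun _ => ⟨rfl, rfl⟩) (fun _ _ => rfl)
    (fun _ => .inl rfl) hS.unallocated ?_ ?_ ?_ ?_ (fun _ h => .inl h) ?_ ?_ (Nat.le_succ _)
  · rw [hx, if_neg hd.symm]; exact hS.dummy_allFrozen
  · intro v hv hvd hst
    rw [hx] at hst
    split_ifs at hst with h
    · subst h; exact ⟨hv, aborted hst⟩
    · exact ⟨hv, hS.aborted v hv hvd hst⟩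
  · intro v hv hst
    rw [hx] at hst
    split_ifs at hst with h
    · subst h; exact committed hst
    · exact hS.committed v hv hst
  · intro v hv haf
    rw [hx] at haf
    split_ifs at haf with h
    · subst h; exact ⟨hv, allFrozen haf⟩
    · exact ⟨hv, hS.allFrozen v hv haf⟩
  · intro v hv hv'; exact absurd hv hv'.not_gt
  · intro v hv hv'; exact absurd hv hv'.not_gt

/-- Preservation of the invariant by steps that change only `info` and `marked` of a node. -/
lemma Ghost.Inv.next_of_setNode (hS : S.Inv) {r : Ptr} (hr : r < S.heap.numNodes) {x : Node K}
    (hT : Mono S (S.next (S.heap.setNode r x) none))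
    (hx : x.key = (S.node r).key ∧ x.next = (S.node r).next)
    (info : x.info = (S.node r).info ∨ ∃ u l₁ l₂, u < S.heap.numRecs ∧ u ≠ dummy ∧
      (S.scx u).V = l₁ ++ r :: l₂ ∧ (∀ r' ∈ l₁, S.froze r' u) ∧
      (S.node r).info = (S.scx u).infoFields r ∧ x.info = u)
    (marked : x.marked = true → (S.node r).marked = true ∨
      ∃ u < S.heap.numRecs, (S.scx u).allFrozen = true ∧ r ∈ (S.scx u).R) :
    (S.next (S.heap.setNode r x) none).Inv := by
  have hn : ∀ v, (S.heap.setNode r x).node v = if v = r then x else S.node v := fun v => by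
    simp [Heap.setNode, Function.update_apply]
  refine hS.next_of_frame hT (hS.sorted.frame rfl fun v => ?_) (fun v _ => ?_) (fun v => ?_)
    (fun v hv => ?_) hS.dummy_allFrozen
    (fun v hv hd hst => ⟨hv, hS.aborted v hv hd hst⟩) hS.committed
    (fun v hv haf => ⟨hv, hS.allFrozen v hv haf⟩) (fun v => ?_) ?_ ?_ (Nat.le_succ _)
  · rw [hn]; split_ifs with h
    · subst h; exact hx
    · exact ⟨rfl, rfl⟩
  · rw [hn]; split_ifs with h
    · subst h; exact hx.2
    · rfl
  · rw [hn]; split_ifs with h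
    · subst h; exact info
    · exact .inl rfl
  · rw [hn, if_neg]
    · exact hS.unallocated v hv
    · rintro rfl; exact hv.not_gt hr
  · rw [hn]; split_ifs with h
    · subst h; exact marked
    · exact .inl
  · intro v hv hv'; exact absurd hv hv'.not_gt
  · intro v hv hv'; exact absurd hv hv'.not_gt

lemma Ghost.Inv.next_of_allocates (hS : S.Inv) {h : Heap K} {x : SCXRecord}
    (ha : Allocates S.heap h x) (sorted : Sorted h)
    (rec : RecordOK (S.next h none) S.heap.numRecs)
    (fresh : ∀ a, x.new = .ptr (some a) → S.heap.numNodes ≤ a) : (S.next h none).Inv := by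
  have hx : ∀ v, h.scx v = if v = S.heap.numRecs then x else S.scx v := fun v => by
    rw [ha.scx, Function.update_apply]
  have hlt : ∀ v < h.numRecs, v ≠ S.heap.numRecs → v < S.heap.numRecs := fun v hv hne => by
    rw [ha.recs] at hv; omega
  refine hS.next_of_frame (.of_allocates hS ha) sorted (fun r hr => by rw [ha.node r hr])
    (fun r => .inl ?_) (fun r hr => ha.info r (ha.nodes_le.trans hr)) ?_ ?_ ?_ ?_
    (fun r hm => ?_) ?_ ?_ ha.recs.le
  · rcases lt_or_ge r S.heap.numNodes with hr | hr
    · rw [ha.node r hr]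
    · rw [(ha.info r hr).1, (hS.unallocated r hr).1]
  · rw [hx, if_neg (show dummy ≠ S.heap.numRecs from hS.recs_pos.ne)]; exact hS.dummy_allFrozen
  · intro v hv hd hst
    rw [hx] at hst
    split_ifs at hst with h1
    · rw [ha.state] at hst; cases hst
    · exact ⟨hlt v hv h1, hS.aborted v (hlt v hv h1) hd hst⟩
  · intro v hv hst
    rw [hx] at hst
    split_ifs at hst with h1
    · rw [ha.state] at hst; cases hst
    · exact hS.committed v (hlt v hv h1) hst
  · intro v hv haf
    rw [hx] at haf
    split_ifs at haf with h1
    · rw [ha.allFrozen] at haf; cases haf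
    · exact ⟨hlt v hv h1, hS.allFrozen v (hlt v hv h1) haf⟩
  · rcases lt_or_ge r S.heap.numNodes with hr | hr
    · rw [ha.node r hr] at hm; exact .inl hm
    · rw [(ha.info r hr).2] at hm; cases hm
  · intro v hv hv'
    rw [ha.recs] at hv
    obtain rfl : v = S.heap.numRecs := by omega
    exact rec
  · intro v hv hv' a hn
    rw [ha.recs] at hv
    obtain rfl : v = S.heap.numRecs := by omega
    rw [hx, if_pos rfl] at hn
    exact fresh a hn

/-- The new node points to `r` itself or to the next pointer in a snapshot of a removed node. Either
way nothing reachable from the new node is new, so listed nodes stay closed under `next`. -/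
lemma NextRecord.y_listed {u : RecPtr} {p r a : Ptr} {key : WithBot (WithTop K)}
    {c : ℕ} {y : Option Ptr} (h : NextRecord S u p r a key c y) {d : Ptr} (hy : y = some d) :
    S.listed d := by
  subst hy
  obtain ⟨c₀, h₀⟩ := h.snap
  rcases h.repl with ⟨k, op, R, h1, h2, h3⟩ | ⟨k, n, c', op, R, h1, h2, h3, h4⟩ |
      ⟨k, n, x, op, R, h1, h2, h3, h4⟩
  · cases h2; exact h₀.snapshot.next.key_lt.2.2
  · exact h3.snapshot.next.key_lt.2.2
  · exact h4.snapshot.next.key_lt.2.2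

/-- Updates of a count and of a next pointer are treated together by means of the set `N` of nodes
that enter the list: it is empty in the first case and consists of the new node in the second. -/
lemma Ghost.Inv.next_of_update (hS : S.Inv) {u : RecPtr} (hu : u < S.heap.numRecs)
    (hd : u ≠ dummy) (haf : (S.scx u).allFrozen = true)
    (hR : ∀ r ∈ (S.scx u).R, (S.node r).marked = true)
    (hold : S.heap.readFld (S.scx u).fld = (S.scx u).old) :
    (S.next (S.heap.writeFld (S.scx u).fld (S.scx u).new) (some u)).Inv := by
  have hT := Mono.of_update hS hu hd haf hold
  obtain ⟨hup, hst, hinfo⟩ := hS.at_update hu hd haf hold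
  have hrec := hS.record u hu hd
  have hn := S.heap.writeFld_node (S.scx u).fld (S.scx u).new
  have hscx := S.heap.writeFld_scx (S.scx u).fld (S.scx u).new
  have hrecs := S.heap.writeFld_numRecs (S.scx u).fld (S.scx u).new
  have hnodes := S.heap.writeFld_numNodes (S.scx u).fld (S.scx u).new
  have hread := hrec.readFld_writeFld S.heap
  have hother : ∀ b, b ≠ (S.scx u).fld.node →
      (S.heap.writeFld (S.scx u).fld (S.scx u).new).node b = S.node b :=
    fun b hb => S.heap.writeFld_node_of_ne _ hb
  -- the effect on the list
  have hlist : Sorted (S.heap.writeFld (S.scx u).fld (S.scx u).new) ∧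
      ∃ N : Ptr → Prop, (∀ a, N a → ¬ S.listed a ∧ (S.scx u).new = .ptr (some a)) ∧
        (∀ b, InList (S.heap.writeFld (S.scx u).fld (S.scx u).new) b ↔
          (InList S.heap b ∧ b ∉ (S.scx u).R) ∨ N b) ∧
        (∀ a, (S.scx u).new = .ptr (some a) → N a) ∧
        (∀ a b, S.listed a ∨ N a →
          ((S.heap.writeFld (S.scx u).fld (S.scx u).new).node a).next = some b →
          S.listed b ∨ N b) := by
    rcases hrec.kind with ⟨r, k, n, c, nx, hc⟩ | ⟨p, r, a, key, c, y, hc⟩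
    · have hnx : ∀ b, ((S.heap.writeFld (S.scx u).fld (S.scx u).new).node b).next =
          (S.node b).next := fun b => by
        rw [hc.writeFld_eq]
        by_cases hb : b = r <;> simp [Heap.setNode, hb]
      refine ⟨hS.sorted.frame hnodes fun b => ⟨(hn b).1, hnx b⟩, fun _ => False, by simp, ?_,
        by simp [hc.new], ?_⟩
      · intro b
        rw [inList_congr fun a _ => hnx a]
        simp [hc.R]
      · intro a b ha hb
        rw [hnx] at hb
        exact .inl (hS.listed_next a b (by simpa using ha) hb)
    · obtain ⟨hr, hpr, hac⟩ := hc.ready hS hu hd haf hold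
      have hap : a ≠ p := fun h => hr.a_fresh (h ▸ hS.listed _ hr.p_mem)
      rw [hc.writeFld_eq]
      refine ⟨hr.sorted hS, (· = a), ?_, hr.inList_iff hS, ?_, ?_⟩
      · rintro _ rfl; exact ⟨hr.a_fresh, hc.new⟩
      · intro b hb
        rw [hc.new] at hb; cases hb; rfl
      · intro b d hb hbd
        by_cases hbp : b = p
        · subst hbp
          simp only [Heap.setNode, Function.update_self, Option.some.injEq] at hbd
          exact .inr hbd.symm
        · simp only [Heap.setNode, Function.update_of_ne hbp] at hbd
          rcases hb with hb | rfl
          · exact .inl (hS.listed_next b d hb hbd)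
          · exact .inl (hc.y_listed (hr.a_next ▸ hbd))
  obtain ⟨sorted, N, hN, hin, hN', hnext⟩ := hlist
  have hl : ∀ a, S.listed a ∨ InList (S.heap.writeFld (S.scx u).fld (S.scx u).new) a ↔
      S.listed a ∨ N a := fun a => by
    rw [hin]
    constructor
    · rintro (h | ⟨h, _⟩ | h)
      exacts [.inl h, .inl (hS.listed a h), .inr h]
    · rintro (h | h)
      exacts [.inl h, .inr (.inr h)]
  refine hS.next_of hT sorted (fun r => .inl (hn r).2.1) ?_ ?_ ?_ ?_ ?_ ?_ ?_ ?_ ?_ ?_ ?_ ?_ ?_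
  · intro r hr
    rw [(hn r).2.1, (hn r).2.2]
    exact hS.unallocated r (hnodes ▸ hr)
  · rw [hscx]; exact hS.dummy_allFrozen
  · rw [hscx, hrecs]; exact fun v hv hd hst => ⟨hv, hS.aborted v hv hd hst⟩
  · rw [hscx, hrecs]; exact hS.committed
  · rw [hscx, hrecs]; exact fun v hv haf => ⟨hv, hS.allFrozen v hv haf⟩
  · intro a ha
    rw [(hn a).2.2] at ha; exact .inl ha
  · rintro _ ⟨⟩
    refine ⟨hu, hd, haf, fun r hr => ?_, ?_⟩
    · have := hinfo r (hrec.R_subset hr)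
      exact ⟨hR r hr, this, (hn r).2.1.trans this⟩
    · rw [hread]; exact hrec.rank_lt
  · intro a b ha hb
    rw [hl] at ha ⊢
    exact hnext a b ha hb
  · intro a ha
    rw [hl] at ha
    rw [hin]
    rcases ha with ha | ha
    · rcases hS.listed_cases a ha with h | ⟨h1, h2⟩
      · by_cases haR : a ∈ (S.scx u).R
        · right
          rw [hinfo a (hrec.R_subset haR)]
          exact ⟨haR, .inr rfl⟩
        · exact .inl (.inl ⟨h, haR⟩)
      · exact .inr ⟨h1, .inl h2⟩
    · exact .inl (.inr ha)
  · intro v a hv ha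
    rw [hin]
    have hvd : v < S.heap.numRecs ∧ v ≠ dummy := by
      rcases hv with hv | hv
      · exact ⟨hS.updated_lt v hv, hS.ne_dummy_of_updated hv⟩
      · cases hv; exact ⟨hu, hd⟩
    have hal := (hS.mem_V_spec hvd.1 hvd.2 ((hS.record v hvd.1 hvd.2).R_subset ha)).2
    rintro (⟨h1, h2⟩ | h)
    · rcases hv with hv | hv
      · exact hS.removed v a hv ha h1
      · cases hv; exact h2 ha
    · exact (hN a h).1 hal
  · intro v hv hv'
    rw [hrecs] at hv; exact absurd hv hv'.not_gt
  · intro v hv a hvd hnew hup'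
    rw [hrecs] at hv
    rw [hscx] at hnew
    rw [hl]
    push Not at hup'
    rintro (h | h)
    · exact hS.fresh v hv a hvd hnew hup'.1 h
    -- A node cannot be the new node of two records, so the node entering the list belongs to no
    -- record other than `u`.
    · exact hup'.2 (congrArg some (hS.new_inj u hu v hv a hd hvd (hN a h).2 hnew))
  · rw [hscx, hrecs]; exact hS.new_inj

lemma Effect.inv (hS : S.Inv) {h : Heap K} {l : Option RecPtr} (he : Effect S h l) :
    (S.next h l).Inv := by
  have hT := he.mono hS
  cases he with
  | skip =>
    exact hS.next_of_frame hT hS.sorted (fun _ _ => rfl) (fun _ => .inl rfl) hS.unallocated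
      hS.dummy_allFrozen (fun u hu hd h => ⟨hu, hS.aborted u hu hd h⟩) hS.committed
      (fun u hu h => ⟨hu, hS.allFrozen u hu h⟩) (fun _ h => .inl h)
      (fun u hu hu' => absurd hu hu'.not_gt) (fun u hu hu' => absurd hu hu'.not_gt)
      (Nat.le_succ _)
  | freeze u r l₁ l₂ lt ne hV hl info =>
    exact hS.next_of_setNode (hS.mem_V_spec lt ne (r := r) (by simp [hV])).1 hT ⟨rfl, rfl⟩
      (.inr ⟨u, l₁, l₂, lt, ne, hV, hl, info, rfl⟩) .inl
  | abort u lt ne hc =>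
    exact hS.next_of_setSCX lt ne hT (fun _ => hc) (fun h => by cases h) (hS.allFrozen u lt)
  | frozen u lt ne hf =>
    exact hS.next_of_setSCX lt ne hT (hS.aborted u lt ne) (hS.committed u lt) (fun _ => hf)
  | mark u r lt ne af hr =>
    exact hS.next_of_setNode (hS.mem_V_spec lt ne ((hS.record u lt ne).R_subset hr)).1 hT
      ⟨rfl, rfl⟩ (.inl rfl) fun _ => .inr ⟨u, lt, af, hr⟩
  | update u lt ne af hR old => exact hS.next_of_update lt ne af hR old
  | commit u hup =>
    have lt := hS.updated_lt u hup
    exact hS.next_of_setSCX lt (hS.ne_dummy_of_updated hup) hT (fun h => by cases h)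
      (fun _ => hup) (hS.allFrozen u lt)
  | allocate h' x ha sorted rec fresh => exact hS.next_of_allocates ha sorted rec fresh

end Preservation

/-! ### What `Help` and `LLX` know at each program counter. -/

section HelpLLX

variable {K : Type*} [LinearOrder K] {S T : Ghost K}

/-- The record for which a step of `Help(u)` is a successful update CAS. -/
def helpLabel (h : Heap K) (u : RecPtr) : HelpPC → Option RecPtr
  | .updateCAS => if h.readFld (h.scx u).fld = (h.scx u).old then some u else none
  | _ => none

/-- What an invocation of `Help(u)` knows. -/
def HelpInv (S : Ghost K) (u : RecPtr) (pc : HelpPC) : Prop :=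
  u < S.heap.numRecs ∧ u ≠ dummy ∧ match pc with
  | .freeze todo => ∃ l, (S.scx u).V = l ++ todo ∧ ∀ r ∈ l, S.froze r u
  | .checkFrozen r todo => ∃ l, (S.scx u).V = l ++ r :: todo ∧ (∀ r ∈ l, S.froze r u) ∧
      (S.scx u).infoFields r < (S.node r).info
  -- The second alternative is that of a late helper: `u` has been committed and the node has since
  -- been frozen for another record.
  | .frozenCheck => CannotFreeze S u ∨ (S.scx u).state = .committed
  | .abort => CannotFreeze S u
  | .frozen => ∀ r ∈ (S.scx u).V, S.froze r u
  | .mark todo => (S.scx u).allFrozen = true ∧ ∃ l, (S.scx u).R = l ++ todo ∧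
      ∀ r ∈ l, (S.node r).marked = true
  | .updateCAS => (S.scx u).allFrozen = true ∧ ∀ r ∈ (S.scx u).R, (S.node r).marked = true
  | .commit => S.updated u

lemma HelpInv.mono (hT : Mono S T) {u : RecPtr} {pc : HelpPC} (h : HelpInv S u pc) :
    HelpInv T u pc := by
  obtain ⟨hu, hd, h⟩ := h
  refine ⟨hu.trans_le hT.recs_le, hd, ?_⟩
  cases pc with
  | freeze todo =>
    obtain ⟨l, h1, h2⟩ := h
    exact ⟨l, (hT.V u hu).trans h1, fun r hr => hT.froze _ _ (h2 r hr)⟩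
  | checkFrozen r todo =>
    obtain ⟨l, h1, h2, h3⟩ := h
    refine ⟨l, (hT.V u hu).trans h1, fun r hr => hT.froze _ _ (h2 r hr), ?_⟩
    rw [hT.infoFields u hu]; exact h3.trans_le (hT.info_le r)
  | frozenCheck =>
    exact h.imp (fun h => h.mono hT hu) fun h => (hT.state u hu (by simp [h])).trans h
  | abort => exact CannotFreeze.mono hT hu h
  | frozen => simp only [hT.V u hu]; exact fun r hr => hT.froze _ _ (h r hr)
  | mark todo =>
    obtain ⟨h0, l, h1, h2⟩ := h
    exact ⟨hT.allFrozen u hu h0, l, (hT.R u hu).trans h1, fun r hr => hT.marked _ (h2 r hr)⟩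
  | updateCAS =>
    simp only [hT.R u hu]
    exact ⟨hT.allFrozen u hu h.1, fun r hr => hT.marked _ (h.2 r hr)⟩
  | commit => exact hT.updated u h

lemma RecordOK.readFld_eq_old {u : RecPtr} (h : RecordOK S u)
    (hinfo : (S.node (S.scx u).fld.node).info = u) (hup : ¬ S.updated u) :
    S.heap.readFld (S.scx u).fld = (S.scx u).old := by
  rcases h.kind with ⟨r', k, n, c, nx, hc⟩ | ⟨p, r', a, key, c, y, hc⟩
  · rw [hc.fld] at hinfo
    rw [hc.fld, hc.old]
    exact congrArg Val.num (hc.snap.same hinfo hup).1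
  · rw [hc.fld] at hinfo
    rw [hc.fld, hc.old]
    obtain ⟨c₀, h₀⟩ := hc.snap
    exact congrArg Val.ptr (h₀.same hinfo hup).2

/-- A failing update CAS means that a helper was faster. Without an update, `u` would be in
progress, its nodes still frozen for it, and the field still as in the snapshot. -/
lemma Ghost.Inv.updated_of_ne_old (hS : S.Inv) {u : RecPtr} (hu : u < S.heap.numRecs)
    (hd : u ≠ dummy) (haf : (S.scx u).allFrozen = true)
    (hne : S.heap.readFld (S.scx u).fld ≠ (S.scx u).old) : S.updated u := by
  by_contra hup
  have hf := hS.allFrozen u hu haf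
  have hrec := hS.record u hu hd
  refine hne (hrec.readFld_eq_old ?_ hup)
  by_contra hinfo
  have hst := hS.froze_done _ u (hf _ hrec.fld_mem) hinfo
  cases h : (S.scx u).state with
  | inProgress => exact hst h
  | committed => exact hup (hS.committed u hu h)
  | aborted =>
    obtain ⟨r, hr, _, hnf⟩ := hS.aborted u hu hd h
    exact hnf (hf r hr)

lemma Ghost.Inv.not_cannotFreeze (hS : S.Inv) {u : RecPtr} (hu : u < S.heap.numRecs)
    (haf : (S.scx u).allFrozen = true) : ¬ CannotFreeze S u := by
  rintro ⟨r, hr, _, hnf⟩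
  exact hnf (hS.allFrozen u hu haf r hr)

/-- The result of a step of `Help(u)`. -/
def HelpPost (T : Ghost K) (u : RecPtr) : HelpPC ⊕ Bool → Prop
  | .inl pc => HelpInv T u pc
  | .inr true => (T.scx u).state = .committed
  | .inr false => (T.scx u).state = .aborted

lemma HelpInv.effect {u : RecPtr} {pc : HelpPC} (h : HelpInv S u pc) :
    Effect S (stepHelp S.heap u pc).1 (helpLabel S.heap u pc) := by
  obtain ⟨hu, hd, h⟩ := h
  cases pc with
  | freeze todo =>
    cases todo with
    | nil => exact .skip
    | cons r rs =>
      obtain ⟨l, h1, h2⟩ := h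
      simp only [stepHelp, helpLabel]
      split_ifs with hi
      · exact .freeze u r l rs hu hd h1 h2 hi
      · exact .skip
  | checkFrozen r todo =>
    simp only [stepHelp, helpLabel]
    split_ifs <;> exact .skip
  | frozenCheck =>
    simp only [stepHelp, helpLabel]
    split_ifs <;> exact .skip
  | abort => exact .abort u hu hd h
  | frozen => exact .frozen u hu hd h
  | mark todo =>
    cases todo with
    | nil => exact .skip
    | cons r rs =>
      obtain ⟨h0, l, h1, h2⟩ := h
      exact .mark u r hu hd h0 (by simp [h1])
  | updateCAS =>
    simp only [stepHelp, helpLabel]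
    split_ifs with hi
    · exact .update u hu hd h.1 h.2 hi
    · exact .skip
  | commit => exact .commit u h

/-- The delicate exit is the frozen check: `allFrozen` rules out that some node can no longer be
frozen, so the CAS failed because `u` is already committed, and returning true is right. -/
lemma HelpInv.post (hS : S.Inv) {u : RecPtr} {pc : HelpPC} (h : HelpInv S u pc) :
    HelpPost (S.next (stepHelp S.heap u pc).1 (helpLabel S.heap u pc)) u
      (stepHelp S.heap u pc).2 := by
  have hT := h.effect.mono hS
  have hm := h.mono hT
  obtain ⟨hu, hd, h⟩ := h
  obtain ⟨hu', -, hm⟩ := hm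
  cases pc with
  | freeze todo =>
    cases todo with
    | nil =>
      obtain ⟨l, h1, h2⟩ := hm
      refine ⟨hu', hd, ?_⟩
      rw [List.append_nil] at h1
      exact h1 ▸ h2
    | cons r rs =>
      obtain ⟨l, h1, h2⟩ := hm
      have hV : r ∈ (S.scx u).V := by
        rw [← hT.V u hu, h1]; simp
      by_cases hi : (S.heap.node r).info = (S.heap.scx u).infoFields r
      · simp only [stepHelp, helpLabel, if_pos hi] at h1 h2 hu' ⊢
        refine ⟨hu', hd, l ++ [r], h1.trans (by simp), fun r' hr' => ?_⟩
        rcases List.mem_append.1 hr' with hr' | hr'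
        · exact h2 r' hr'
        · rw [List.mem_singleton] at hr'; subst hr'
          exact .inr (by simp [Heap.setNode])
      · simp only [stepHelp, helpLabel, if_neg hi] at h1 h2 hu' ⊢
        refine ⟨hu', hd, l, h1, h2, ?_⟩
        obtain ⟨c, nx, hs⟩ := (hS.record u hu hd).snap hV
        -- The expected record once froze the node, so it is at most the present `info`; the failed
        -- CAS excludes equality.
        exact lt_of_le_of_ne (hS.froze_le _ _ hs.snapshot.settled.froze) (Ne.symm hi)
  | checkFrozen r todo =>
    obtain ⟨l, h1, h2, h3⟩ := hm
    obtain ⟨l', h1', h2', h3'⟩ := h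
    have hV : r ∈ (S.scx u).V := by simp [h1']
    by_cases hi : (S.heap.node r).info ≠ u
    · simp only [stepHelp, helpLabel, if_pos hi] at h1 h2 h3 hu' ⊢
      refine ⟨hu', hd, ?_⟩
      -- If the node was frozen for `u` and has lost this, then `u` is done. Otherwise its `info`
      -- has overtaken the expected value for good.
      by_cases hf : S.froze r u
      · cases hst : (S.scx u).state with
        | inProgress => exact absurd hst (hS.froze_done r u hf hi)
        | committed => exact .inr hst
        | aborted => exact .inl ((hS.aborted u hu hd hst).mono
            (Effect.skip.mono hS) hu)
      · exact .inl (CannotFreeze.mono (Effect.skip.mono hS) hu ⟨r, hV, h3', hf⟩)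
    · simp only [stepHelp, helpLabel, if_neg hi] at h1 h2 h3 hu' ⊢
      push Not at hi
      refine ⟨hu', hd, l ++ [r], h1.trans (by simp), fun r' hr' => ?_⟩
      rcases List.mem_append.1 hr' with hr' | hr'
      · exact h2 r' hr'
      · rw [List.mem_singleton] at hr'; subst hr'
        exact .inr hi
  | frozenCheck =>
    by_cases haf : (S.heap.scx u).allFrozen = true
    · simp only [stepHelp, helpLabel, if_pos haf] at hm ⊢
      exact h.resolve_left (hS.not_cannotFreeze hu haf)
    · simp only [stepHelp, helpLabel, if_neg haf] at hm hu' ⊢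
      refine ⟨hu', hd, hm.resolve_right fun hst => haf ?_⟩
      exact hS.updated_allFrozen u (hS.committed u hu hst)
  | abort => simp [stepHelp, HelpPost, Heap.setSCX]
  | frozen =>
    refine ⟨hu', hd, ?_, [], ?_, by simp⟩
    · simp [stepHelp, Heap.setSCX]
    · simp [stepHelp, Heap.setSCX]
  | mark todo =>
    cases todo with
    | nil =>
      obtain ⟨h0, l, h1, h2⟩ := hm
      rw [List.append_nil] at h1
      exact ⟨hu', hd, h0, h1 ▸ h2⟩
    | cons r rs =>
      obtain ⟨h0, l, h1, h2⟩ := hm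
      refine ⟨hu', hd, h0, l ++ [r], h1.trans (by simp), fun r' hr' => ?_⟩
      rcases List.mem_append.1 hr' with hr' | hr'
      · exact h2 r' hr'
      · rw [List.mem_singleton] at hr'; subst hr'
        simp [stepHelp, Heap.setNode]
  | updateCAS =>
    by_cases hi : S.heap.readFld (S.heap.scx u).fld = (S.heap.scx u).old
    · simp only [stepHelp, helpLabel, if_pos hi] at hu' ⊢
      exact ⟨hu', hd, .inr rfl⟩
    · simp only [stepHelp, helpLabel, if_neg hi] at hu' ⊢
      exact ⟨hu', hd, .inl (hS.updated_of_ne_old hu hd h.1 hi)⟩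
  | commit => simp [stepHelp, HelpPost, Heap.setSCX]

lemma HelpInv.start {u : RecPtr} (hu : u < S.heap.numRecs) (hd : u ≠ dummy) :
    HelpInv S u (startHelp S.heap u) :=
  ⟨hu, hd, [], by simp, by simp⟩

/-- The record for which a step of `LLX` is a successful update CAS. -/
def llxLabel (h : Heap K) : LLXPC → Option RecPtr
  | .helpFinal _ u pc => helpLabel h u pc
  | .helpFail u pc => helpLabel h u pc
  | _ => none

/-- What an invocation of `LLX(r)` knows. -/
def LLXInv (S : Ghost K) (r : Ptr) : LLXPC → Prop
  | .readMarked1 => True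
  | .readInfo _ => True
  | .readState _ i => S.froze r i
  | .readMarked2 _ i st => S.froze r i ∧ (st ≠ .inProgress → (S.scx i).state = st)
  | .readCount _ i => Settled S r i
  | .readNext _ i c => Settled S r i ∧ ((S.node r).info = i → (S.node r).count = c)
  | .reread _ i c nx => Settled S r i ∧
      ((S.node r).info = i → (S.node r).count = c ∧ (S.node r).next = nx) ∧ NextOK S r nx
  | .testCommitted _ i => S.froze r i
  | .testInProgress _ i => S.froze r i
  | .helpFinal _ u pc => HelpInv S u pc
  | .failInfo => True
  | .failState x => S.froze r x
  | .failInfoAgain => (S.node r).info ≠ dummy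
  | .helpFail u pc => HelpInv S u pc

lemma LLXInv.mono (hS : S.Inv) (hT : Mono S T) {r : Ptr} (hr : S.listed r) {pc : LLXPC}
    (h : LLXInv S r pc) : LLXInv T r pc := by
  have hlt := hS.listed_lt r hr
  cases pc with
  | readMarked1 => trivial
  | readInfo m => trivial
  | readState m i => exact hT.froze _ _ h
  | readMarked2 m i st =>
    refine ⟨hT.froze _ _ h.1, fun hst => ?_⟩
    have := h.2 hst
    exact (hT.state i (hS.froze_lt _ _ h.1) (this ▸ hst)).trans this
  | readCount m i => exact Settled.mono hS hT h
  | readNext m i c =>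
    refine ⟨h.1.mono hS hT, fun hi => ?_⟩
    obtain ⟨h1, h2, h3⟩ := h.1.fields_mono hS hT hlt hi
    rw [h2]; exact h.2 h1
  | reread m i c nx =>
    refine ⟨h.1.mono hS hT, fun hi => ?_, h.2.2.mono hT hlt⟩
    obtain ⟨h1, h2, h3⟩ := h.1.fields_mono hS hT hlt hi
    rw [h2, h3]; exact h.2.1 h1
  | testCommitted m i => exact hT.froze _ _ h
  | testInProgress m i => exact hT.froze _ _ h
  | helpFinal m u pc => exact HelpInv.mono hT h
  | failInfo => trivial
  | failState x => exact hT.froze _ _ h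
  | failInfoAgain =>
    -- The dummy record has address `0` and `info` only grows, so a node that has left it never
    -- returns to it.
    have h1 : 0 < (S.node r).info := Nat.pos_of_ne_zero h
    exact (h1.trans_le (hT.info_le r)).ne'
  | helpFail u pc => exact HelpInv.mono hT h

lemma Ghost.Inv.nextOK (hS : S.Inv) {r : Ptr} (hr : S.listed r) :
    NextOK S r (S.node r).next := by
  obtain ⟨h1, h2⟩ := hS.sorted.2.2 r (hS.listed_lt r hr)
  refine ⟨h1, fun hk => ?_⟩
  obtain ⟨b, hb, h3, h4⟩ := h2 hk
  exact ⟨b, hb, h3, h4, hS.listed_next r b hr h3⟩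

/-- A node whose `info` record is settled is still in the list. -/
lemma Settled.inList (hS : S.Inv) {r : Ptr} (hr : S.listed r) {i : RecPtr} (h : Settled S r i)
    (hi : (S.node r).info = i) : InList S.heap r := by
  rcases hS.listed_cases r hr with h1 | ⟨h1, h2⟩
  · exact h1
  · rw [hi] at h1 h2
    have hlt := hS.updated_lt _ h2
    cases hst : (S.scx i).state with
    | inProgress => exact absurd hst h.state
    | committed => exact absurd h1 (h.not_mem hst)
    | aborted =>
      exact absurd (hS.aborted i hlt (hS.ne_dummy_of_updated h2) hst)
        (hS.not_cannotFreeze hlt (hS.updated_allFrozen i h2))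

/-- The result of a step of `LLX(r)`. -/
def LLXPost (T : Ghost K) (r : Ptr) (tbl tbl' : Table) : LLXPC ⊕ LLXResult → Prop
  | .inl pc => tbl' = tbl ∧ LLXInv T r pc
  | .inr (.snapshot c nx) => ∃ i, tbl' = Function.update tbl r ⟨i, c, nx⟩ ∧
      Snapshot T r i c nx ∧ (T.node r).info = i ∧ InList T.heap r ∧ (T.node r).count = c
  | .inr _ => tbl' = tbl

lemma LLXInv.effect {r : Ptr} {tbl : Table} {pc : LLXPC} (h : LLXInv S r pc) :
    Effect S (stepLLX S.heap tbl r pc).1 (llxLabel S.heap pc) := by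
  cases pc with
  | helpFinal m u pc =>
    have := HelpInv.effect h
    revert this
    simp only [stepLLX, llxLabel]
    rcases stepHelp S.heap u pc with ⟨h₁, pc₁ | b⟩ <;> exact id
  | helpFail u pc =>
    have := HelpInv.effect h
    revert this
    simp only [stepLLX, llxLabel]
    rcases stepHelp S.heap u pc with ⟨h₁, pc₁ | b⟩ <;> exact id
  | readMarked2 m i st => simp only [stepLLX, llxLabel]; split_ifs <;> exact .skip
  | reread m i c nx => simp only [stepLLX, llxLabel]; split_ifs <;> exact .skip
  | testCommitted m i => simp only [stepLLX, llxLabel]; split_ifs <;> exact .skip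
  | testInProgress m i => simp only [stepLLX, llxLabel]; split_ifs <;> exact .skip
  | failState x => simp only [stepLLX, llxLabel]; split_ifs <;> exact .skip
  | _ => exact .skip

lemma LLXInv.post (hS : S.Inv) {r : Ptr} (hr : S.listed r) {tbl : Table} {pc : LLXPC}
    (h : LLXInv S r pc) :
    LLXPost (S.next (stepLLX S.heap tbl r pc).1 (llxLabel S.heap pc)) r tbl
      (stepLLX S.heap tbl r pc).2.1 (stepLLX S.heap tbl r pc).2.2 := by
  have hT := (h.effect (tbl := tbl)).mono hS
  have hm := h.mono hS hT hr
  have hsk := Effect.skip.mono hS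
  have hlt := hS.listed_lt r hr
  cases pc with
  | readMarked1 => exact ⟨rfl, trivial⟩
  | readInfo m => exact ⟨rfl, .inr rfl⟩
  | readState m i => exact ⟨rfl, hm, fun _ => rfl⟩
  | readMarked2 m i st =>
    by_cases hi : st = .aborted ∨ (st = .committed ∧ (S.heap.node r).marked = false)
    · simp only [stepLLX, llxLabel, if_pos hi]
      refine ⟨rfl, Settled.mono hS hsk ⟨h.1, ?_, ?_⟩⟩
      · rcases hi with rfl | ⟨rfl, _⟩ <;> simp [h.2]
      · intro hst hR
        -- Marking precedes the update and hence the commit. So an unmarked node whose record is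
        -- committed was not finalized by that record.
        have := hS.updated_marked i (hS.committed i (hS.froze_lt _ _ h.1) hst) r hR
        rcases hi with rfl | ⟨rfl, hmk⟩
        · rw [h.2 (by simp)] at hst; cases hst
        · rw [hmk] at this; cases this
    · simp only [stepLLX, llxLabel, if_neg hi]
      exact ⟨rfl, hsk.froze _ _ h.1⟩
  | readCount m i => exact ⟨rfl, hm, fun _ => rfl⟩
  | readNext m i c => exact ⟨rfl, hm.1, fun hi => ⟨hm.2 hi, rfl⟩, (hS.nextOK hr).mono hsk hlt⟩
  | reread m i c nx =>
    by_cases hi : (S.heap.node r).info = i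
    · simp only [stepLLX, llxLabel, if_pos hi]
      exact ⟨i, rfl, Snapshot.mono hS hsk ⟨hlt, hr, h.1, h.2.1, h.2.2⟩, hi,
        h.1.inList hS hr hi, (h.2.1 hi).1⟩
    · simp only [stepLLX, llxLabel, if_neg hi]
      exact ⟨rfl, hsk.froze _ _ h.1.froze⟩
  | testCommitted m i =>
    by_cases hi : (S.heap.scx i).state = .committed
    · simp only [stepLLX, llxLabel, if_pos hi]
      split_ifs
      · exact rfl
      · exact ⟨rfl, trivial⟩
    · simp only [stepLLX, llxLabel, if_neg hi]
      exact ⟨rfl, hsk.froze _ _ h⟩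
  | testInProgress m i =>
    by_cases hi : (S.heap.scx i).state = .inProgress
    · simp only [stepLLX, llxLabel, if_pos hi]
      refine ⟨rfl, HelpInv.start (S := S.next S.heap none) (hS.froze_lt _ _ h) ?_⟩
      rintro rfl
      rw [hS.dummy_state] at hi; cases hi
    · simp only [stepLLX, llxLabel, if_neg hi]
      exact ⟨rfl, trivial⟩
  | helpFinal m u pc =>
    have := HelpInv.post hS h
    revert this
    simp only [stepLLX, llxLabel]
    rcases stepHelp S.heap u pc with ⟨h₁, pc₁ | b⟩
    · exact fun h => ⟨rfl, h⟩
    · intro _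
      dsimp only
      split_ifs
      · exact rfl
      · exact ⟨rfl, trivial⟩
  | failInfo => exact ⟨rfl, .inr rfl⟩
  | failState x =>
    by_cases hi : (S.heap.scx x).state = .inProgress
    · simp only [stepLLX, llxLabel, if_pos hi]
      refine ⟨rfl, fun hd => ?_⟩
      -- The record may have changed since it was read, but it can only be newer than `x`, and `x`,
      -- being in progress, is not the dummy record.
      have h1 : x ≤ dummy := hd ▸ hS.froze_le _ _ h
      obtain rfl : x = dummy := Nat.le_zero.1 h1
      rw [hS.dummy_state] at hi; cases hi
    · simp only [stepLLX, llxLabel, if_neg hi]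
      exact rfl
  | failInfoAgain =>
    exact ⟨rfl, HelpInv.start (S := S.next S.heap none) (hS.info_lt r) h⟩
  | helpFail u pc =>
    have := HelpInv.post hS h
    revert this
    simp only [stepLLX, llxLabel]
    rcases stepHelp S.heap u pc with ⟨h₁, pc₁ | b⟩
    · exact fun h => ⟨rfl, h⟩
    · exact fun _ => rfl

end HelpLLX

/-! ### Operation instances as owners of records, and the history of an execution. -/

section Ownership

lemma stepHelp_numRecs {K : Type*} (h : Heap K) (u : RecPtr) (pc : HelpPC) :
    (stepHelp h u pc).1.numRecs = h.numRecs := by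
  cases pc with
  | freeze todo => cases todo <;> simp only [stepHelp] <;> split_ifs <;> rfl
  | mark todo => cases todo <;> rfl
  | updateCAS => simp only [stepHelp]; split_ifs <;> simp [Heap.writeFld_numRecs]
  | checkFrozen r todo => simp only [stepHelp]; split_ifs <;> rfl
  | frozenCheck => simp only [stepHelp]; split_ifs <;> rfl
  | _ => rfl

lemma stepLLX_numRecs {K : Type*} (h : Heap K) (tbl : Table) (r : Ptr) (pc : LLXPC) :
    (stepLLX h tbl r pc).1.numRecs = h.numRecs := by
  cases pc with
  | helpFinal m u pc =>
    have := stepHelp_numRecs h u pc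
    revert this
    simp only [stepLLX]
    rcases stepHelp h u pc with ⟨h₁, pc₁ | b⟩ <;> exact id
  | helpFail u pc =>
    have := stepHelp_numRecs h u pc
    revert this
    simp only [stepLLX]
    rcases stepHelp h u pc with ⟨h₁, pc₁ | b⟩ <;> exact id
  | readMarked2 m i st => simp only [stepLLX]; split_ifs <;> rfl
  | reread m i c nx => simp only [stepLLX]; split_ifs <;> rfl
  | testCommitted m i => simp only [stepLLX]; split_ifs <;> rfl
  | testInProgress m i => simp only [stepLLX]; split_ifs <;> rfl
  | failState x => simp only [stepLLX]; split_ifs <;> rfl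
  | _ => rfl

lemma inLLX_numRecs {K : Type*} (h : Heap K) (tbl : Table) (r : Ptr) (pc : LLXPC)
    (stay : LLXPC → PC) (exit : LLXResult → PC) :
    (inLLX h tbl r pc stay exit).1.numRecs = h.numRecs := by
  have := stepLLX_numRecs h tbl r pc
  revert this
  simp only [inLLX]
  rcases stepLLX h tbl r pc with ⟨h₁, tbl₁, pc₁ | res⟩ <;> exact id

variable {P K : Type*} [DecidableEq P] [LinearOrder K]

lemma stepOp_numRecs_le (h : Heap K) (tbl : Table) (op : Op K) (pc : PC) :
    h.numRecs ≤ (stepOp h tbl op pc).1.numRecs := by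
  cases pc with
  | start => simp only [stepOp]; split <;> exact le_rfl
  | search p r => simp only [stepOp]; split_ifs <;> [split; skip] <;> exact le_rfl
  | found p r => exact le_rfl
  | insLLXr r pc => exact (inLLX_numRecs ..).ge
  | insLLXp p r pc => exact (inLLX_numRecs ..).ge
  | delLLXp p r pc => exact (inLLX_numRecs ..).ge
  | delLLXr p r lp pc => exact (inLLX_numRecs ..).ge
  | delLLXn p r x pc => exact (inLLX_numRecs ..).ge
  | insR r res =>
    cases op <;> simp only [stepOp] <;> cases res <;> (try simp only [stepInsR]) <;>
      first | exact le_rfl | exact Nat.le_succ _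
  | insP p r res =>
    cases op <;> simp only [stepOp] <;> cases res <;> (try simp only [stepInsP]) <;>
      (try split_ifs) <;> first | exact le_rfl | exact Nat.le_succ _
  | delTest p r lp lr =>
    cases op <;> simp only [stepOp] <;> cases lp <;> cases lr <;>
      (try simp only [stepDelTest]) <;>
      (try split_ifs) <;> (try split) <;> first | exact le_rfl | exact Nat.le_succ _
  | delN p r x res =>
    simp only [stepOp]
    cases res <;> simp only [stepDelN] <;> first | exact le_rfl | exact Nat.le_succ _
  | scx u pc ret =>
    have := (stepHelp_numRecs h u pc).ge
    revert this
    simp only [stepOp]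
    rcases stepHelp h u pc with ⟨h₁, pc₁ | b⟩
    · exact id
    · cases b <;> exact id
  | fault => exact le_rfl

/-- The memory at time `t`. -/
abbrev Execution.heap (E : Execution P K) (t : ℕ) : Heap K := (E.conf t).heap

/-- At time `t`, the operation `op` that `p` invoked at time `i` has not returned. -/
def Execution.Pending (E : Execution P K) (p : P) (i : ℕ) (op : Op K) (t : ℕ) : Prop :=
  E.act i = .invoke p op ∧ i < t ∧ ∀ m, i < m → m < t → ∀ w, E.act m ≠ .respond p w

/-- The process taking a step. -/
def Action.proc? : Action P K → Option P
  | .stutter => none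
  | .invoke p _ => some p
  | .internal p => some p
  | .respond p _ => some p

variable {E : Execution P K}

lemma Execution.proc_eq_of_ne {t : ℕ} {p : P} (h : (E.act t).proc? ≠ some p) :
    (E.conf (t + 1)).proc p = (E.conf t).proc p := by
  have hn := E.next t
  have key : ∀ q (h' : Heap K) l, E.conf (t + 1) = (E.conf t).set h' q l → q ≠ p →
      (E.conf (t + 1)).proc p = (E.conf t).proc p := by
    intro q h' l he hq
    rw [he]; simp [Config.set, hq.symm]
  cases ha : E.act t with
  | stutter => rw [ha] at hn; rw [show E.conf (t + 1) = E.conf t from hn]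
  | invoke q op =>
    rw [ha] at hn h
    exact key q _ _ hn.2.2 (fun hq => h (congrArg some hq))
  | internal q =>
    rw [ha] at hn h
    obtain ⟨op, pc, h', tbl, pc₁, -, -, he⟩ := hn
    exact key q _ _ he (fun hq => h (congrArg some hq))
  | respond q v =>
    rw [ha] at hn h
    obtain ⟨op, pc, h', tbl, -, -, he⟩ := hn
    exact key q _ _ he (fun hq => h (congrArg some hq))

lemma Execution.Pending.cur {p : P} {i : ℕ} {op : Op K} {t : ℕ} (h : E.Pending p i op t) :
    ∃ pc, ((E.conf t).proc p).cur = some (op, pc) := by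
  obtain ⟨ha, hit, hr⟩ := h
  induction t, hit using Nat.le_induction with
  | base =>
    have hn := E.next i
    rw [ha] at hn
    exact ⟨.start, by rw [hn.2.2]; simp [Config.set]⟩
  | succ t ht ih =>
    obtain ⟨pc, hpc⟩ := ih fun m h1 h2 => hr m h1 (h2.trans t.lt_succ_self)
    have hn := E.next t
    by_cases hp : (E.act t).proc? = some p
    · cases hat : E.act t with
      | stutter => rw [hat] at hp; cases hp
      | invoke q op' =>
        rw [hat] at hn hp
        cases hp
        rw [hn.1] at hpc; cases hpc
      | internal q =>
        rw [hat] at hn hp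
        cases hp
        obtain ⟨op', pc', h', tbl, pc₁, h1, -, he⟩ := hn
        rw [hpc] at h1; cases h1
        exact ⟨pc₁, by rw [he]; simp [Config.set]⟩
      | respond q v =>
        rw [hat] at hp
        cases hp
        exact absurd hat (hr t ht t.lt_succ_self v)
    · exact ⟨pc, by rw [proc_eq_of_ne hp]; exact hpc⟩

lemma Execution.Pending.unique {p : P} {i j : ℕ} {op op' : Op K} {t : ℕ}
    (hi : E.Pending p i op t) (hj : E.Pending p j op' t) : i = j := by
  have key : ∀ {i j : ℕ} {op op' : Op K}, E.Pending p i op t → E.Pending p j op' t →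
      ¬ i < j := by
    intro i j op op' hi hj hij
    obtain ⟨pc, hpc⟩ := Pending.cur (E := E) (t := j)
      ⟨hi.1, hij, fun m h1 h2 => hi.2.2 m h1 (h2.trans hj.2.1)⟩
    have hn := E.next j
    rw [hj.1] at hn
    rw [hn.1] at hpc; cases hpc
  exact le_antisymm (not_lt.1 (key hj hi)) (not_lt.1 (key hi hj))

lemma Execution.numRecs_mono : Monotone fun t => (E.heap t).numRecs := by
  refine monotone_nat_of_le_succ fun t => ?_
  have hn := E.next t
  change (E.conf t).heap.numRecs ≤ (E.conf (t + 1)).heap.numRecs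
  cases ha : E.act t with
  | stutter => rw [ha] at hn; rw [show E.conf (t + 1) = E.conf t from hn]
  | invoke q op => rw [ha] at hn; rw [hn.2.2]; rfl
  | internal q =>
    rw [ha] at hn
    obtain ⟨op, pc, h', tbl, pc₁, -, hst, he⟩ := hn
    have := stepOp_numRecs_le (E.conf t).heap ((E.conf t).proc q).table op pc
    rw [he]; rw [hst] at this; exact this
  | respond q v =>
    rw [ha] at hn
    obtain ⟨op, pc, h', tbl, -, hst, he⟩ := hn
    have := stepOp_numRecs_le (E.conf t).heap ((E.conf t).proc q).table op pc
    rw [he]; rw [hst] at this; exact this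

/-- The operation instance `i` of `p` creates the record `u` at time `t`. -/
def Execution.CreatesAt (E : Execution P K) (u : RecPtr) (i : ℕ) (p : P) (op : Op K)
    (t : ℕ) : Prop :=
  E.act t = .internal p ∧ E.Pending p i op t ∧ (E.heap t).numRecs = u ∧
    (E.heap (t + 1)).numRecs = u + 1

/-- The number of records never decreases, so it passes from `u` to `u + 1` only once. The acting
process and its pending instance are determined by that step. -/
lemma Execution.CreatesAt.unique {u : RecPtr} {i j : ℕ} {p q : P} {op op' : Op K} {s t : ℕ}
    (h : E.CreatesAt u i p op s) (h' : E.CreatesAt u j q op' t) : i = j := by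
  have key : ∀ {i j : ℕ} {p q : P} {op op' : Op K} {s t : ℕ}, E.CreatesAt u i p op s →
      E.CreatesAt u j q op' t → ¬ s < t := by
    intro i j p q op op' s t h h' hst
    have h1 := E.numRecs_mono (Nat.succ_le_of_lt hst)
    have h2 := h.2.2.2
    have h3 := h'.2.2.1
    simp only [Nat.succ_eq_add_one] at h1
    omega
  obtain rfl : s = t := le_antisymm (not_lt.1 (key h' h)) (not_lt.1 (key h h'))
  have hpq := h.1.symm.trans h'.1
  cases hpq
  exact h.2.1.unique h'.2.1

open Classical in
/-- The operation instance that creates the record `u`. -/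
noncomputable def Execution.owner (E : Execution P K) (u : RecPtr) : ℕ :=
  Classical.epsilon fun i => ∃ p op t, E.CreatesAt u i p op t

lemma Execution.CreatesAt.owner_eq {u : RecPtr} {i : ℕ} {p : P} {op : Op K} {t : ℕ}
    (h : E.CreatesAt u i p op t) : E.owner u = i := by
  have hex : ∃ i p op t, E.CreatesAt u i p op t := ⟨i, p, op, t, h⟩
  obtain ⟨q, op', s, h'⟩ := Classical.epsilon_spec hex
  exact h'.unique h

/-- The memory at time `t` with its history. -/
noncomputable def Execution.ghost (E : Execution P K) (t : ℕ) : Ghost K where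
  heap := E.heap t
  froze r u := ∃ s ≤ t, ((E.heap s).node r).info = u
  listed a := ∃ s ≤ t, InList (E.heap s) a
  updated u := ∃ s < t, E.UpdatesAt s u
  opOf u := E.opAt (E.owner u)

@[simp] lemma Execution.ghost_heap (t : ℕ) : (E.ghost t).heap = E.heap t := rfl

/-- Connects the history, defined by quantifying over past times, with the one-step description used
for effects. The component `opOf` does not change, because `owner` refers to the whole execution. -/
lemma Execution.ghost_succ {t : ℕ} {l : Option RecPtr} (hl : ∀ u, E.UpdatesAt t u ↔ l = some u) :
    E.ghost (t + 1) = (E.ghost t).next (E.heap (t + 1)) l := by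
  have key : ∀ Q : ℕ → Prop, (∃ s ≤ t + 1, Q s) ↔ (∃ s ≤ t, Q s) ∨ Q (t + 1) := fun Q => by
    constructor
    · rintro ⟨s, hs, hq⟩
      rcases hs.lt_or_eq with hs | rfl
      · exact .inl ⟨s, Nat.lt_succ_iff.1 hs, hq⟩
      · exact .inr hq
    · rintro (⟨s, hs, hq⟩ | hq)
      · exact ⟨s, hs.trans t.le_succ, hq⟩
      · exact ⟨_, le_rfl, hq⟩
  have key' : ∀ Q : ℕ → Prop, (∃ s < t + 1, Q s) ↔ (∃ s < t, Q s) ∨ Q t := fun Q => by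
    constructor
    · rintro ⟨s, hs, hq⟩
      rcases (Nat.lt_succ_iff.1 hs).lt_or_eq with hs | rfl
      · exact .inl ⟨s, hs, hq⟩
      · exact .inr hq
    · rintro (⟨s, hs, hq⟩ | hq)
      · exact ⟨s, hs.trans t.lt_succ_self, hq⟩
      · exact ⟨_, t.lt_succ_self, hq⟩
  simp only [ghost, Ghost.next, key, key', hl]

end Ownership

/-! ### Only nodes of the list change. -/

section ListedNodes

variable {K : Type*} [LinearOrder K] {S : Ghost K}

/-- If a step changes a field of a node that has been in the list, then the node is in the list
after the step. -/
lemma Effect.inList_of_changed (hS : S.Inv) {h : Heap K} {l : Option RecPtr}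
    (he : Effect S h l) {r : Ptr} (hr : S.listed r)
    (hc : ¬ ((h.node r).count = (S.node r).count ∧ (h.node r).next = (S.node r).next)) :
    InList h r := by
  cases he with
  | skip => exact absurd ⟨rfl, rfl⟩ hc
  | freeze u r' l₁ l₂ lt ne hV hl info =>
    refine absurd ?_ hc
    by_cases hr : r = r' <;> simp [Heap.setNode, hr]
  | mark u r' lt ne af hR =>
    refine absurd ?_ hc
    by_cases hr : r = r' <;> simp [Heap.setNode, hr]
  | abort u lt ne hc' => exact absurd ⟨rfl, rfl⟩ hc
  | frozen u lt ne hf => exact absurd ⟨rfl, rfl⟩ hc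
  | commit u hup => exact absurd ⟨rfl, rfl⟩ hc
  | allocate h' x ha sorted rec fresh =>
    rw [ha.node r (hS.listed_lt r hr)] at hc
    exact absurd ⟨rfl, rfl⟩ hc
  | update u lt ne af hR old =>
    have hrec := hS.record u lt ne
    have hrf : r = (S.scx u).fld.node := by
      by_contra hne
      rw [S.heap.writeFld_node_of_ne _ hne] at hc
      exact hc ⟨rfl, rfl⟩
    have hin := hS.inList_of_mem_V lt ne af old hrec.fld_mem
    have hnot := hrec.fld_not_mem
    rw [← hrf] at hin hnot
    rcases hrec.kind with ⟨r', k, n, c, nx, hc⟩ | ⟨p, r', a, key, c, y, hc⟩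
    · rw [hc.writeFld_eq]
      refine inList_mono_of_next (fun b _ => ?_) hin
      by_cases hb : b = r' <;> simp [Heap.setNode, hb]
    · rw [hc.writeFld_eq, (hc.ready hS lt ne af old).1.inList_iff hS]
      exact .inl ⟨hin, hnot⟩

end ListedNodes

/-! ### Looking back in time, and the local knowledge of operations. -/

section History

variable {P K : Type*} [DecidableEq P] [LinearOrder K]

/-- Up to time `t`, the invariant of the memory holds and the steps have legitimate effects. -/
structure Execution.History (E : Execution P K) (t : ℕ) : Prop where
  inv : ∀ s ≤ t, (E.ghost s).Inv
  step : ∀ s < t, ∃ l, Effect (E.ghost s) (E.heap (s + 1)) l ∧ ∀ u, E.UpdatesAt s u ↔ l = some u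

variable {E : Execution P K}

lemma Execution.History.mono_succ {t s : ℕ} (h : E.History t) (hs : s < t) :
    Mono (E.ghost s) (E.ghost (s + 1)) := by
  obtain ⟨l, he, hl⟩ := h.step s hs
  rw [ghost_succ hl]
  exact he.mono (h.inv s hs.le)

lemma Execution.listed_mono {s t : ℕ} (hst : s ≤ t) {r : Ptr} (hr : (E.ghost s).listed r) :
    (E.ghost t).listed r := by
  obtain ⟨m, hm, h⟩ := hr
  exact ⟨m, hm.trans hst, h⟩

lemma Execution.listed_of_inList {s t : ℕ} (hst : s ≤ t) {r : Ptr} (hr : InList (E.heap s) r) :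
    (E.ghost t).listed r := ⟨s, hst, hr⟩

lemma Execution.History.key_eq {t s : ℕ} (h : E.History t) (hs : s ≤ t) {r : Ptr}
    (hr : (E.ghost s).listed r) : ((E.heap t).node r).key = ((E.heap s).node r).key := by
  have key : ∀ m, s ≤ m → m ≤ t → ((E.heap m).node r).key = ((E.heap s).node r).key := by
    intro m hsm
    induction m, hsm using Nat.le_induction with
    | base => intro _; rfl
    | succ m hm ih =>
      intro hmt
      rw [← ih (Nat.le_of_succ_le hmt)]
      exact (h.mono_succ hmt).key r
        ((h.inv m (Nat.le_of_succ_le hmt)).listed_lt r (listed_mono hm hr))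
  exact key t hs le_rfl

/-- A node that was in the list at time `s` was in the list at some time since then with the
content that it has now. -/
lemma Execution.History.past {t s : ℕ} (h : E.History t) (hs : s ≤ t) {r : Ptr}
    (hr : InList (E.heap s) r) : ∃ m, s ≤ m ∧ m ≤ t ∧ InList (E.heap m) r ∧
      ((E.heap m).node r).count = ((E.heap t).node r).count ∧
      ((E.heap m).node r).next = ((E.heap t).node r).next := by
  have key : ∀ t', s ≤ t' → t' ≤ t → ∃ m, s ≤ m ∧ m ≤ t' ∧ InList (E.heap m) r ∧
      ((E.heap m).node r).count = ((E.heap t').node r).count ∧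
      ((E.heap m).node r).next = ((E.heap t').node r).next := by
    intro t' hst'
    induction t', hst' using Nat.le_induction with
    | base => intro _; exact ⟨s, le_rfl, le_rfl, hr, rfl, rfl⟩
    | succ t' ht' ih =>
      intro hle
      obtain ⟨m, h1, h2, h3, h4, h5⟩ := ih (Nat.le_of_succ_le hle)
      by_cases hc : ((E.heap (t' + 1)).node r).count = ((E.heap t').node r).count ∧
          ((E.heap (t' + 1)).node r).next = ((E.heap t').node r).next
      · exact ⟨m, h1, h2.trans t'.le_succ, h3, h4.trans hc.1.symm, h5.trans hc.2.symm⟩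
      · obtain ⟨l, he, -⟩ := h.step t' hle
        exact ⟨t' + 1, ht'.trans t'.le_succ, le_rfl, he.inList_of_changed
          (h.inv t' (Nat.le_of_succ_le hle)) (listed_of_inList ht' hr) hc, rfl, rfl⟩
  exact key t hs le_rfl

/-- The entry for `r` in the table is a snapshot of `r`. -/
def TableOK (S : Ghost K) (tbl : Table) (r : Ptr) : Prop :=
  Snapshot S r (tbl r).info (tbl r).count (tbl r).next

/-- If `LLX(r)` has returned a snapshot, it is in the table. -/
def ResultOK (S : Ghost K) (tbl : Table) (r : Ptr) : LLXResult → Prop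
  | .snapshot c nx => TableOK S tbl r ∧ (tbl r).count = c ∧ (tbl r).next = nx
  | _ => True

/-- Since time `i`, `r` was the successor of `p` in the list. -/
def Execution.Edge (E : Execution P K) (i t : ℕ) (p r : Ptr) : Prop :=
  ∃ s, i < s ∧ s ≤ t ∧ InList (E.heap s) p ∧ ((E.heap s).node p).next = some r

/-- The result of a search for `k`. -/
structure Execution.Found (E : Execution P K) (i t : ℕ) (k : K) (p r : Ptr) : Prop where
  edge : E.Edge i t p r
  lt : ((E.heap t).node p).key < (k : WithBot (WithTop K))
  le : (k : WithBot (WithTop K)) ≤ ((E.heap t).node r).key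

/-- `Delete` has found at least the key, and a count that is equal to the number `n` of occurrences
to be removed. -/
structure DeleteReady (S : Ghost K) (tbl : Table) (p r x : Ptr) (k : K) (n : ℕ) : Prop where
  p_ok : TableOK S tbl p
  p_next : (tbl p).next = some r
  r_ok : TableOK S tbl r
  r_count : (tbl r).count = n
  r_next : (tbl r).next = some x
  key : (S.node r).key = (k : WithBot (WithTop K))
  key_lt : (S.node p).key < (k : WithBot (WithTop K))

/-- The response of an operation that updates the multiset. -/
def Op.updateResp : Op K → Resp
  | .get _ => .num 0
  | .insert _ _ => .done
  | .delete _ _ => .bool true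

/-- What an operation instance `op` invoked at time `i` knows at time `t`. -/
def Execution.PCInv (E : Execution P K) (t i : ℕ) (op : Op K) (tbl : Table) : PC → Prop
  | .start => True
  | .search p r => E.Edge i t p r ∧ ((E.heap t).node p).key < (op.key : WithBot (WithTop K))
  | .found p r => E.Found i t op.key p r
  | .insLLXr r pc => ∃ k n, op = .insert k n ∧ (E.ghost t).listed r ∧
      ((E.heap t).node r).key = (k : WithBot (WithTop K)) ∧ LLXInv (E.ghost t) r pc
  | .insR r res => ∃ k n, op = .insert k n ∧ (E.ghost t).listed r ∧
      ((E.heap t).node r).key = (k : WithBot (WithTop K)) ∧ ResultOK (E.ghost t) tbl r res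
  | .insLLXp p r pc => ∃ k n, op = .insert k n ∧ E.Found i t k p r ∧
      (k : WithBot (WithTop K)) ≠ ((E.heap t).node r).key ∧ LLXInv (E.ghost t) p pc
  | .insP p r res => ∃ k n, op = .insert k n ∧ E.Found i t k p r ∧
      (k : WithBot (WithTop K)) ≠ ((E.heap t).node r).key ∧ ResultOK (E.ghost t) tbl p res
  | .delLLXp p r pc => ∃ k n, op = .delete k n ∧ E.Found i t k p r ∧ LLXInv (E.ghost t) p pc
  | .delLLXr p r lp pc => ∃ k n, op = .delete k n ∧ E.Found i t k p r ∧
      ResultOK (E.ghost t) tbl p lp ∧ LLXInv (E.ghost t) r pc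
  | .delTest p r lp lr => ∃ k n, op = .delete k n ∧ E.Found i t k p r ∧
      ResultOK (E.ghost t) tbl p lp ∧ ResultOK (E.ghost t) tbl r lr ∧
      ∀ c nx, lr = .snapshot c nx →
        ∃ s, i < s ∧ s ≤ t ∧ InList (E.heap s) r ∧ ((E.heap s).node r).count = c
  | .delLLXn p r x pc => ∃ k n, op = .delete k n ∧ DeleteReady (E.ghost t) tbl p r x k n ∧
      LLXInv (E.ghost t) x pc
  | .delN p r x res => ∃ k n, op = .delete k n ∧ DeleteReady (E.ghost t) tbl p r x k n ∧
      ResultOK (E.ghost t) tbl x res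
  | .scx u pc ret => HelpInv (E.ghost t) u pc ∧ E.owner u = i ∧ ret = op.updateResp
  | .fault => False

/-! ### Stability of the local knowledge of operations. -/

section Stability

variable {S T : Ghost K}

lemma TableOK.mono (hS : S.Inv) (hT : Mono S T) {tbl : Table} {r : Ptr} (h : TableOK S tbl r) :
    TableOK T tbl r := Snapshot.mono hS hT h

lemma ResultOK.mono (hS : S.Inv) (hT : Mono S T) {tbl : Table} {r : Ptr} {res : LLXResult}
    (h : ResultOK S tbl r res) : ResultOK T tbl r res := by
  cases res with
  | snapshot c nx => exact ⟨h.1.mono hS hT, h.2⟩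
  | _ => trivial

lemma DeleteReady.mono (hS : S.Inv) (hT : Mono S T) {tbl : Table} {p r x : Ptr} {k : K} {n : ℕ}
    (h : DeleteReady S tbl p r x k n) : DeleteReady T tbl p r x k n where
  p_ok := h.p_ok.mono hS hT
  p_next := h.p_next
  r_ok := h.r_ok.mono hS hT
  r_count := h.r_count
  r_next := h.r_next
  key := (hT.key r h.r_ok.lt).trans h.key
  key_lt := by rw [hT.key p h.p_ok.lt]; exact h.key_lt

lemma Execution.Edge.succ {i t : ℕ} {p r : Ptr} (h : E.Edge i t p r) : E.Edge i (t + 1) p r := by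
  obtain ⟨s, h1, h2, h3⟩ := h
  exact ⟨s, h1, h2.trans t.le_succ, h3⟩

lemma Execution.Edge.listed {i t : ℕ} {p r : Ptr} (h : E.Edge i t p r) :
    (E.ghost t).listed p ∧ (E.ghost t).listed r := by
  obtain ⟨s, h1, h2, h3, h4⟩ := h
  exact ⟨⟨s, h2, h3⟩, ⟨s, h2, h3.next h4⟩⟩

lemma Execution.Found.succ (hS : (E.ghost t).Inv) (hT : Mono (E.ghost t) (E.ghost (t + 1)))
    {i : ℕ} {k : K} {p r : Ptr} (h : E.Found i t k p r) : E.Found i (t + 1) k p r where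
  edge := h.edge.succ
  lt := (hT.key p (hS.listed_lt p h.edge.listed.1)).trans_lt h.lt
  le := h.le.trans_eq (hT.key r (hS.listed_lt r h.edge.listed.2)).symm

lemma Execution.PCInv.succ {t : ℕ} (hS : (E.ghost t).Inv)
    (hT : Mono (E.ghost t) (E.ghost (t + 1))) {i : ℕ} {op : Op K} {tbl : Table} {pc : PC}
    (h : E.PCInv t i op tbl pc) : E.PCInv (t + 1) i op tbl pc := by
  have hkey : ∀ r, (E.ghost t).listed r →
      ((E.heap (t + 1)).node r).key = ((E.heap t).node r).key :=
    fun r hr => hT.key r (hS.listed_lt r hr)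
  cases pc with
  | start => trivial
  | search p r => exact ⟨h.1.succ, (hkey p h.1.listed.1).trans_lt h.2⟩
  | found p r => exact Found.succ hS hT h
  | insLLXr r pc =>
    obtain ⟨k, n, h1, h2, h3, h4⟩ := h
    exact ⟨k, n, h1, hT.listed r h2, (hkey r h2).trans h3, h4.mono hS hT h2⟩
  | insR r res =>
    obtain ⟨k, n, h1, h2, h3, h4⟩ := h
    exact ⟨k, n, h1, hT.listed r h2, (hkey r h2).trans h3, h4.mono hS hT⟩
  | insLLXp p r pc =>
    obtain ⟨k, n, h1, h2, h3, h4⟩ := h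
    refine ⟨k, n, h1, h2.succ hS hT, ?_, h4.mono hS hT h2.edge.listed.1⟩
    rw [hkey r h2.edge.listed.2]; exact h3
  | insP p r res =>
    obtain ⟨k, n, h1, h2, h3, h4⟩ := h
    refine ⟨k, n, h1, h2.succ hS hT, ?_, h4.mono hS hT⟩
    rw [hkey r h2.edge.listed.2]; exact h3
  | delLLXp p r pc =>
    obtain ⟨k, n, h1, h2, h3⟩ := h
    exact ⟨k, n, h1, h2.succ hS hT, h3.mono hS hT h2.edge.listed.1⟩
  | delLLXr p r lp pc =>
    obtain ⟨k, n, h1, h2, h3, h4⟩ := h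
    exact ⟨k, n, h1, h2.succ hS hT, h3.mono hS hT, h4.mono hS hT h2.edge.listed.2⟩
  | delTest p r lp lr =>
    obtain ⟨k, n, h1, h2, h3, h4, h5⟩ := h
    refine ⟨k, n, h1, h2.succ hS hT, h3.mono hS hT, h4.mono hS hT, fun c nx hc => ?_⟩
    obtain ⟨s, h6, h7, h8⟩ := h5 c nx hc
    exact ⟨s, h6, h7.trans t.le_succ, h8⟩
  | delLLXn p r x pc =>
    obtain ⟨k, n, h1, h2, h3⟩ := h
    have hx := h2.r_ok.next
    rw [h2.r_next] at hx
    exact ⟨k, n, h1, h2.mono hS hT, h3.mono hS hT hx.key_lt.2.2⟩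
  | delN p r x res =>
    obtain ⟨k, n, h1, h2, h3⟩ := h
    exact ⟨k, n, h1, h2.mono hS hT, h3.mono hS hT⟩
  | scx u pc ret =>
    obtain ⟨h1, h2⟩ := h
    exact ⟨h1.mono hT, h2⟩
  | fault => exact h

end Stability

end History

/-! ### Creation of nodes and SCX-records. -/

section Allocation

variable {K : Type*} [LinearOrder K] {S : Ghost K}

lemma Ghost.Inv.allocates_newSCX (hS : S.Inv) (tbl : Table) (V R : List Ptr) (fld : Fld)
    (new : Val) : Allocates S.heap (newSCX S.heap tbl V R fld new).1
      { V := V, R := R, fld := fld, new := new, old := tbl.value fld, state := .inProgress,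
        allFrozen := false, infoFields := fun r => (tbl r).info } where
  nodes_le := le_rfl
  node _ _ := rfl
  info := hS.unallocated
  recs := rfl
  scx := rfl
  state := rfl
  allFrozen := rfl

lemma Ghost.Inv.allocates_newNode (hS : S.Inv) (tbl : Table) (V R : List Ptr) (fld : Fld)
    (new : Val) (key : WithBot (WithTop K)) (c : ℕ) (y : Option Ptr) :
    Allocates S.heap (newSCX (S.heap.newNode (mkNode key c y)).1 tbl V R fld new).1
      { V := V, R := R, fld := fld, new := new, old := tbl.value fld, state := .inProgress,
        allFrozen := false, infoFields := fun r => (tbl r).info } where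
  nodes_le := Nat.le_succ _
  node r hr := Function.update_of_ne hr.ne _ _
  info r hr := by
    by_cases h : r = S.heap.numNodes
    · subst h
      simp [newSCX, Heap.newNode, Heap.newRecord, Heap.setNode, Heap.setSCX, mkNode]
    · have : (newSCX (S.heap.newNode (mkNode key c y)).1 tbl V R fld new).1.node r =
          S.node r := Function.update_of_ne h _ _
      rw [this]; exact hS.unallocated r hr
  recs := rfl
  scx := rfl
  state := rfl
  allFrozen := rfl

lemma Allocates.recSnapshot (hS : S.Inv) {h : Heap K} {x : SCXRecord}
    (ha : Allocates S.heap h x) {tbl : Table} (hx : x.infoFields = fun r => (tbl r).info)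
    {r : Ptr} (hr : TableOK S tbl r) :
    RecSnapshot (S.next h none) S.heap.numRecs r (tbl r).count (tbl r).next := by
  have hscx : (S.next h none).scx S.heap.numRecs = x := by
    simp [ha.scx]
  refine ⟨?_, fun hi => ?_⟩
  · rw [hscx, hx]
    exact Snapshot.mono hS (.of_allocates hS ha) hr
  · have h1 : ((S.next h none).node r).info = (S.node r).info := by
      simp [ha.node r hr.lt]
    -- No node can be frozen for a record that has only just been allocated.
    exact absurd (h1.symm.trans hi) (hS.info_lt r).ne

lemma TableOK.info_lt (hS : S.Inv) {tbl : Table} {r : Ptr} (h : TableOK S tbl r) :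
    (tbl r).info < S.heap.numRecs := hS.froze_lt _ _ h.settled.froze

lemma Ghost.Inv.effect_newSCX_count (hS : S.Inv) {tbl : Table} {r : Ptr} {k : K} {n : ℕ}
    (hn : 0 < n) (hop : S.opOf S.heap.numRecs = some (.insert k n)) (hr : TableOK S tbl r)
    (hk : (S.node r).key = (k : WithBot (WithTop K))) :
    Effect S (newSCX S.heap tbl [r] [] (.count r) (.num ((tbl r).count + n))).1 none := by
  have ha := hS.allocates_newSCX tbl [r] [] (.count r) (.num ((tbl r).count + n))
  refine .allocate _ _ ha (hS.sorted.frame rfl fun _ => ⟨rfl, rfl⟩) ?_ (by simp)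
  have hscx := congrFun ha.scx S.heap.numRecs
  rw [Function.update_self] at hscx
  have hsnap := ha.recSnapshot hS rfl hr
  refine ⟨?_, .inl ⟨r, k, n, _, _, hop, hn, ?_, ?_, ?_, ?_, ?_, hk, hsnap⟩⟩
  · rw [Ghost.next_scx, hscx]
    intro r' hr'
    rw [List.mem_singleton] at hr'; subst hr'
    exact hr.info_lt hS
  all_goals rw [Ghost.next_scx, hscx]; try rfl

/-- Common to the three operations that replace a next pointer. The replacement is required for an
arbitrary later state `T`, because it speaks of a record that exists only after the allocation. -/
lemma Ghost.Inv.effect_newSCX_next (hS : S.Inv) {tbl : Table} {p r : Ptr} {R : List Ptr}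
    {key : WithBot (WithTop K)} {c : ℕ} {y : Option Ptr}
    (hp : TableOK S tbl p) (hpr : (tbl p).next = some r) (hkey : (S.node p).key < key)
    (hy : (key = WithBot.some ⊤ → y = none) ∧
      (key ≠ WithBot.some ⊤ → ∃ b < S.heap.numNodes, y = some b ∧ key < (S.node b).key))
    (hR : ∀ v ∈ R, TableOK S tbl v)
    (hrepl : ∀ T : Ghost K, Mono S T → (T.scx S.heap.numRecs).R = R →
      (∀ v, TableOK S tbl v → RecSnapshot T S.heap.numRecs v (tbl v).count (tbl v).next) →
      Replacement T S.heap.numRecs r key c y) :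
    Effect S (newSCX (S.heap.newNode (mkNode key c y)).1 tbl (p :: R) R (.next p)
      (.ptr (some S.heap.numNodes))).1 none := by
  have ha := hS.allocates_newNode tbl (p :: R) R (.next p) (.ptr (some S.heap.numNodes)) key c y
  generalize hh : (newSCX (S.heap.newNode (mkNode key c y)).1 tbl (p :: R) R (.next p)
      (.ptr (some S.heap.numNodes))).1 = h at ha ⊢
  have hnode : h.node S.heap.numNodes = mkNode key c y := by
    rw [← hh]; exact Function.update_self ..
  have hnum : h.numNodes = S.heap.numNodes + 1 := by rw [← hh]; rfl
  have hT := Mono.of_allocates hS ha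
  have hscx := congrFun ha.scx S.heap.numRecs
  rw [Function.update_self] at hscx
  have hsnap : ∀ v, TableOK S tbl v → RecSnapshot (S.next h none) S.heap.numRecs v
    (tbl v).count (tbl v).next := fun v hv => ha.recSnapshot hS rfl hv
  refine .allocate _ _ ha ?_ ?_ ?_
  · refine ⟨hS.sorted.1.trans_le ha.nodes_le, ?_, fun a hlt => ?_⟩
    · rw [ha.node _ hS.sorted.1]; exact hS.sorted.2.1
    · rw [hnum, Nat.lt_succ_iff] at hlt
      rcases hlt.lt_or_eq with hlt | rfl
      · rw [ha.node a hlt]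
        refine ⟨(hS.sorted.2.2 a hlt).1, fun hk => ?_⟩
        obtain ⟨b, hb, h1, h2⟩ := (hS.sorted.2.2 a hlt).2 hk
        exact ⟨b, hb.trans_le ha.nodes_le, h1, by rwa [ha.node b hb]⟩
      · rw [hnode]
        refine ⟨hy.1, fun hk => ?_⟩
        obtain ⟨b, hb, h1, h2⟩ := hy.2 hk
        exact ⟨b, hb.trans_le ha.nodes_le, h1, by rwa [ha.node b hb]⟩
  · refine ⟨?_, .inr ⟨p, r, S.heap.numNodes, key, c, y, ?_⟩⟩
    · rw [Ghost.next_scx, hscx]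
      intro v hv
      rcases List.mem_cons.1 hv with rfl | hv
      · exact hp.info_lt hS
      · exact (hR v hv).info_lt hS
    · have hpn := hp.next
      rw [hpr] at hpn
      have hps := hsnap p hp
      rw [hpr] at hps
      refine {
        V := by rw [Ghost.next_scx, hscx]
        fld := by rw [Ghost.next_scx, hscx]
        old := by rw [Ghost.next_scx, hscx]; exact congrArg Val.ptr hpr
        new := by rw [Ghost.next_scx, hscx]
        lt := hpn.key_lt.2.1
        key_lt := by rw [hT.key p hp.lt]; exact hkey
        snap := ⟨_, hps⟩
        new_node := ⟨?_, ?_, fun _ => ?_⟩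
        repl := hrepl _ hT (by rw [Ghost.next_scx, hscx]) hsnap }
      · rw [Ghost.next_heap, hnum]; exact Nat.lt_succ_self _
      · rw [Ghost.next_node, hnode]; rfl
      · rw [Ghost.next_node, hnode]; exact ⟨rfl, rfl⟩
  · intro a h1
    cases h1; exact le_rfl

end Allocation

/-! ### Every step of an operation has a legitimate effect. -/

section OperationSteps

variable {P K : Type*} [DecidableEq P] [LinearOrder K] {E : Execution P K}

/-- The record for which a step of an operation is a successful update CAS. -/
def opLabel (h : Heap K) : PC → Option RecPtr
  | .insLLXr _ pc => llxLabel h pc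
  | .insLLXp _ _ pc => llxLabel h pc
  | .delLLXp _ _ pc => llxLabel h pc
  | .delLLXr _ _ _ pc => llxLabel h pc
  | .delLLXn _ _ _ pc => llxLabel h pc
  | .scx u pc _ => helpLabel h u pc
  | _ => none

lemma inLLX_eq (h : Heap K) (tbl : Table) (r : Ptr) (pc : LLXPC) (stay : LLXPC → PC)
    (exit : LLXResult → PC) : inLLX h tbl r pc stay exit = ((stepLLX h tbl r pc).1,
      (stepLLX h tbl r pc).2.1, .inl ((stepLLX h tbl r pc).2.2.elim stay exit)) := by
  simp only [inLLX]
  rcases stepLLX h tbl r pc with ⟨h₁, tbl₁, pc₁ | res⟩ <;> rfl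

lemma Execution.Found.key_lt {t i : ℕ} {k : K} {p r : Ptr} (h : E.Found i t k p r) :
    ((E.heap t).node p).key < ((E.heap t).node r).key := h.lt.trans_le h.le

lemma DeleteReady.keys {S : Ghost K} {tbl : Table} {p r x : Ptr} {k : K} {n : ℕ}
    (h : DeleteReady S tbl p r x k n) :
    (S.node p).key < (S.node r).key ∧ (S.node r).key < (S.node x).key ∧ S.listed x := by
  have h1 := h.p_ok.next
  rw [h.p_next] at h1
  have h2 := h.r_ok.next
  rw [h.r_next] at h2
  exact ⟨h1.key_lt.1, h2.key_lt.1, h2.key_lt.2.2⟩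

lemma coe_ne_top (k : K) : (k : WithBot (WithTop K)) ≠ WithBot.some ⊤ := by
  intro h
  exact WithTop.coe_ne_top (WithBot.coe_injective h)

/-- The hypothesis about `opOf` is conditional on the creation of a record, since only then is there
an owner to be identified with the acting instance. -/
lemma Execution.PCInv.effect {t i : ℕ} {op : Op K} {tbl : Table} {pc : PC}
    (hS : (E.ghost t).Inv) (h : E.PCInv t i op tbl pc) (hpre : op.Pre)
    (hown : (stepOp (E.heap t) tbl op pc).1.numRecs = (E.heap t).numRecs + 1 →
      (E.ghost t).opOf (E.heap t).numRecs = some op) :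
    Effect (E.ghost t) (stepOp (E.heap t) tbl op pc).1 (opLabel (E.heap t) pc) := by
  cases pc with
  | start => simp only [stepOp]; split <;> exact .skip
  | search p r => simp only [stepOp]; split_ifs <;> [split; skip] <;> exact .skip
  | found p r => exact .skip
  | insLLXr r pc =>
    obtain ⟨k, n, h1, h2, h3, h4⟩ := h
    simp only [stepOp, inLLX_eq]; exact h4.effect
  | insLLXp p r pc =>
    obtain ⟨k, n, h1, h2, h3, h4⟩ := h
    simp only [stepOp, inLLX_eq]; exact h4.effect
  | delLLXp p r pc =>
    obtain ⟨k, n, h1, h2, h3⟩ := h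
    simp only [stepOp, inLLX_eq]; exact h3.effect
  | delLLXr p r lp pc =>
    obtain ⟨k, n, h1, h2, h3, h4⟩ := h
    simp only [stepOp, inLLX_eq]; exact h4.effect
  | delLLXn p r x pc =>
    obtain ⟨k, n, h1, h2, h3⟩ := h
    simp only [stepOp, inLLX_eq]; exact h3.effect
  | insR r res =>
    obtain ⟨k, n, rfl, h2, h3, h4⟩ := h
    cases res with
    | snapshot c nx =>
      obtain ⟨h4, rfl, rfl⟩ := h4
      exact hS.effect_newSCX_count hpre (hown rfl) h4 h3
    | _ => exact .skip
  | insP p r res =>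
    obtain ⟨k, n, rfl, h2, h3, h4⟩ := h
    cases res with
    | snapshot c nx =>
      obtain ⟨h4, rfl, h5⟩ := h4
      simp only [stepOp, stepInsP] at hown ⊢
      split_ifs at hown ⊢ with hnx
      · have hop := hown rfl
        rw [← h5] at hnx
        have hlt := lt_of_le_of_ne h2.le h3
        have hr := hS.listed_lt r h2.edge.listed.2
        refine hS.effect_newSCX_next h4 hnx h2.lt
          ⟨fun hk => absurd hk (coe_ne_top k), fun _ => ⟨r, hr, rfl, hlt⟩⟩ (by simp) ?_
        intro T hT hR _
        exact .insert k (hT.opOf ▸ hop) hR rfl rfl (hlt.trans_eq (hT.key r hr).symm)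
      · exact .skip
    | _ => exact .skip
  | delTest p r lp lr =>
    obtain ⟨k, n, rfl, h2, h3, h4, -⟩ := h
    cases lp with
    | snapshot c₀ pn =>
      cases lr with
      | snapshot c rn =>
        obtain ⟨h3, rfl, h5⟩ := h3
        obtain ⟨h4, h6, h7⟩ := h4
        simp only [stepOp, stepDelTest] at hown ⊢
        by_cases hpn : pn = some r
        · rw [if_pos hpn] at hown ⊢
          by_cases hk : (k : WithBot (WithTop K)) ≠ ((E.heap t).node r).key ∨ c < n
          · rw [if_pos hk]; exact .skip
          · rw [if_neg hk] at hown ⊢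
            push Not at hk
            by_cases hnc : n < c
            · rw [if_pos hnc] at hown ⊢
              have hop := hown rfl
              have hn := h4.next
              rw [h7] at hn
              refine hS.effect_newSCX_next h3 (h5.trans hpn) h2.key_lt ⟨hn.1, fun hk => ?_⟩
                (by simpa using h4) ?_
              · obtain ⟨b, hb, h8, h9, -⟩ := hn.2 hk
                exact ⟨b, hb, h8, h9⟩
              · intro T hT hR hsnap
                have hs := hsnap r h4
                rw [h6, h7] at hs
                exact .decrease k n c (hT.opOf ▸ hop) hR hk.1.symm (hT.key r h4.lt) hs hnc rfl
            · rw [if_neg hnc]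
              split <;> exact .skip
        · rw [if_neg hpn]; exact .skip
      | _ => exact .skip
    | _ => exact .skip
  | delN p r x res =>
    obtain ⟨k, n, rfl, h2, h3⟩ := h
    cases res with
    | snapshot c nx =>
      obtain ⟨h3, rfl, rfl⟩ := h3
      have hop := hown rfl
      obtain ⟨h4, h5, h6⟩ := h2.keys
      refine hS.effect_newSCX_next h2.p_ok h2.p_next (h4.trans h5)
        ⟨h3.next.1, fun hk => ?_⟩ (by simpa using ⟨h2.r_ok, h3⟩) ?_
      · obtain ⟨b, hb, h8, h9, -⟩ := h3.next.2 hk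
        exact ⟨b, hb, h8, h9⟩
      · intro T hT hR hsnap
        have hs := hsnap r h2.r_ok
        rw [h2.r_count, h2.r_next] at hs
        exact .remove k n x (hT.opOf ▸ hop) hR ((hT.key r h2.r_ok.lt).trans h2.key)
          (hT.key x h3.lt) hs (hsnap x h3)
    | _ => exact .skip
  | scx u pc ret =>
    have := h.1.effect
    revert this
    simp only [stepOp, opLabel, ghost_heap]
    rcases stepHelp (E.heap t) u pc with ⟨h₁, pc₁ | b⟩
    · exact id
    · cases b <;> exact id
  | fault => exact absurd h id

end OperationSteps

/-! ### Local knowledge after a step, and the justification of responses. -/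

section OperationResults

variable {P K : Type*} [DecidableEq P] [LinearOrder K] {E : Execution P K}

/-- A response of the operation instance `op` invoked at time `i`, given at time `t` with program
counter `pc`: either it is the response of an operation that does not update the multiset, or an
`SCX` of the instance is committed. -/
inductive Execution.Responds (E : Execution P K) (t i : ℕ) (op : Op K) (v : Resp) (pc : PC) : Prop
  | read (s : ℕ) (his : i < s) (hst : s ≤ t)
      (spec : ∀ m, IsContents (E.heap s) m → spec m op = (m, v))
      (hpc : ∀ u hp ret, pc ≠ .scx u hp ret)
  | update (u : RecPtr) (hp : HelpPC) (hpc : pc = .scx u hp v) (hv : v = op.updateResp)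
      (state : ((E.heap (t + 1)).scx u).state = .committed)

/-- The outcome of a step. -/
def Execution.OpPost (E : Execution P K) (t i : ℕ) (op : Op K) (pc : PC) (tbl' : Table) :
    PC ⊕ Resp → Prop
  | .inl pc' => E.PCInv (t + 1) i op tbl' pc'
  | .inr v => E.Responds t i op v pc

lemma LLXPost.resultOK {T : Ghost K} {r : Ptr} {tbl tbl' : Table} {res : LLXResult}
    (h : LLXPost T r tbl tbl' (.inr res)) : ResultOK T tbl' r res := by
  cases res with
  | snapshot c nx =>
    obtain ⟨i, rfl, h1, -⟩ := h
    refine ⟨?_, by simp, by simp⟩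
    simpa [TableOK] using h1
  | _ => trivial

lemma LLXPost.table_eq {T : Ghost K} {r : Ptr} {tbl tbl' : Table} {res : LLXPC ⊕ LLXResult}
    (h : LLXPost T r tbl tbl' res) {v : Ptr} (hv : v ≠ r) : tbl' v = tbl v := by
  rcases res with pc | res
  · rw [h.1]
  · cases res with
    | snapshot c nx =>
      obtain ⟨i, rfl, h1, -⟩ := h
      exact Function.update_of_ne hv _ _
    | _ => exact congrFun h v

lemma TableOK.congr {S : Ghost K} {tbl tbl' : Table} {r : Ptr} (h : TableOK S tbl r)
    (he : tbl' r = tbl r) : TableOK S tbl' r := by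
  rw [TableOK, he]; exact h

lemma ResultOK.congr {S : Ghost K} {tbl tbl' : Table} {r : Ptr} {res : LLXResult}
    (h : ResultOK S tbl r res) (he : tbl' r = tbl r) : ResultOK S tbl' r res := by
  cases res with
  | snapshot c nx =>
    obtain ⟨h1, h2, h3⟩ := h
    exact ⟨h1.congr he, he ▸ h2, he ▸ h3⟩
  | _ => trivial

lemma DeleteReady.congr {S : Ghost K} {tbl tbl' : Table} {p r x : Ptr} {k : K} {n : ℕ}
    (h : DeleteReady S tbl p r x k n) (hp : tbl' p = tbl p) (hr : tbl' r = tbl r) :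
    DeleteReady S tbl' p r x k n where
  p_ok := h.p_ok.congr hp
  p_next := hp ▸ h.p_next
  r_ok := h.r_ok.congr hr
  r_count := hr ▸ h.r_count
  r_next := hr ▸ h.r_next
  key := h.key
  key_lt := h.key_lt

lemma InList.not_exists_key {h : Heap K} (hs : Sorted h) {p r : Ptr} (hp : InList h p)
    (hpr : (h.node p).next = some r) {k : WithBot (WithTop K)} (h1 : (h.node p).key < k)
    (h2 : k < (h.node r).key) : ¬ ∃ a, InList h a ∧ (h.node a).key = k := by
  rintro ⟨a, ha, rfl⟩
  exact (hp.key_le_of_next hs ha hpr h1).not_gt h2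

/-- The search has been at consecutive nodes of the list between which the key is missing. -/
lemma Execution.Found.count_eq_zero {t i : ℕ} (H : E.History t) {k : K} {p r : Ptr}
    (h : E.Found i t k p r) (hk : (k : WithBot (WithTop K)) ≠ ((E.heap t).node r).key) :
    ∃ s, i < s ∧ s ≤ t ∧ ∀ m, IsContents (E.heap s) m → m.count k = 0 := by
  obtain ⟨s, h1, h2, h3, h4⟩ := h.edge
  refine ⟨s, h1, h2, fun m hm => (hm k).2 ?_⟩
  refine h3.not_exists_key (h := E.heap s) (H.inv s h2).sorted h4 ?_ ?_
  · rw [← H.key_eq h2 (listed_of_inList le_rfl h3)]; exact h.lt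
  · rw [← H.key_eq h2 (listed_of_inList le_rfl (h3.next h4))]; exact lt_of_le_of_ne h.le hk

/-- The node `r` may meanwhile have been removed. At some moment since the invocation it was in the
list with its present next pointer, and this moment is the witness for the new edge. -/
lemma Execution.Edge.step {t i : ℕ} (H : E.History t) {p r x : Ptr} (h : E.Edge i t p r)
    (hx : ((E.heap t).node r).next = some x) : E.Edge i t r x := by
  obtain ⟨s, h1, h2, h3, h4⟩ := h
  obtain ⟨m, h5, h6, h7, -, h8⟩ := H.past h2 (h3.next h4)
  exact ⟨m, h1.trans_le h5, h6, h7, h8.trans hx⟩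

/-- A response that comes without an `SCX` is justified by a past configuration within the interval
of the operation. A response after an `SCX` is justified by the committed record. -/
lemma Execution.PCInv.post {t i : ℕ} {op : Op K} {tbl : Table} {pc : PC}
    (H : E.History t) (h : E.PCInv t i op tbl pc) (hpre : op.Pre) (hi : i < t)
    (hT : Mono (E.ghost t) (E.ghost (t + 1)))
    (hh : E.heap (t + 1) = (stepOp (E.heap t) tbl op pc).1)
    (hg : E.ghost (t + 1) = (E.ghost t).next (E.heap (t + 1)) (opLabel (E.heap t) pc))
    (hown : (stepOp (E.heap t) tbl op pc).1.numRecs = (E.heap t).numRecs + 1 →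
      E.owner (E.heap t).numRecs = i) :
    E.OpPost t i op pc (stepOp (E.heap t) tbl op pc).2.1 (stepOp (E.heap t) tbl op pc).2.2 := by
  have hS := H.inv t le_rfl
  have hkey : ∀ r, (E.ghost t).listed r →
      ((E.heap (t + 1)).node r).key = ((E.heap t).node r).key :=
    fun r hr => hT.key r (hS.listed_lt r hr)
  have hm := h.succ hS hT
  -- `LLX` inside an operation
  have hllx : ∀ (r : Ptr) (pc' : LLXPC), (E.ghost t).listed r → LLXInv (E.ghost t) r pc' →
      (stepOp (E.heap t) tbl op pc).1 = (stepLLX (E.heap t) tbl r pc').1 →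
      opLabel (E.heap t) pc = llxLabel (E.heap t) pc' →
      LLXPost (E.ghost (t + 1)) r tbl (stepLLX (E.heap t) tbl r pc').2.1
        (stepLLX (E.heap t) tbl r pc').2.2 := by
    intro r pc' hr hinv h1 h2
    rw [hg, hh, h1, h2]
    exact hinv.post hS hr
  -- `SCX`
  have hscx : ∀ ret, ret = op.updateResp →
      (stepOp (E.heap t) tbl op pc).1.numRecs = (E.heap t).numRecs + 1 →
      E.PCInv (t + 1) i op tbl (.scx (E.heap t).numRecs
        (startHelp (E.heap (t + 1)) (E.heap t).numRecs) ret) := by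
    intro ret hret hnum
    refine ⟨HelpInv.start (S := E.ghost (t + 1)) ?_ hS.recs_pos.ne', hown hnum, hret⟩
    rw [ghost_heap, hh, hnum]; exact Nat.lt_succ_self _
  cases pc with
  | start =>
    simp only [stepOp]
    split
    · rename_i r hr
      refine ⟨⟨t, hi, t.le_succ, .head, hr⟩, ?_⟩
      rw [hkey head (hS.listed _ .head),
        show ((E.heap t).node head).key = ⊥ from hS.sorted.2.1]
      exact WithBot.bot_lt_coe _
    · rename_i hr
      obtain ⟨b, hb, h1, h2⟩ := (hS.sorted.2.2 head hS.sorted.1).2 (by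
        rw [hS.sorted.2.1]; exact WithBot.bot_ne_coe)
      rw [ghost_heap, hr] at h1; cases h1
  | search p r =>
    obtain ⟨h1, h2⟩ := h
    simp only [stepOp]
    split_ifs with hk
    · split
      · rename_i x hx
        refine ⟨(h1.step H hx).succ, ?_⟩
        rw [hkey r h1.listed.2]; exact hk
      · rename_i hx
        obtain ⟨b, hb, h3, h4⟩ := (hS.sorted.2.2 r (hS.listed_lt r h1.listed.2)).2 (by
          intro htop
          rw [ghost_heap] at htop
          rw [htop] at hk
          exact absurd hk (not_lt.2 le_top))
        rw [ghost_heap, hx] at h3; cases h3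
    · exact ⟨hm.1, hm.2, (not_lt.1 hk).trans_eq (hkey r h1.listed.2).symm⟩
  | found p r =>
    cases op with
    | get k =>
      simp only [stepOp, stepFound]
      split_ifs with hk
      · obtain ⟨s, h1, h2, h3, h4⟩ := h.edge
        -- The count is read now, possibly from a removed node. At time `m` the node was in the list
        -- with this same count, so `Get` is linearized there.
        obtain ⟨m, h5, h6, h7, h8, -⟩ := H.past h2 (h3.next h4)
        refine .read m (h1.trans_le h5) h6 (fun s hs => ?_) (by simp)
        have := (hs k).1 r h7 (by
          rw [← H.key_eq h6 (listed_of_inList le_rfl h7)]; exact hk.symm)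
        simp [spec, this, h8]
      · obtain ⟨s, h1, h2, h3⟩ := Found.count_eq_zero (k := k) H h hk
        exact .read s h1 h2 (fun m hm => by simp [spec, h3 m hm]) (by simp)
    | insert k n =>
      simp only [stepOp, stepFound]
      split_ifs with hk
      · exact ⟨k, n, rfl, hm.edge.listed.2, (hkey r h.edge.listed.2).trans hk.symm, trivial⟩
      · exact ⟨k, n, rfl, hm, by rw [hkey r h.edge.listed.2]; exact hk, trivial⟩
    | delete k n => exact ⟨k, n, rfl, hm, trivial⟩
  | insLLXr r pc =>
    obtain ⟨k, n, rfl, h2, h3, h4⟩ := h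
    obtain ⟨k', n', h1', h2', h3', -⟩ := hm
    cases h1'
    have hp := hllx r pc h2 h4 (by simp only [stepOp, inLLX_eq]) rfl
    simp only [stepOp, inLLX_eq]
    rcases hres : (stepLLX (E.heap t) tbl r pc).2.2 with pc' | res <;> rw [hres] at hp
    · exact ⟨k, n, rfl, h2', h3', hp.2⟩
    · exact ⟨k, n, rfl, h2', h3', hp.resultOK⟩
  | insLLXp p r pc =>
    obtain ⟨k, n, rfl, h2, h3, h4⟩ := h
    obtain ⟨k', n', h1', h2', h3', -⟩ := hm
    cases h1'
    have hp := hllx p pc h2.edge.listed.1 h4 (by simp only [stepOp, inLLX_eq]) rfl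
    simp only [stepOp, inLLX_eq]
    rcases hres : (stepLLX (E.heap t) tbl p pc).2.2 with pc' | res <;> rw [hres] at hp
    · exact ⟨k, n, rfl, h2', h3', hp.2⟩
    · exact ⟨k, n, rfl, h2', h3', hp.resultOK⟩
  | delLLXp p r pc =>
    obtain ⟨k, n, rfl, h2, h3⟩ := h
    obtain ⟨k', n', h1', h2', -⟩ := hm
    cases h1'
    have hp := hllx p pc h2.edge.listed.1 h3 (by simp only [stepOp, inLLX_eq]) rfl
    simp only [stepOp, inLLX_eq]
    rcases hres : (stepLLX (E.heap t) tbl p pc).2.2 with pc' | res <;> rw [hres] at hp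
    · exact ⟨k, n, rfl, h2', hp.2⟩
    · exact ⟨k, n, rfl, h2', hp.resultOK, trivial⟩
  | delLLXr p r lp pc =>
    obtain ⟨k, n, rfl, h2, h3, h4⟩ := h
    obtain ⟨k', n', h1', h2', h3', -⟩ := hm
    cases h1'
    have hp := hllx r pc h2.edge.listed.2 h4 (by simp only [stepOp, inLLX_eq]) rfl
    -- `LLX(r)` must not overwrite the table entry of `p`; the keys show that the nodes differ.
    have hpr : p ≠ r := by rintro rfl; exact lt_irrefl _ h2.key_lt
    have htab := h3'.congr (hp.table_eq hpr)
    simp only [stepOp, inLLX_eq]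
    rcases hres : (stepLLX (E.heap t) tbl r pc).2.2 with pc' | res <;> rw [hres] at hp
    · exact ⟨k, n, rfl, h2', htab, hp.2⟩
    · refine ⟨k, n, rfl, h2', htab, hp.resultOK, ?_⟩
      rintro c nx rfl
      obtain ⟨i', -, -, -, h5, h6⟩ := hp
      -- The successful rereading of `info` shows that the node is in the list at this very moment
      -- with the count returned. This is where a `Delete` finding too few occurrences can be
      -- linearized.
      exact ⟨t + 1, hi.trans t.lt_succ_self, le_rfl, h5, h6⟩
  | delLLXn p r x pc =>
    obtain ⟨k, n, rfl, h2, h3⟩ := h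
    obtain ⟨k', n', h1', h2', -⟩ := hm
    cases h1'
    obtain ⟨h4, h5, h6⟩ := h2.keys
    have hp := hllx x pc h6 h3 (by simp only [stepOp, inLLX_eq]) rfl
    have hpx : p ≠ x := by rintro rfl; exact lt_irrefl _ (h4.trans h5)
    have hrx : r ≠ x := by rintro rfl; exact lt_irrefl _ h5
    have htab := h2'.congr (hp.table_eq hpx) (hp.table_eq hrx)
    simp only [stepOp, inLLX_eq]
    rcases hres : (stepLLX (E.heap t) tbl x pc).2.2 with pc' | res <;> rw [hres] at hp
    · exact ⟨k, n, rfl, htab, hp.2⟩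
    · exact ⟨k, n, rfl, htab, hp.resultOK⟩
  | insR r res =>
    obtain ⟨k, n, rfl, h2, h3, h4⟩ := h
    cases res with
    | snapshot c nx =>
      have := hscx .done rfl rfl
      rw [hh] at this; exact this
    | _ => trivial
  | insP p r res =>
    obtain ⟨k, n, rfl, h2, h3, h4⟩ := h
    cases res with
    | snapshot c nx =>
      simp only [stepOp, stepInsP] at hscx hh ⊢
      split_ifs at hscx hh ⊢ with hnx
      · have := hscx .done rfl rfl
        rw [hh] at this; exact this
      · trivial
    | _ => trivial
  | delTest p r lp lr =>
    obtain ⟨k, n, rfl, h2, h3, h4, h5⟩ := h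
    obtain ⟨k', n', h1', h2', h3', h4', -⟩ := hm
    cases h1'
    cases lp with
    | snapshot c₀ pn =>
      cases lr with
      | snapshot c rn =>
        simp only [stepOp, stepDelTest] at hscx hh ⊢
        by_cases hpn : pn = some r
        · rw [if_pos hpn] at hscx hh ⊢
          by_cases hk : (k : WithBot (WithTop K)) ≠ ((E.heap t).node r).key ∨ c < n
          · rw [if_pos hk]
            by_cases hk' : (k : WithBot (WithTop K)) = ((E.heap t).node r).key
            · have hlt := hk.resolve_left (not_not.2 hk')
              obtain ⟨s, h6, h7, h8, h9⟩ := h5 c rn rfl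
              refine .read s h6 h7 (fun m hm => ?_) (by simp)
              have := (hm k).1 r h8 (by
                rw [← H.key_eq h7 (listed_of_inList le_rfl h8)]; exact hk'.symm)
              rw [h9] at this
              simp [spec, this, hlt.not_ge]
            · obtain ⟨s, h6, h7, h8⟩ := h2.count_eq_zero H hk'
              refine .read s h6 h7 (fun m hm => ?_) (by simp)
              -- The key is absent, and `n > 0` by the precondition; for `n = 0` the specification
              -- would ask for True.
              have hn : ¬ n ≤ m.count k := by rw [h8 m hm]; exact not_le.2 hpre
              simp only [spec, if_neg hn]
          · rw [if_neg hk] at hscx hh ⊢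
            push Not at hk
            by_cases hnc : n < c
            · rw [if_pos hnc] at hscx hh ⊢
              have := hscx (.bool true) rfl rfl
              rw [hh] at this; exact this
            · rw [if_neg hnc]
              split
              · obtain ⟨h6, h7, h8⟩ := h4'
                refine ⟨k, n, rfl, ⟨h3'.1, h3'.2.2.trans hpn, h6,
                  h7.trans (le_antisymm (not_lt.1 hnc) hk.2), h8, ?_, h2'.lt⟩, trivial⟩
                exact (hkey r h2.edge.listed.2).trans hk.1.symm
              · obtain ⟨h6, h7, h8⟩ := h4
                -- Only nodes with key `∞` have next pointer `Nil`, and the key of `r` is the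
                -- genuine key `k`.
                obtain ⟨b, -, h9, -⟩ := h6.next.2 (by
                  change ((E.heap t).node r).key ≠ _
                  rw [← hk.1]; exact coe_ne_top k)
                rw [h8] at h9; cases h9
        · rw [if_neg hpn]; trivial
      | _ => trivial
    | _ => trivial
  | delN p r x res =>
    obtain ⟨k, n, rfl, h2, h3⟩ := h
    cases res with
    | snapshot c nx =>
      have := hscx (.bool true) rfl rfl
      rw [hh] at this; exact this
    | _ => trivial
  | scx u pc ret =>
    obtain ⟨h1, h2, h3⟩ := h
    have hp : HelpPost (E.ghost (t + 1)) u (stepHelp (E.heap t) u pc).2 := by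
      have hst : (stepOp (E.heap t) tbl op (.scx u pc ret)).1 = (stepHelp (E.heap t) u pc).1 := by
        simp only [stepOp]
        rcases stepHelp (E.heap t) u pc with ⟨h₁, pc₁ | b⟩
        · rfl
        · cases b <;> rfl
      rw [hg, hh, hst]
      exact h1.post hS
    revert hp
    simp only [stepOp]
    rcases stepHelp (E.heap t) u pc with ⟨h₁, pc₁ | b⟩
    · exact fun hp => ⟨hp, h2, h3⟩
    · cases b with
      | false => exact fun _ => trivial
      | true => exact fun hp => .update u pc rfl h3 hp
  | fault => exact absurd h id

end OperationResults

/-! ### The invariant holds in every configuration of an execution. -/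

section Reachability

variable {P K : Type*} [DecidableEq P] [LinearOrder K] {E : Execution P K}

lemma helpLabel_eq_some {h : Heap K} {v u : RecPtr} {pc : HelpPC} :
    helpLabel h v pc = some u ↔
      v = u ∧ pc = .updateCAS ∧ h.readFld (h.scx u).fld = (h.scx u).old := by
  cases pc with
  | updateCAS =>
    simp only [helpLabel]
    split_ifs with hr
    · simp only [Option.some.injEq, true_and]
      exact ⟨fun hv => ⟨hv, hv ▸ hr⟩, fun hv => hv.1⟩
    · simp only [false_iff]
      rintro ⟨rfl, -, h⟩
      exact hr h
  | _ => simp [helpLabel]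

lemma llxLabel_eq_some {h : Heap K} {u : RecPtr} {pc : LLXPC} :
    llxLabel h pc = some u ↔
      ((∃ m, pc = .helpFinal m u .updateCAS) ∨ pc = .helpFail u .updateCAS) ∧
      h.readFld (h.scx u).fld = (h.scx u).old := by
  cases pc with
  | helpFinal m v pc =>
    simp only [llxLabel, helpLabel_eq_some]
    constructor
    · rintro ⟨rfl, rfl, h⟩; exact ⟨.inl ⟨m, rfl⟩, h⟩
    · rintro ⟨⟨m, h⟩ | h, h'⟩ <;> cases h
      exact ⟨rfl, rfl, h'⟩
  | helpFail v pc =>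
    simp only [llxLabel, helpLabel_eq_some]
    constructor
    · rintro ⟨rfl, rfl, h⟩; exact ⟨.inr rfl, h⟩
    · rintro ⟨⟨m, h⟩ | h, h'⟩ <;> cases h
      exact ⟨rfl, rfl, h'⟩
  | _ => simp [llxLabel]

lemma opLabel_eq_some {h : Heap K} {u : RecPtr} {pc : PC} :
    opLabel h pc = some u ↔
      pc.AtUpdateCAS u ∧ h.readFld (h.scx u).fld = (h.scx u).old := by
  cases pc with
  | scx v pc ret =>
    simp only [opLabel, helpLabel_eq_some, PC.AtUpdateCAS]
    constructor
    · rintro ⟨rfl, rfl, h⟩; exact ⟨.inl ⟨ret, rfl⟩, h⟩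
    · rintro ⟨⟨m, h⟩ | ⟨l, -, ⟨_, h⟩ | ⟨_, _, h⟩ | ⟨_, _, h⟩ | ⟨_, _, _, h⟩ | ⟨_, _, _, h⟩⟩, h'⟩ <;>
        cases h
      exact ⟨rfl, rfl, h'⟩
  | _ => simp [opLabel, PC.AtUpdateCAS, llxLabel_eq_some]

lemma Execution.updatesAt_iff {t : ℕ} {p : P} {op : Op K} {pc : PC}
    (ha : E.act t = .internal p) (hc : ((E.conf t).proc p).cur = some (op, pc)) (u : RecPtr) :
    E.UpdatesAt t u ↔ opLabel (E.heap t) pc = some u := by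
  rw [opLabel_eq_some]
  constructor
  · rintro ⟨q, op', pc', ha', hc', h⟩
    rw [ha] at ha'; cases ha'
    rw [hc] at hc'; cases hc'
    exact h
  · exact fun h => ⟨p, op, pc, ha, hc, h⟩

lemma Execution.not_updatesAt {t : ℕ} (ha : ∀ p, E.act t ≠ .internal p) (u : RecPtr) :
    ¬ E.UpdatesAt t u := fun ⟨p, _, _, h, _⟩ => ha p h

/-- `UpdatesAt` counts internal steps only, so it matters that no step at which an operation returns
is a successful update CAS. -/
lemma stepOp_respond {h h' : Heap K} {tbl tbl' : Table} {op : Op K} {pc : PC} {v : Resp}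
    (hs : stepOp h tbl op pc = (h', tbl', .inr v)) :
    opLabel h pc = none ∧ h'.numRecs = h.numRecs := by
  cases pc with
  | found p r =>
    simp only [stepOp, Prod.mk.injEq] at hs
    exact ⟨rfl, hs.1 ▸ rfl⟩
  | scx u pc ret =>
    have hn := stepHelp_numRecs h u pc
    simp only [stepOp] at hs
    constructor
    · rw [Option.eq_none_iff_forall_ne_some]
      intro w hw
      obtain ⟨rfl, rfl, hr⟩ := helpLabel_eq_some.1 hw
      simp only [stepHelp, if_pos hr] at hs
      cases hs
    · rcases hsh : stepHelp h u pc with ⟨h₁, pc₁ | b⟩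
      · rw [hsh] at hs; cases hs
      · rw [hsh] at hs hn
        cases b with
        | false => cases hs
        | true => cases hs; exact hn
  | start => simp only [stepOp] at hs; split at hs <;> cases hs
  | search p r => simp only [stepOp] at hs; split_ifs at hs <;> [split at hs; skip] <;> cases hs
  | insLLXr r pc => simp only [stepOp, inLLX_eq] at hs; cases hs
  | insLLXp p r pc => simp only [stepOp, inLLX_eq] at hs; cases hs
  | delLLXp p r pc => simp only [stepOp, inLLX_eq] at hs; cases hs
  | delLLXr p r lp pc => simp only [stepOp, inLLX_eq] at hs; cases hs
  | delLLXn p r x pc => simp only [stepOp, inLLX_eq] at hs; cases hs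
  | insR r res =>
    cases op <;> simp only [stepOp] at hs <;> cases res <;> simp [stepInsR, callSCX] at hs
  | insP p r res =>
    cases op <;> simp only [stepOp] at hs <;> cases res <;> simp [stepInsP, callSCX] at hs
    split_ifs at hs <;> cases hs
  | delTest p r lp lr =>
    cases op <;> simp only [stepOp] at hs <;> cases lp <;> cases lr <;>
      try simp only [stepDelTest] at hs
    case delete.snapshot.snapshot k n c₀ pn c rn =>
      by_cases h1 : pn = some r
      · rw [if_pos h1] at hs
        by_cases h2 : (k : WithBot (WithTop K)) ≠ (h.node r).key ∨ c < n
        · rw [if_pos h2] at hs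
          cases hs
          exact ⟨rfl, rfl⟩
        · rw [if_neg h2] at hs
          by_cases h3 : n < c
          · rw [if_pos h3] at hs; cases hs
          · rw [if_neg h3] at hs
            split at hs <;> cases hs
      · rw [if_neg h1] at hs; cases hs
    all_goals cases hs
  | delN p r x res =>
    simp only [stepOp] at hs
    cases res <;> simp [stepDelN, callSCX] at hs
  | fault => simp [stepOp] at hs

/-- The invariant of executions. -/
structure Execution.Inv (E : Execution P K) (t : ℕ) : Prop where
  history : E.History t
  procs : ∀ p op pc, ((E.conf t).proc p).cur = some (op, pc) →
    ∃ i, E.Pending p i op t ∧ E.PCInv t i op ((E.conf t).proc p).table pc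

lemma inList_initial {a : Ptr} (h : InList (Heap.initial K) a) : a < 2 := by
  induction h with
  | head => exact Nat.lt_succ_self 1
  | @next a b _ hb ih =>
    by_cases ha : a = head
    · subst ha
      simp only [Heap.initial, if_true, mkNode, Option.some.injEq] at hb
      rw [← hb]; exact Nat.zero_lt_succ 1
    · simp [Heap.initial, ha, mkNode] at hb

lemma Execution.ghost_zero_inv : (E.ghost 0).Inv := by
  have hheap : E.heap 0 = Heap.initial K := by rw [heap, E.conf_zero]; rfl
  have hf : ∀ r u, (E.ghost 0).froze r u ↔ u = dummy := by
    intro r u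
    simp only [ghost, Nat.le_zero, exists_eq_left, hheap, Heap.initial]
    split_ifs <;> exact eq_comm
  have hl : ∀ a, (E.ghost 0).listed a ↔ InList (Heap.initial K) a := by
    intro a
    simp only [ghost, Nat.le_zero, exists_eq_left, hheap]
  have hu : ∀ u, ¬ (E.ghost 0).updated u := by
    rintro u ⟨s, hs, -⟩
    exact absurd hs (Nat.not_lt_zero s)
  have hinfo : ∀ r, ((Heap.initial K).node r).info = dummy ∧
      ((Heap.initial K).node r).marked = false := by
    intro r
    simp only [Heap.initial]
    split_ifs <;> exact ⟨rfl, rfl⟩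
  have hd : ∀ u < (E.ghost 0).heap.numRecs, u = dummy := by
    intro u hu
    rw [ghost_heap, hheap] at hu
    exact Nat.lt_one_iff.1 hu
  have hgh : (E.ghost 0).heap = Heap.initial K := hheap
  exact {
    sorted := by
      rw [hgh]
      refine ⟨Nat.lt_succ_self 1, rfl, fun a ha => ?_⟩
      by_cases h : a = head
      · subst h
        refine ⟨fun hk => ?_, fun _ => ⟨tail, Nat.zero_lt_succ 1, rfl, ?_⟩⟩
        · simp [Heap.initial, mkNode] at hk
        · simp [Heap.initial, mkNode, head, tail]
      · refine ⟨fun _ => ?_, fun hk => ?_⟩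
        · simp [Heap.initial, mkNode, h]
        · simp [Heap.initial, mkNode, h] at hk
    recs_pos := by rw [hgh]; exact Nat.zero_lt_one
    dummy_state := by rw [Ghost.scx, hgh]; rfl
    dummy_allFrozen := by rw [Ghost.scx, hgh]; rfl
    froze_info := fun r => by rw [hf, Ghost.node, hgh, (hinfo r).1]
    froze_dummy := fun r => by rw [hf]
    froze_le := fun r u h => by rw [(hf r u).1 h]; exact Nat.zero_le _
    froze_lt := fun r u h => by rw [(hf r u).1 h, hgh]; exact Nat.zero_lt_one
    froze_mem := fun r u h hne => absurd ((hf r u).1 h) hne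
    froze_done := fun r u h hne => by
      rw [Ghost.node, hgh, (hinfo r).1, (hf r u).1 h] at hne
      exact absurd rfl hne
    froze_prefix := fun u l₁ r l₂ hne _ h => absurd ((hf r u).1 h) hne
    unallocated := fun r _ => by rw [Ghost.node, hgh]; exact hinfo r
    aborted := fun u h hne => absurd (hd u h) hne
    committed := fun u h hst => by
      rw [hd u h, Ghost.scx, hgh] at hst; cases hst
    updated_lt := fun u h => absurd h (hu u)
    updated_allFrozen := fun u h => absurd h (hu u)
    updated_marked := fun u h => absurd h (hu u)
    updated_rank := fun u h => absurd h (hu u)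
    allFrozen := fun u h haf => by
      rw [hd u h, Ghost.scx, hgh] at haf; cases haf
    listed := fun a h => by rw [hl]; exact hgh ▸ h
    listed_lt := fun a h => by rw [hgh]; exact inList_initial ((hl a).1 h)
    listed_next := fun a b h hb => by
      rw [hl] at h ⊢
      rw [Ghost.node, hgh] at hb
      exact h.next hb
    listed_cases := fun a h => .inl (by rw [hgh]; exact (hl a).1 h)
    removed := fun u a h => absurd h (hu u)
    removed_info := fun u a h => absurd h (hu u)
    marked := fun a h => by rw [Ghost.node, hgh, (hinfo a).2] at h; cases h
    record := fun u h hne => absurd (hd u h) hne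
    fresh := fun u h a hne => absurd (hd u h) hne
    new_inj := fun u h v _ a hne => absurd (hd u h) hne }

lemma Execution.Pending.succ {p : P} {i : ℕ} {op : Op K} {t : ℕ} (h : E.Pending p i op t)
    (ha : ∀ w, E.act t ≠ .respond p w) : E.Pending p i op (t + 1) := by
  refine ⟨h.1, h.2.1.trans t.lt_succ_self, fun m h1 h2 w => ?_⟩
  rcases (Nat.lt_succ_iff.1 h2).lt_or_eq with h2 | rfl
  · exact h.2.2 m h1 h2 w
  · exact ha w

lemma Execution.Pending.pre {p : P} {i : ℕ} {op : Op K} {t : ℕ} (h : E.Pending p i op t) :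
    op.Pre := by
  have := E.next i
  rw [h.1] at this
  exact this.2.1

/-- The owner of a new record is the instance that creates it. -/
lemma Execution.CreatesAt.opOf_eq {u : RecPtr} {i : ℕ} {p : P} {op : Op K} {t : ℕ}
    (h : E.CreatesAt u i p op t) (s : ℕ) : (E.ghost s).opOf u = some op := by
  simp only [ghost, h.owner_eq, opAt, h.2.1.1]

lemma Execution.History.succ {t : ℕ} (H : E.History t) {l : Option RecPtr}
    (he : Effect (E.ghost t) (E.heap (t + 1)) l) (hl : ∀ u, E.UpdatesAt t u ↔ l = some u) :
    E.History (t + 1) where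
  inv s hs := by
    rcases Nat.le_succ_iff.1 hs with hs | rfl
    · exact H.inv s hs
    · rw [ghost_succ hl]; exact he.inv (H.inv t le_rfl)
  step s hs := by
    rcases (Nat.lt_succ_iff.1 hs).lt_or_eq with hs | rfl
    · exact H.step s hs
    · exact ⟨l, he, hl⟩

/-- The justification of responses is proved along with the inductive step, since both come from the
same analysis of the step. -/
lemma Execution.Inv.succ {t : ℕ} (h : E.Inv t) :
    E.Inv (t + 1) ∧ ∀ p v, E.act t = .respond p v → ∃ i op pc, E.Pending p i op t ∧
      ((E.conf t).proc p).cur = some (op, pc) ∧ E.Responds t i op v pc := by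
  have H := h.history
  have hS := H.inv t le_rfl
  -- the other processes
  have hother : ∀ {l : Option RecPtr}, Effect (E.ghost t) (E.heap (t + 1)) l →
      (∀ u, E.UpdatesAt t u ↔ l = some u) → ∀ p op pc, (E.act t).proc? ≠ some p →
      ((E.conf (t + 1)).proc p).cur = some (op, pc) → ∃ i, E.Pending p i op (t + 1) ∧
        E.PCInv (t + 1) i op ((E.conf (t + 1)).proc p).table pc := by
    intro l he hl p op pc hp hc
    rw [proc_eq_of_ne hp] at hc ⊢
    obtain ⟨i, hi, hpc⟩ := h.procs p op pc hc
    refine ⟨i, hi.succ fun w ha => hp (by rw [ha]; rfl), hpc.succ hS ?_⟩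
    rw [ghost_succ hl]; exact he.mono hS
  have hn := E.next t
  cases ha : E.act t with
  | stutter =>
    rw [ha] at hn
    have hconf : E.conf (t + 1) = E.conf t := hn
    have hl : ∀ u, E.UpdatesAt t u ↔ none = some u := fun u => by
      simp [not_updatesAt (u := u) (by simp [ha] : ∀ p, E.act t ≠ .internal p)]
    have he : Effect (E.ghost t) (E.heap (t + 1)) none := by
      rw [heap, hconf]; exact .skip
    exact ⟨⟨H.succ he hl, fun p op pc hc => hother he hl p op pc (by simp [ha, Action.proc?]) hc⟩,
      by simp⟩
  | invoke q op' =>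
    rw [ha] at hn
    obtain ⟨h1, h2, hconf⟩ := hn
    have hl : ∀ u, E.UpdatesAt t u ↔ none = some u := fun u => by
      simp [not_updatesAt (u := u) (by simp [ha] : ∀ p, E.act t ≠ .internal p)]
    have he : Effect (E.ghost t) (E.heap (t + 1)) none := by
      rw [heap, hconf]; exact .skip
    refine ⟨⟨H.succ he hl, fun p op pc hc => ?_⟩, by simp⟩
    by_cases hpq : q = p
    · subst hpq
      rw [hconf] at hc
      simp only [Config.set, Function.update_self, Option.some.injEq, Prod.mk.injEq] at hc
      obtain ⟨rfl, rfl⟩ := hc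
      exact ⟨t, ⟨ha, t.lt_succ_self, fun m h3 h4 => by omega⟩, trivial⟩
    · exact hother he hl p op pc (by simpa [ha, Action.proc?] using hpq) hc
  | internal q =>
    rw [ha] at hn
    obtain ⟨op, pc, h', tbl', pc₁, hc, hst, hconf⟩ := hn
    obtain ⟨i, hi, hpc⟩ := h.procs q op pc hc
    have hl := updatesAt_iff ha hc
    have hheap : E.heap (t + 1) = (stepOp (E.heap t) ((E.conf t).proc q).table op pc).1 := by
      rw [hst]; change (E.conf (t + 1)).heap = h'; rw [hconf]; rfl
    have hcre : (stepOp (E.heap t) ((E.conf t).proc q).table op pc).1.numRecs =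
        (E.heap t).numRecs + 1 → E.CreatesAt (E.heap t).numRecs i q op t := fun hnum =>
      ⟨ha, hi, rfl, by rw [hheap]; exact hnum⟩
    have he := hpc.effect hS hi.pre fun hnum => (hcre hnum).opOf_eq t
    have hpost := hpc.post H hi.pre hi.2.1 (by
      rw [ghost_succ hl, hheap]; exact he.mono hS) hheap (ghost_succ hl)
      fun hnum => (hcre hnum).owner_eq
    rw [← hheap] at he
    refine ⟨⟨H.succ he hl, fun p op' pc' hc' => ?_⟩, by simp⟩
    by_cases hpq : q = p
    · subst hpq
      rw [hconf] at hc' ⊢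
      simp only [Config.set, Function.update_self, Option.some.injEq, Prod.mk.injEq] at hc' ⊢
      obtain ⟨rfl, rfl⟩ := hc'
      rw [hst] at hpost
      exact ⟨i, hi.succ (by simp [ha]), hpost⟩
    · exact hother he hl p op' pc' (by simpa [ha, Action.proc?] using hpq) hc'
  | respond q v =>
    rw [ha] at hn
    obtain ⟨op, pc, h', tbl', hc, hst, hconf⟩ := hn
    obtain ⟨i, hi, hpc⟩ := h.procs q op pc hc
    obtain ⟨hlab, hrecs⟩ := stepOp_respond hst
    have hl : ∀ u, E.UpdatesAt t u ↔ opLabel (E.heap t) pc = some u := fun u => by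
      rw [show opLabel (E.heap t) pc = none from hlab]
      simp [not_updatesAt (u := u) (by simp [ha] : ∀ p, E.act t ≠ .internal p)]
    have hheap : E.heap (t + 1) = (stepOp (E.heap t) ((E.conf t).proc q).table op pc).1 := by
      rw [hst]; change (E.conf (t + 1)).heap = h'; rw [hconf]; rfl
    -- A returning step creates no record, so the ownership hypotheses are vacuous.
    have hno : (stepOp (E.heap t) ((E.conf t).proc q).table op pc).1.numRecs ≠
        (E.heap t).numRecs + 1 := by
      rw [hst]; exact fun h => absurd (hrecs.symm.trans h) (Nat.lt_succ_self _).ne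
    have he := hpc.effect hS hi.pre fun hnum => absurd hnum hno
    have hpost := hpc.post H hi.pre hi.2.1 (by
      rw [ghost_succ hl, hheap]; exact he.mono hS) hheap (ghost_succ hl)
      fun hnum => absurd hnum hno
    rw [← hheap] at he
    refine ⟨⟨H.succ he hl, fun p op' pc' hc' => ?_⟩, ?_⟩
    · by_cases hpq : q = p
      · subst hpq
        rw [hconf] at hc'
        simp [Config.set] at hc'
      · exact hother he hl p op' pc' (by simpa [ha, Action.proc?] using hpq) hc'
    · intro p w hpw
      cases hpw
      rw [hst] at hpost
      exact ⟨i, op, pc, hi, hc, hpost⟩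

theorem Execution.inv (E : Execution P K) (t : ℕ) : E.Inv t := by
  induction t with
  | zero =>
    refine ⟨⟨fun s hs => ?_, fun s hs => absurd hs (Nat.not_lt_zero s)⟩, fun p op pc hc => ?_⟩
    · rw [Nat.le_zero.1 hs]; exact ghost_zero_inv
    · rw [E.conf_zero] at hc
      cases hc
  | succ t ih => exact ih.succ.1

lemma Execution.ghost_inv (E : Execution P K) (t : ℕ) : (E.ghost t).Inv :=
  (E.inv t).history.inv t le_rfl

lemma Execution.ghost_mono (E : Execution P K) (t : ℕ) : Mono (E.ghost t) (E.ghost (t + 1)) :=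
  (E.inv (t + 1)).history.mono_succ t.lt_succ_self

lemma Execution.exists_effect (E : Execution P K) (t : ℕ) :
    ∃ l, Effect (E.ghost t) (E.heap (t + 1)) l ∧ ∀ u, E.UpdatesAt t u ↔ l = some u :=
  (E.inv (t + 1)).history.step t t.lt_succ_self

end Reachability

/-! ### The effect of steps on the multiset of keys. -/

section Contents

variable {K : Type*} [LinearOrder K] {S : Ghost K}

/-- A step that is not a successful update CAS does not change the nodes that have been in the
list. -/
lemma Effect.fields_eq (hS : S.Inv) {h : Heap K} (he : Effect S h none) {r : Ptr}
    (hr : S.listed r) : (h.node r).key = (S.node r).key ∧ (h.node r).count = (S.node r).count ∧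
      (h.node r).next = (S.node r).next := by
  cases he with
  | skip => exact ⟨rfl, rfl, rfl⟩
  | freeze u r' l₁ l₂ lt ne hV hl info => by_cases hr : r = r' <;> simp [Heap.setNode, hr]
  | mark u r' lt ne af hR => by_cases hr : r = r' <;> simp [Heap.setNode, hr]
  | abort u lt ne hc' => exact ⟨rfl, rfl, rfl⟩
  | frozen u lt ne hf => exact ⟨rfl, rfl, rfl⟩
  | commit u hup => exact ⟨rfl, rfl, rfl⟩
  | allocate h' x ha sorted rec fresh =>
    rw [ha.node r (hS.listed_lt r hr)]; exact ⟨rfl, rfl, rfl⟩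

lemma Effect.inList_iff (hS : S.Inv) {h : Heap K} (he : Effect S h none) {a : Ptr} :
    InList h a ↔ InList S.heap a :=
  inList_congr fun _ hb => (he.fields_eq hS (hS.listed _ hb)).2.2

/-- The nodes removed by a step are the ones finalized by the record updated by the step. -/
lemma Effect.removed_iff (hS : S.Inv) {h : Heap K} {l : Option RecPtr} (he : Effect S h l)
    (a : Ptr) :
    (InList S.heap a ∧ ¬ InList h a) ↔ ∃ u, l = some u ∧ a ∈ (S.scx u).R := by
  cases l with
  | none =>
    rw [he.inList_iff hS]
    simp
  | some u =>
    cases he with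
    | update _ lt ne af hR old =>
      have hrec := hS.record u lt ne
      simp only [Option.some.injEq, exists_eq_left']
      rcases hrec.kind with ⟨r', k, n, c, nx, hc⟩ | ⟨p, r', a', key, c, y, hc⟩
      · have hI : InList (S.heap.setNode r' { S.heap.node r' with count := c + n }) a ↔
            InList S.heap a := by
          refine inList_congr fun b _ => ?_
          by_cases hb : b = r' <;> simp [Heap.setNode, hb]
        rw [hc.writeFld_eq, hI, hc.R]
        simp
      · have hr := (hc.ready hS lt ne af old).1
        rw [hc.writeFld_eq, hr.inList_iff hS]
        constructor
        · rintro ⟨h1, h2⟩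
          by_contra h3
          exact h2 (.inl ⟨h1, h3⟩)
        · refine fun h => ⟨hr.R_mem a h, ?_⟩
          rintro (h1 | rfl)
          · exact h1.2 h
          · exact hr.a_fresh (hS.listed _ (hr.R_mem _ h))

/-- The contents of the list after the nodes in `R` have been replaced by `a`. -/
lemma IsContents.replace {h h' : Heap K} {m m' : Multiset K} {a : Ptr} {R : List Ptr}
    (hc : IsContents h m)
    (hI : ∀ b, InList h' b ↔ (InList h b ∧ b ∉ R) ∨ b = a)
    (hn : ∀ b, (h'.node b).key = (h.node b).key ∧ (h'.node b).count = (h.node b).count)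
    (new : ∀ k : K, (h.node a).key = (k : WithBot (WithTop K)) →
      m'.count k = (h.node a).count ∧
        ∀ b, InList h b → (h.node b).key = (k : WithBot (WithTop K)) → b ∈ R)
    (gone : ∀ k : K, (h.node a).key ≠ (k : WithBot (WithTop K)) →
      ∀ b ∈ R, (h.node b).key = (k : WithBot (WithTop K)) → m'.count k = 0)
    (same : ∀ k : K, (h.node a).key ≠ (k : WithBot (WithTop K)) →
      (∀ b ∈ R, (h.node b).key ≠ (k : WithBot (WithTop K))) → m'.count k = m.count k)
    (hs : ∀ b d, InList h b → InList h d → (h.node b).key = (h.node d).key → b = d)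
    (hRm : ∀ b ∈ R, InList h b) :
    IsContents h' m' := by
  intro k
  by_cases hak : (h.node a).key = (k : WithBot (WithTop K))
  · obtain ⟨h1, h2⟩ := new k hak
    constructor
    · intro b hb hbk
      rw [(hn b).1] at hbk
      rw [(hn b).2]
      rcases (hI b).1 hb with ⟨h3, h4⟩ | rfl
      · exact absurd (h2 b h3 hbk) h4
      · exact h1
    · intro hne
      exact absurd ⟨a, (hI a).2 (.inr rfl), (hn a).1.trans hak⟩ hne
  · by_cases hR : ∃ b ∈ R, (h.node b).key = (k : WithBot (WithTop K))
    · obtain ⟨b, hb, hbk⟩ := hR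
      refine ⟨fun d hd hdk => ?_, fun _ => gone k hak b hb hbk⟩
      rw [(hn d).1] at hdk
      rcases (hI d).1 hd with ⟨h3, h4⟩ | rfl
      · rw [hs d b h3 (hRm b hb) (hdk.trans hbk.symm)] at h4
        exact absurd hb h4
      · exact absurd hdk hak
    · push Not at hR
      rw [same k hak hR]
      constructor
      · intro b hb hbk
        rw [(hn b).1] at hbk
        rw [(hn b).2]
        rcases (hI b).1 hb with ⟨h3, h4⟩ | rfl
        · exact (hc k).1 b h3 hbk
        · exact absurd hbk hak
      · refine fun hne => (hc k).2 ?_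
        rintro ⟨b, hb, hbk⟩
        refine hne ⟨b, (hI b).2 (.inl ⟨hb, fun hbR => hR b hbR hbk⟩), (hn b).1.trans hbk⟩

/-- A successful update CAS changes the contents of the list as prescribed by the operation to
which the record belongs. -/
lemma Effect.contents (hS : S.Inv) {h : Heap K} {u : RecPtr} (he : Effect S h (some u))
    {m : Multiset K} (hm : IsContents S.heap m) : ∃ op, S.opOf u = some op ∧
      IsContents h (spec m op).1 ∧ (spec m op).2 = op.updateResp := by
  cases he with
  | update _ lt ne af hR old =>
    have hrec := hS.record u lt ne
    obtain ⟨hup, -, hinfo⟩ := hS.at_update lt ne af old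
    have hin {r} := hS.inList_of_mem_V lt ne af old (r := r)
    have hinj : ∀ b d, InList S.heap b → InList S.heap d → (S.node b).key = (S.node d).key →
        b = d := fun b d hb hd hk => hb.eq_of_key_eq hS.sorted hd hk
    rcases hrec.kind with ⟨r', k, n, c, nx, hc⟩ | ⟨p, r, a, key, c, y, hc⟩
    · have hV : r' ∈ (S.scx u).V := by simp [hc.V]
      have hcount := (hc.snap.same (hinfo r' hV) hup).1
      have hr' := hin hV
      have hmc := (hm k).1 r' hr' hc.key
      refine ⟨_, hc.op, ?_, rfl⟩
      rw [hc.writeFld_eq]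
      intro k'
      have hn : ∀ b, ((S.heap.setNode r' { S.heap.node r' with count := c + n }).node b).key =
          (S.node b).key ∧ ((S.heap.setNode r' { S.heap.node r' with count := c + n }).node b).next
            = (S.node b).next := by
        intro b
        by_cases hb : b = r' <;> simp [Heap.setNode, hb]
      have hI : ∀ b, InList (S.heap.setNode r' { S.heap.node r' with count := c + n }) b ↔
          InList S.heap b := fun b => inList_congr fun d _ => (hn d).2
      simp only [hI, hn, spec, Multiset.count_add, Multiset.count_replicate]
      by_cases hk : k = k'
      · subst hk
        refine ⟨fun b hb hbk => ?_, fun hne => absurd ⟨r', hr', hc.key⟩ hne⟩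
        obtain rfl := hinj b r' hb hr' (hbk.trans hc.key.symm)
        simp only [if_true, Heap.setNode, Function.update_self]
        rw [hmc, hcount]
      · simp only [if_neg hk, add_zero]
        refine ⟨fun b hb hbk => ?_, (hm k').2⟩
        have hbr : b ≠ r' := by
          rintro rfl
          refine hk ?_
          exact WithTop.coe_injective (WithBot.coe_injective (hc.key.symm.trans hbk))
        rw [(hm k').1 b hb hbk]
        simp [Heap.setNode, hbr]
    · obtain ⟨hr, hpr, hac⟩ := hc.ready hS lt ne af old
      have hn : ∀ b, ((S.heap.setNode p { S.heap.node p with next := some a }).node b).key =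
          (S.node b).key ∧
          ((S.heap.setNode p { S.heap.node p with next := some a }).node b).count
            = (S.node b).count := by
        intro b
        by_cases hb : b = p <;> simp [Heap.setNode, hb]
      have hcoe : ∀ {k k' : K}, (k : WithBot (WithTop K)) = (k' : WithBot (WithTop K)) → k = k' :=
        fun h => WithTop.coe_injective (WithBot.coe_injective h)
      have hak := hc.new_node.key
      rw [hc.writeFld_eq]
      have hRV : ∀ {b}, b ∈ (S.scx u).R → (S.node b).info = u := fun hb =>
        hinfo _ (hrec.R_subset hb)
      rcases hc.repl with ⟨k, op, R, h1, h2, h3⟩ | ⟨k, n, c', op, R, h1, h2, h3, h4, h5⟩ |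
        ⟨k, n, x, op, R, h1, h2, h3, h4⟩
      -- The key lies strictly between those of the consecutive nodes `p` and `r`, so it is not in
      -- the list.
      · have hno : ¬ ∃ b, InList S.heap b ∧ (S.node b).key = (k : WithBot (WithTop K)) :=
          hr.p_mem.not_exists_key hS.sorted hpr (h1 ▸ hc.key_lt) (h1 ▸ h3)
        have hz := (hm k).2 hno
        refine ⟨_, op, hm.replace (hr.inList_iff hS) hn ?_ ?_ ?_ hinj hr.R_mem, rfl⟩
        · intro k' hk'
          obtain rfl := hcoe (h1.symm.trans (hak.symm.trans hk'))
          refine ⟨?_, fun b hb hbk => absurd ⟨b, hb, hbk⟩ hno⟩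
          simp [spec, hz, hac]
        · simp [R]
        · intro k' hk' _
          have : k ≠ k' := by
            rintro rfl
            exact hk' (hak.trans h1)
          simp [spec, Multiset.count_replicate, this]
      -- The new node takes over the key of `r` with a count smaller by `n`.
      · have hrR : r ∈ (S.scx u).R := by simp [R]
        have hcount := (h3.same (hRV hrR) hup).1
        have hmc := (hm k).1 r (hr.R_mem r hrR) (h2.trans h1)
        have hle : n ≤ m.count k := by rw [hmc]; exact h4.le.trans hcount.ge
        have hsp : spec m (.delete k n) = (m - Multiset.replicate n k, .bool true) := if_pos hle
        refine ⟨_, op, ?_, by rw [hsp]; rfl⟩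
        rw [hsp]
        refine hm.replace (hr.inList_iff hS) hn ?_ ?_ ?_ hinj hr.R_mem
        · intro k' hk'
          obtain rfl := hcoe (h1.symm.trans (hak.symm.trans hk'))
          refine ⟨?_, fun b hb hbk => ?_⟩
          · rw [Multiset.count_sub, Multiset.count_replicate_self, hmc, hcount, ← h5]
            exact hac.symm
          · rw [hinj b r hb (hr.R_mem r hrR) (hbk.trans (h2.trans h1).symm)]; exact hrR
        · intro k' hk' b hb hbk
          rw [R, List.mem_singleton] at hb
          subst hb
          exact absurd (hak.trans (h2.symm.trans hbk)) hk'
        · intro k' hk' _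
          have : k ≠ k' := by
            rintro rfl
            exact hk' (hak.trans h1)
          simp [Multiset.count_replicate, this]
      -- The copy of `x` has the key and count of `x`, so only the key of `r` loses its occurrences,
      -- and it had exactly `n` of them. If `x` has key `∞`, its copy contributes no genuine key.
      · have hrR : r ∈ (S.scx u).R := by simp [R]
        have hxR : x ∈ (S.scx u).R := by simp [R]
        have hcount := (h3.same (hRV hrR) hup).1
        have hcx := (h4.same (hRV hxR) hup).1
        have hmc := (hm k).1 r (hr.R_mem r hrR) h1
        have hrx : (S.node r).key < (S.node x).key := h3.snapshot.next.key_lt.1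
        have hle : n ≤ m.count k := by rw [hmc]; exact hcount.ge
        have hsp : spec m (.delete k n) = (m - Multiset.replicate n k, .bool true) := if_pos hle
        refine ⟨_, op, ?_, by rw [hsp]; rfl⟩
        rw [hsp]
        refine hm.replace (hr.inList_iff hS) hn ?_ ?_ ?_ hinj hr.R_mem
        · intro k' hk'
          have hxk : (S.node x).key = (k' : WithBot (WithTop K)) := h2.trans (hak.symm.trans hk')
          have hne : k ≠ k' := by
            rintro rfl
            rw [h1, hxk] at hrx
            exact lt_irrefl _ hrx
          refine ⟨?_, fun b hb hbk => ?_⟩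
          · rw [Multiset.count_sub, Multiset.count_replicate, if_neg hne, tsub_zero,
              (hm k').1 x (hr.R_mem x hxR) hxk, hcx]
            exact hac.symm
          · rw [hinj b x hb (hr.R_mem x hxR) (hbk.trans hxk.symm)]; exact hxR
        · intro k' hk' b hb hbk
          simp only [R, List.mem_cons, List.not_mem_nil, or_false] at hb
          rcases hb with rfl | rfl
          · obtain rfl := hcoe (h1.symm.trans hbk)
            rw [Multiset.count_sub, Multiset.count_replicate_self, hmc, hcount, tsub_self]
          · exact absurd (hak.trans (h2.symm.trans hbk)) hk'
        · intro k' _ hR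
          have : k ≠ k' := by
            rintro rfl
            exact hR r hrR h1
          simp [Multiset.count_replicate, this]

lemma isContents_initial : IsContents (Heap.initial K) 0 := by
  intro k
  refine ⟨fun a _ _ => ?_, fun _ => Multiset.count_zero k⟩
  simp only [Heap.initial]
  split_ifs <;> simp [mkNode]

end Contents

/-! ### The removed nodes are exactly the finalized ones. -/

section RemovedNodes

variable {P K : Type*} [DecidableEq P] [LinearOrder K]

theorem Execution.removesFinalized (E : Execution P K) : E.RemovesFinalized := by
  intro t a
  obtain ⟨l, he, hl⟩ := E.exists_effect t
  simp only [hl]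
  exact he.removed_iff (E.ghost_inv t) a

end RemovedNodes

/-! ### Steps that create records. -/

section NewRecords

variable {K : Type*}

/-- The abort step is the only exit with False. Hence an operation that retries after an `SCX`
leaves an aborted record behind. -/
lemma stepHelp_false {h h' : Heap K} {u : RecPtr} {pc : HelpPC}
    (hs : stepHelp h u pc = (h', .inr false)) : (h'.scx u).state = .aborted := by
  cases pc with
  | freeze todo => cases todo <;> simp only [stepHelp] at hs <;> (try split_ifs at hs) <;> cases hs
  | mark todo => cases todo <;> cases hs
  | updateCAS => simp only [stepHelp] at hs; split_ifs at hs <;> cases hs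
  | checkFrozen r todo => simp only [stepHelp] at hs; split_ifs at hs <;> cases hs
  | frozenCheck => simp only [stepHelp] at hs; split_ifs at hs <;> cases hs
  | abort => cases hs; simp [Heap.setSCX]
  | frozen => cases hs
  | commit => cases hs

/-- The node for which the table has a new entry if the result of `LLX(r)` is a snapshot. -/
def LLXResult.entries (r : Ptr) : LLXResult → List Ptr
  | .snapshot _ _ => [r]
  | _ => []

/-- The nodes for which the operation has obtained a snapshot in the current iteration. -/
def PC.entries : PC → List Ptr
  | .insR r res => res.entries r
  | .insP p _ res => res.entries p
  | .delLLXr p _ lp _ => lp.entries p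
  | .delTest p r lp lr => lp.entries p ++ lr.entries r
  | .delLLXn p r _ _ => [p, r]
  | .delN p r x res => [p, r] ++ res.entries x
  | _ => []

/-- What a step that creates a record does. -/
structure CreatesRecord (h : Heap K) (tbl : Table) (pc : PC)
    (res : Heap K × Table × (PC ⊕ Resp)) : Prop where
  numRecs : res.1.numRecs = h.numRecs + 1
  pc_eq : ∃ ret, res.2.2 = .inl (.scx h.numRecs (startHelp res.1 h.numRecs) ret)
  pc_ne : ∀ u hp ret, pc ≠ .scx u hp ret
  infoFields : ∀ r, (res.1.scx h.numRecs).infoFields r = (tbl r).info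
  V_subset : ∀ r ∈ (res.1.scx h.numRecs).V, r ∈ pc.entries

lemma createsRecord_callSCX {h h' : Heap K} (hn : h'.numRecs = h.numRecs) (tbl : Table)
    (pc : PC) (hpc : ∀ u hp ret, pc ≠ .scx u hp ret) {V : List Ptr}
    (hV : ∀ r ∈ V, r ∈ pc.entries) (R : List Ptr) (fld : Fld) (new : Val)
    (ret : Resp) : CreatesRecord h tbl pc (callSCX h' tbl V R fld new ret) where
  numRecs := by rw [← hn]; rfl
  pc_eq := ⟨ret, by rw [← hn]; rfl⟩
  pc_ne := hpc
  infoFields r := by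
    rw [← hn]; simp [callSCX, newSCX, Heap.newRecord, Heap.setSCX]
  V_subset := by
    rw [← hn]; simpa [callSCX, newSCX, Heap.newRecord, Heap.setSCX] using hV

variable [LinearOrder K]

lemma stepOp_numRecs (h : Heap K) (tbl : Table) (op : Op K) (pc : PC) :
    (stepOp h tbl op pc).1.numRecs = h.numRecs ∨
      CreatesRecord h tbl pc (stepOp h tbl op pc) := by
  cases pc with
  | start => simp only [stepOp]; split <;> exact .inl rfl
  | search p r => simp only [stepOp]; split_ifs <;> [split; skip] <;> exact .inl rfl
  | found p r => exact .inl rfl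
  | insLLXr r pc => exact .inl (inLLX_numRecs ..)
  | insLLXp p r pc => exact .inl (inLLX_numRecs ..)
  | delLLXp p r pc => exact .inl (inLLX_numRecs ..)
  | delLLXr p r lp pc => exact .inl (inLLX_numRecs ..)
  | delLLXn p r x pc => exact .inl (inLLX_numRecs ..)
  | insR r res =>
    cases op with
    | insert k n =>
      cases res with
      | snapshot c nx => exact .inr (createsRecord_callSCX (h := h) rfl _ (.insR r (.snapshot c nx)) (by simp)
          (by simp [PC.entries, LLXResult.entries]) ..)
      | _ => exact .inl rfl
    | _ => exact .inl rfl
  | insP p r res =>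
    cases op with
    | insert k n =>
      cases res with
      | snapshot c nx =>
        simp only [stepOp, stepInsP]
        split_ifs
        · exact .inr (createsRecord_callSCX (h := h) (h' := (h.newNode _).1) rfl _
            (.insP p r (.snapshot c nx)) (by simp) (by simp [PC.entries, LLXResult.entries]) ..)
        · exact .inl rfl
      | _ => exact .inl rfl
    | _ => exact .inl rfl
  | delTest p r lp lr =>
    cases op with
    | delete k n =>
      cases lp with
      | snapshot c₀ pn =>
        cases lr with
        | snapshot c rn =>
          simp only [stepOp, stepDelTest]
          split_ifs
          · exact .inl rfl
          · exact .inr (createsRecord_callSCX (h := h) (h' := (h.newNode _).1) rfl _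
              (.delTest p r (.snapshot c₀ pn) (.snapshot c rn)) (by simp)
              (by simp [PC.entries, LLXResult.entries]) ..)
          · split <;> exact .inl rfl
          · exact .inl rfl
        | _ => exact .inl rfl
      | _ => exact .inl rfl
    | _ => exact .inl rfl
  | delN p r x res =>
    cases res with
    | snapshot c nx =>
      exact .inr (createsRecord_callSCX (h := h) (h' := (h.newNode _).1) rfl _
        (.delN p r x (.snapshot c nx)) (by simp) (by simp [PC.entries, LLXResult.entries]) ..)
    | _ => exact .inl rfl
  | scx u pc ret =>
    refine .inl ?_
    have := stepHelp_numRecs h u pc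
    revert this
    simp only [stepOp]
    rcases stepHelp h u pc with ⟨h₁, pc₁ | b⟩
    · exact id
    · cases b <;> exact id
  | fault => exact .inl rfl

end NewRecords

/-! ### Each operation instance has at most one successful update. -/

section Owners

lemma Effect.not_updated {K : Type*} [LinearOrder K] {S : Ghost K} (hS : S.Inv) {h : Heap K}
    {u : RecPtr} (he : Effect S h (some u)) :
    u < S.heap.numRecs ∧ u ≠ dummy ∧ ¬ S.updated u := by
  cases he with
  | update _ lt ne af hR old => exact ⟨lt, ne, (hS.at_update lt ne af old).1⟩

variable {P K : Type*} [DecidableEq P] [LinearOrder K] {E : Execution P K}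

lemma Execution.internal_step {t : ℕ} {p : P} (ha : E.act t = .internal p) :
    ∃ op pc pc', ((E.conf t).proc p).cur = some (op, pc) ∧
      ((E.conf (t + 1)).proc p).cur = some (op, pc') ∧
      stepOp (E.heap t) ((E.conf t).proc p).table op pc =
        (E.heap (t + 1), ((E.conf (t + 1)).proc p).table, .inl pc') := by
  have hn := E.next t
  rw [ha] at hn
  obtain ⟨op, pc, h', tbl', pc₁, hc, hst, hconf⟩ := hn
  refine ⟨op, pc, pc₁, hc, by rw [hconf]; simp [Config.set], ?_⟩
  rw [heap, heap, hst, hconf]; simp [Config.set]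

lemma Execution.respond_step {t : ℕ} {p : P} {v : Resp} (ha : E.act t = .respond p v) :
    ∃ op pc, ((E.conf t).proc p).cur = some (op, pc) ∧
      ((E.conf (t + 1)).proc p).cur = none ∧
      stepOp (E.heap t) ((E.conf t).proc p).table op pc =
        (E.heap (t + 1), ((E.conf (t + 1)).proc p).table, .inr v) := by
  have hn := E.next t
  rw [ha] at hn
  obtain ⟨op, pc, h', tbl', hc, hst, hconf⟩ := hn
  refine ⟨op, pc, hc, by rw [hconf]; simp [Config.set], ?_⟩
  rw [heap, heap, hst, hconf]; simp [Config.set]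

/-- A new record is created by an internal step of its owner. -/
lemma Execution.numRecs_succ (E : Execution P K) (t : ℕ) :
    (E.heap (t + 1)).numRecs = (E.heap t).numRecs ∨
    ∃ i p op pc, E.CreatesAt (E.heap t).numRecs i p op t ∧
      ((E.conf t).proc p).cur = some (op, pc) ∧
      CreatesRecord (E.heap t) ((E.conf t).proc p).table pc
        (stepOp (E.heap t) ((E.conf t).proc p).table op pc) := by
  have hn := E.next t
  cases ha : E.act t with
  | stutter => rw [ha] at hn; exact .inl (by rw [heap, show E.conf (t + 1) = E.conf t from hn])
  | invoke q op => rw [ha] at hn; exact .inl (by rw [heap, hn.2.2]; rfl)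
  | respond q v =>
    obtain ⟨op, pc, -, -, hst⟩ := respond_step ha
    exact .inl (stepOp_respond hst).2
  | internal q =>
    obtain ⟨op, pc, pc', hc, -, hst⟩ := internal_step ha
    obtain ⟨i, hi, -⟩ := (E.inv t).procs q op pc hc
    rcases stepOp_numRecs (E.heap t) ((E.conf t).proc q).table op pc with h | h
    · rw [hst] at h; exact .inl h
    · refine .inr ⟨i, q, op, pc, ⟨ha, hi, rfl, ?_⟩, hc, h⟩
      have := h.numRecs
      rwa [hst] at this

/-- The relation between records and the operation instances that create them. -/
structure Execution.Owners (E : Execution P K) (t : ℕ) : Prop where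
  created : ∀ u < (E.heap t).numRecs, u ≠ dummy → ∃ i p op s, s < t ∧ E.CreatesAt u i p op s
  -- Records of earlier iterations are aborted; only a record whose `Help` is still running can be
  -- in any other state.
  current : ∀ p i op pc u, E.Pending p i op t → ((E.conf t).proc p).cur = some (op, pc) →
    u < (E.heap t).numRecs → u ≠ dummy → E.owner u = i →
    ((E.heap t).scx u).state = .aborted ∨ ∃ hp ret, pc = .scx u hp ret
  unique : ∀ u < (E.heap t).numRecs, ∀ v < (E.heap t).numRecs, u ≠ dummy → v ≠ dummy →
    E.owner u = E.owner v → u = v ∨ ((E.heap t).scx u).state = .aborted ∨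
      ((E.heap t).scx v).state = .aborted

lemma Execution.aborted_succ {t : ℕ} {u : RecPtr} (hu : u < (E.heap t).numRecs)
    (h : ((E.heap t).scx u).state = .aborted) : ((E.heap (t + 1)).scx u).state = .aborted :=
  ((E.ghost_mono t).state u hu (by rw [Ghost.scx, ghost_heap, h]; simp)).trans h

lemma Execution.Pending.pred {p : P} {i : ℕ} {op : Op K} {t : ℕ} (h : E.Pending p i op (t + 1))
    (hi : i < t) : E.Pending p i op t :=
  ⟨h.1, hi, fun m h1 h2 => h.2.2 m h1 (h2.trans t.lt_succ_self)⟩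

lemma Execution.owners (E : Execution P K) (t : ℕ) : E.Owners t := by
  induction t with
  | zero =>
    have hz : ∀ u < (E.heap 0).numRecs, u = dummy := by
      intro u hu
      rw [heap, E.conf_zero] at hu
      exact Nat.lt_one_iff.1 hu
    exact ⟨fun u hu hd => absurd (hz u hu) hd, fun _ _ _ _ u _ _ hu hd => absurd (hz u hu) hd,
      fun u hu _ _ hd => absurd (hz u hu) hd⟩
  | succ t ih =>
    -- either the record is old, or this step creates it
    have hcases : ∀ u < (E.heap (t + 1)).numRecs, u < (E.heap t).numRecs ∨
        ∃ i p op pc, E.CreatesAt u i p op t ∧ ((E.conf t).proc p).cur = some (op, pc) ∧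
          CreatesRecord (E.heap t) ((E.conf t).proc p).table pc
            (stepOp (E.heap t) ((E.conf t).proc p).table op pc) := by
      intro u hu
      by_cases hlt : u < (E.heap t).numRecs
      · exact .inl hlt
      · rcases E.numRecs_succ t with h | ⟨i, p, op, pc, h1, h2, h3⟩
        · rw [h] at hu; exact absurd hu hlt
        · have : u = (E.heap t).numRecs := by
            have := h1.2.2.2
            omega
          subst this
          exact .inr ⟨i, p, op, pc, h1, h2, h3⟩
    refine ⟨fun u hu hd => ?_, fun p i op pc u hP hc hu hd ho => ?_,
      fun u hu v hv hud hvd ho => ?_⟩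
    · rcases hcases u hu with h | ⟨i, p, op, pc, h1, -⟩
      · obtain ⟨i, p, op, s, hs, h1⟩ := ih.created u h hd
        exact ⟨i, p, op, s, hs.trans t.lt_succ_self, h1⟩
      · exact ⟨i, p, op, t, t.lt_succ_self, h1⟩
    · rcases hcases u hu with hlt | ⟨j, q, op', pc', h1, h2, h3⟩
      · obtain ⟨i', p', op', s, hs, hcr⟩ := ih.created u hlt hd
        have hit : i < t := by
          have : i' = i := hcr.owner_eq.symm.trans ho
          subst this
          exact hcr.2.1.2.1.trans hs
        have hP' := hP.pred hit
        by_cases hp : (E.act t).proc? = some p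
        · cases ha : E.act t with
          | stutter => rw [ha] at hp; cases hp
          | invoke q o =>
            rw [ha] at hp; cases hp
            obtain ⟨pc₀, h0⟩ := hP'.cur
            have hn := E.next t
            rw [ha] at hn
            rw [hn.1] at h0; cases h0
          | respond q v =>
            rw [ha] at hp; cases hp
            exact absurd ha (hP.2.2 t hit t.lt_succ_self v)
          | internal q =>
            rw [ha] at hp; cases hp
            obtain ⟨o, pc₀, pc₁, h1, h2, h3⟩ := internal_step ha
            rw [hc] at h2; cases h2
            rcases ih.current p i op pc₀ u hP' h1 hlt hd ho with h | ⟨hp, ret, rfl⟩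
            · exact .inl (aborted_succ hlt h)
            · simp only [stepOp] at h3
              rcases hst : stepHelp (E.heap t) u hp with ⟨h₁, pc₂ | b⟩
              · rw [hst] at h3
                simp only [Prod.mk.injEq, Sum.inl.injEq] at h3
                exact .inr ⟨_, _, h3.2.2.symm⟩
              · rw [hst] at h3
                cases b with
                | true => simp at h3
                -- The instance is about to retry, and the record it gives up has just been aborted.
                | false =>
                  have := stepHelp_false hst
                  simp only [Prod.mk.injEq] at h3
                  rw [h3.1] at this
                  exact .inl this
        · rw [proc_eq_of_ne hp] at hc
          rcases ih.current p i op pc u hP' hc hlt hd ho with h | h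
          · exact .inl (aborted_succ hlt h)
          · exact .inr h
      · have hj : j = i := h1.owner_eq.symm.trans ho
        subst hj
        have hpq : E.act j = .invoke q op' := h1.2.1.1
        rw [hP.1] at hpq
        cases hpq
        obtain ⟨o, pc₀, pc₁, h4, h5, h6⟩ := internal_step h1.1
        rw [h2] at h4; cases h4
        rw [hc] at h5; cases h5
        obtain ⟨ret, h7⟩ := h3.pc_eq
        rw [h6] at h7
        simp only [Sum.inl.injEq] at h7
        right
        rw [← h1.2.2.1]
        exact ⟨_, _, h7⟩
    · rcases hcases u hu with hu' | ⟨i, p, op, pc, h1, h2, h3⟩ <;>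
        rcases hcases v hv with hv' | ⟨j, q, op', pc', h4, h5, h6⟩
      · rcases ih.unique u hu' v hv' hud hvd ho with h | h | h
        · exact .inl h
        · exact .inr (.inl (aborted_succ hu' h))
        · exact .inr (.inr (aborted_succ hv' h))
      -- A record is created outside of `Help`, so the older record of the same instance must be
      -- aborted.
      · rcases ih.current q j op' pc' u h4.2.1 h5 hu' hud (ho.trans h4.owner_eq) with h | ⟨hp, ret, h⟩
        · exact .inr (.inl (aborted_succ hu' h))
        · exact absurd h (h6.pc_ne u hp ret)
      · rcases ih.current p i op pc v h1.2.1 h2 hv' hvd (ho.symm.trans h1.owner_eq) with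
          h | ⟨hp, ret, h⟩
        · exact .inr (.inr (aborted_succ hv' h))
        · exact absurd h (h3.pc_ne v hp ret)
      · exact .inl (h1.2.2.1.symm.trans h4.2.2.1)

lemma Execution.ghost_mono_le {s t : ℕ} (hst : s ≤ t) {u : RecPtr}
    (hu : u < (E.heap s).numRecs) (h : ((E.heap s).scx u).state = .aborted) :
    ((E.heap t).scx u).state = .aborted := by
  induction t, hst using Nat.le_induction with
  | base => exact h
  | succ t ht ih => exact aborted_succ (hu.trans_le (E.numRecs_mono ht)) ih

lemma Execution.not_aborted_of_updated {t : ℕ} {u : RecPtr} (h : (E.ghost t).updated u) :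
    ((E.heap t).scx u).state ≠ .aborted := by
  have hS := E.ghost_inv t
  have hlt := hS.updated_lt u h
  exact fun hst => hS.not_cannotFreeze hlt (hS.updated_allFrozen u h)
    (hS.aborted u hlt (hS.ne_dummy_of_updated h) hst)

lemma Execution.UpdatesAt.updated {s t : ℕ} {u : RecPtr} (h : E.UpdatesAt s u) (hst : s < t) :
    (E.ghost t).updated u := ⟨s, hst, h⟩

lemma Execution.UpdatesAt.not_updated {t : ℕ} {u : RecPtr} (h : E.UpdatesAt t u) :
    u < (E.heap t).numRecs ∧ u ≠ dummy ∧ ¬ (E.ghost t).updated u := by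
  obtain ⟨l, he, hl⟩ := E.exists_effect t
  rw [(hl u).1 h] at he
  exact he.not_updated (E.ghost_inv t)

/-- Updated records are never aborted, so two of them with one owner coincide by `Owners.unique`,
taken at a time after both updates. A single record is updated only once. -/
lemma Execution.UpdatesAt.unique {s t : ℕ} {u v : RecPtr} (hu : E.UpdatesAt s u)
    (hv : E.UpdatesAt t v) (ho : E.owner u = E.owner v) : s = t ∧ u = v := by
  have huv : u = v := by
    have h1 := hu.updated (t := max s t + 1) (by omega)
    have h2 := hv.updated (t := max s t + 1) (by omega)
    have hS := E.ghost_inv (max s t + 1)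
    rcases (E.owners (max s t + 1)).unique u (hS.updated_lt u h1) v (hS.updated_lt v h2)
      (hS.ne_dummy_of_updated h1) (hS.ne_dummy_of_updated h2) ho with h | h | h
    · exact h
    · exact absurd h (not_aborted_of_updated h1)
    · exact absurd h (not_aborted_of_updated h2)
  subst huv
  refine ⟨?_, rfl⟩
  rcases lt_trichotomy s t with h | h | h
  · exact absurd (hu.updated h) hv.not_updated.2.2
  · exact h
  · exact absurd (hv.updated h) hu.not_updated.2.2

/-- An instance that returns without an `SCX` has no successful update CAS. -/
lemma Execution.not_updatesAt_of_pc_ne {p : P} {i j : ℕ} {op : Op K} {pc : PC} {v : Resp}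
    (hP : E.Pending p i op j) (hc : ((E.conf j).proc p).cur = some (op, pc))
    (ha : E.act j = .respond p v) (hpc : ∀ u hp ret, pc ≠ .scx u hp ret) {t : ℕ} {u : RecPtr}
    (hu : E.UpdatesAt t u) : E.owner u ≠ i := by
  intro ho
  obtain ⟨hlt, hd, -⟩ := hu.not_updated
  obtain ⟨i', q, op', s, hs, hcr⟩ := (E.owners t).created u hlt hd
  have hii : i' = i := hcr.owner_eq.symm.trans ho
  subst hii
  have hq := hcr.2.1.1
  rw [hP.1] at hq
  cases hq
  have hsj : s < j := by
    rcases lt_trichotomy s j with h | h | h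
    · exact h
    · subst h
      have := hcr.1
      rw [ha] at this; cases this
    · exact absurd ha (hcr.2.1.2.2 j hP.2.1 h v)
  have hlt' : u < (E.heap j).numRecs := by
    have h1 : (E.heap (s + 1)).numRecs ≤ (E.heap j).numRecs := E.numRecs_mono hsj
    have h2 : (E.heap (s + 1)).numRecs = u + 1 := hcr.2.2.2
    exact (Nat.lt_succ_self u).trans_le (h2.ge.trans h1)
  -- At its return the instance is not in the `Help` of an `SCX`, so every record it created before
  -- is aborted and can never have been updated.
  have hab := ((E.owners j).current p i' op pc u hP hc hlt' hd ho).resolve_right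
    fun ⟨hp, ret, h⟩ => hpc u hp ret h
  have hT : max t j + 1 ≥ j := by omega
  exact not_aborted_of_updated (hu.updated (t := max t j + 1) (by omega))
    (ghost_mono_le hT hlt' hab)

end Owners

/-! ### The order of linearization points. -/

section Linearization

variable {P K : Type*} [DecidableEq P] [LinearOrder K] {E : Execution P K}

lemma Execution.Returns.pending {i j : ℕ} {v : Resp} (h : E.Returns i j v) :
    ∃ p op, E.Pending p i op j ∧ E.act j = .respond p v := by
  obtain ⟨p, op, h1, h2, h3, h4⟩ := h
  exact ⟨p, op, ⟨h1, h2, h4⟩, h3⟩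

lemma Execution.Returns.unique {i j j' : ℕ} {v v' : Resp} (h : E.Returns i j v)
    (h' : E.Returns i j' v') : j = j' ∧ v = v' := by
  obtain ⟨p, op, h1, h2, h3, h4⟩ := h
  obtain ⟨p', op', h1', h2', h3', h4'⟩ := h'
  rw [h1] at h1'
  cases h1'
  rcases lt_trichotomy j j' with hj | rfl | hj
  · exact absurd h3 (h4' j h2 hj v)
  · rw [h3] at h3'; cases h3'; exact ⟨rfl, rfl⟩
  · exact absurd h3' (h4 j' h2' hj v')

lemma Execution.Invokes.unique {i : ℕ} {op op' : Op K} (h : E.Invokes i op)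
    (h' : E.Invokes i op') : op = op' := by
  obtain ⟨p, h⟩ := h
  obtain ⟨p', h'⟩ := h'
  rw [h] at h'; cases h'; rfl

lemma Execution.Invokes.opAt_eq {i : ℕ} {op : Op K} (h : E.Invokes i op) :
    E.opAt i = some op := by
  obtain ⟨p, h⟩ := h
  simp [opAt, h]

/-- Configuration `s` is a possible linearization point of the instance `i`, which returns and
does not update the multiset. -/
structure Execution.ReadPoint (E : Execution P K) (i s : ℕ) : Prop where
  returns : ∃ j v op, E.Returns i j v ∧ E.Invokes i op ∧ s ≤ j ∧
    ∀ m, IsContents (E.heap s) m → spec m op = (m, v)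
  lt : i < s
  not_updates : ∀ t u, E.UpdatesAt t u → E.owner u ≠ i

/-- The response is justified either by a past configuration or by a committed record of the
instance. A committed record has been updated, at a time before the return. -/
lemma Execution.Returns.cases {i j : ℕ} {v : Resp} (h : E.Returns i j v) :
    (∃ s ≤ j, E.ReadPoint i s) ∨ ∃ s ≤ j, ∃ u op, E.UpdatesAt s u ∧ E.owner u = i ∧
      E.Invokes i op ∧ v = op.updateResp := by
  obtain ⟨p, op, hP, ha⟩ := h.pending
  obtain ⟨i', op', pc, hP', hc, hr⟩ := (E.inv j).succ.2 p v ha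
  obtain rfl := hP.unique hP'
  obtain rfl : op = op' := by
    have := hP.1.symm.trans hP'.1
    cases this; rfl
  have hinv : E.Invokes i op := ⟨p, hP.1⟩
  cases hr with
  | read s his hst spec hpc =>
    exact .inl ⟨s, hst, ⟨j, v, op, h, hinv, hst, spec⟩, his,
      fun t u hu => not_updatesAt_of_pc_ne hP hc ha hpc hu⟩
  | update u hp hpc hv state =>
    obtain ⟨i', hP'', hpi⟩ := (E.inv j).procs p op pc hc
    obtain rfl := hP.unique hP''
    subst hpc
    obtain ⟨⟨hlt, hd, -⟩, ho, -⟩ := hpi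
    -- The update CAS may have been executed by any helper; only the fact that it took place is
    -- used.
    obtain ⟨s, hs, hu⟩ := (E.ghost_inv (j + 1)).committed u
      (hlt.trans_le (E.numRecs_mono j.le_succ)) state
    exact .inr ⟨s, Nat.lt_succ_iff.1 hs, u, op, hu, ho, hinv, hv⟩

open Classical in
/-- The instance whose update CAS succeeds at time `t`. -/
noncomputable def Execution.updateList (E : Execution P K) (t : ℕ) : List ℕ :=
  if h : ∃ u, E.UpdatesAt t u then [E.owner h.choose] else []

open Classical in
/-- The configuration at which an instance that does not update the multiset is linearized. -/
noncomputable def Execution.readTime (E : Execution P K) (i : ℕ) : ℕ :=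
  -- The default `0` is recognizable, since a read point comes after the invocation and is therefore
  -- positive.
  if h : ∃ s, E.ReadPoint i s then h.choose else 0

/-- The instances not updating the multiset that are linearized at configuration `t`. -/
noncomputable def Execution.readList (E : Execution P K) (t : ℕ) : List ℕ :=
  (List.range t).filter fun i => E.readTime i = t

/-- The linearization. -/
noncomputable def Execution.order (E : Execution P K) : ℕ → List ℕ
  | 0 => []
  -- The update performed by step `t` precedes the reads placed at configuration `t + 1`, since
  -- these see its effect.
  | t + 1 => E.order t ++ (E.updateList t ++ E.readList (t + 1))

lemma Execution.updateList_eq {t : ℕ} {u : RecPtr} (h : E.UpdatesAt t u) :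
    E.updateList t = [E.owner u] := by
  have hex : ∃ u, E.UpdatesAt t u := ⟨u, h⟩
  obtain ⟨l, -, hl⟩ := E.exists_effect t
  have h1 := (hl _).1 hex.choose_spec
  rw [(hl u).1 h] at h1
  rw [updateList, dif_pos hex, ← Option.some.inj h1]

lemma Execution.updateList_eq_nil {t : ℕ} (h : ∀ u, ¬ E.UpdatesAt t u) :
    E.updateList t = [] := dif_neg fun ⟨u, hu⟩ => h u hu

lemma Execution.mem_updateList {i t : ℕ} :
    i ∈ E.updateList t ↔ ∃ u, E.UpdatesAt t u ∧ E.owner u = i := by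
  by_cases h : ∃ u, E.UpdatesAt t u
  · obtain ⟨u, hu⟩ := h
    rw [updateList_eq hu, List.mem_singleton]
    refine ⟨fun h => ⟨u, hu, h.symm⟩, ?_⟩
    rintro ⟨v, hv, rfl⟩
    obtain ⟨l, -, hl⟩ := E.exists_effect t
    have := ((hl u).1 hu).symm.trans ((hl v).1 hv)
    cases this; rfl
  · rw [updateList_eq_nil fun u hu => h ⟨u, hu⟩]
    simp only [List.not_mem_nil, false_iff]
    rintro ⟨u, hu, -⟩
    exact h ⟨u, hu⟩

lemma Execution.readPoint_readTime {i s : ℕ} (h : E.ReadPoint i s) :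
    E.ReadPoint i (E.readTime i) := by
  have hex : ∃ s, E.ReadPoint i s := ⟨s, h⟩
  rw [readTime, dif_pos hex]
  exact hex.choose_spec

lemma Execution.readPoint_of_ne_zero {i : ℕ} (h : E.readTime i ≠ 0) :
    E.ReadPoint i (E.readTime i) := by
  by_cases hex : ∃ s, E.ReadPoint i s
  · exact readPoint_readTime hex.choose_spec
  · rw [readTime, dif_neg hex] at h
    exact absurd rfl h

lemma Execution.mem_readList {i t : ℕ} :
    i ∈ E.readList (t + 1) ↔ E.readTime i = t + 1 := by
  simp only [readList, List.mem_filter, List.mem_range, decide_eq_true_eq, and_iff_right_iff_imp]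
  intro h
  have := (readPoint_of_ne_zero (E := E) (i := i) (by omega)).lt
  omega

lemma Execution.readPoint_of_mem_readList {i t : ℕ} (h : i ∈ E.readList (t + 1)) :
    E.ReadPoint i (t + 1) := by
  rw [mem_readList] at h
  rw [← h]
  exact readPoint_of_ne_zero (by omega)

lemma Execution.mem_order {i t : ℕ} : i ∈ E.order t ↔
    (∃ s < t, ∃ u, E.UpdatesAt s u ∧ E.owner u = i) ∨ E.readTime i ≠ 0 ∧ E.readTime i ≤ t := by
  induction t with
  | zero =>
    simp only [order, List.not_mem_nil, Nat.not_lt_zero, false_and, exists_false, false_or,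
      false_iff]
    omega
  | succ t ih =>
    simp only [order, List.mem_append, ih, mem_updateList, mem_readList]
    constructor
    · rintro ((⟨s, hs, h⟩ | ⟨h1, h2⟩) | h | h)
      · exact .inl ⟨s, hs.trans t.lt_succ_self, h⟩
      · exact .inr ⟨h1, h2.trans t.le_succ⟩
      · exact .inl ⟨t, t.lt_succ_self, h⟩
      · exact .inr ⟨by omega, h.le⟩
    · rintro (⟨s, hs, h⟩ | ⟨h1, h2⟩)
      · rcases (Nat.lt_succ_iff.1 hs).lt_or_eq with hs | rfl
        · exact .inl (.inl ⟨s, hs, h⟩)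
        · exact .inr (.inl h)
      · rcases h2.lt_or_eq with h2 | h2
        · exact .inl (.inr ⟨h1, Nat.lt_succ_iff.1 h2⟩)
        · exact .inr (.inr h2)

lemma Execution.order_nodup (E : Execution P K) (t : ℕ) : (E.order t).Nodup := by
  induction t with
  | zero => exact List.nodup_nil
  | succ t ih =>
    -- An instance with a read point never updates, so it cannot be linearized a second time as an
    -- update.
    have hread : ∀ i s u, E.readTime i ≠ 0 → E.UpdatesAt s u → E.owner u ≠ i :=
      fun i s u h hu => (readPoint_of_ne_zero h).not_updates s u hu
    refine List.nodup_append.2 ⟨ih, List.nodup_append.2 ⟨?_, ?_, ?_⟩, ?_⟩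
    · rw [updateList]
      split_ifs
      · exact List.nodup_singleton _
      · exact List.nodup_nil
    · exact List.nodup_range.filter _
    · rintro i hi j hj rfl
      obtain ⟨u, hu, ho⟩ := mem_updateList.1 hi
      have := mem_readList.1 hj
      exact hread i t u (by omega) hu ho
    · rintro i hi j hj rfl
      rw [List.mem_append, mem_updateList, mem_readList] at hj
      rcases mem_order.1 hi with ⟨s, hs, u, hu, ho⟩ | ⟨h1, h2⟩
      · rcases hj with ⟨v, hv, ho'⟩ | hj
        · exact hs.ne (hu.unique hv (ho.trans ho'.symm)).1
        · exact hread i s u (by omega) hu ho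
      · rcases hj with ⟨v, hv, ho'⟩ | hj
        · exact hread i t v h1 hv ho'
        · omega

lemma Execution.UpdatesAt.invokes {s : ℕ} {u : RecPtr} (h : E.UpdatesAt s u) :
    E.owner u < s ∧ ∃ op, E.Invokes (E.owner u) op := by
  obtain ⟨hlt, hd, -⟩ := h.not_updated
  obtain ⟨i, p, op, s', hs, hcr⟩ := (E.owners s).created u hlt hd
  rw [hcr.owner_eq]
  exact ⟨hcr.2.1.2.1.trans hs, op, p, hcr.2.1.1⟩

lemma Execution.runOps_append_one (l : List ℕ) {i : ℕ} {op : Op K} (h : E.opAt i = some op) :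
    E.runOps (l ++ [i]) = (spec (E.runOps l) op).1 := by
  simp [runOps, run, h]

/-- Linearizing instances that do not update the multiset. -/
lemma Execution.runOps_append_reads {s : ℕ} {l l' : List ℕ}
    (hc : IsContents (E.heap s) (E.runOps l)) (hl : ∀ i ∈ l', E.ReadPoint i s) :
    E.runOps (l ++ l') = E.runOps l := by
  induction l' using List.reverseRecOn with
  | nil => rw [List.append_nil]
  | append_singleton l' i ih =>
    have ih := ih fun i hi => hl i (List.mem_append_left _ hi)
    obtain ⟨j, v, op, -, hi, -, hs⟩ := (hl i (by simp)).returns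
    rw [← List.append_assoc, runOps_append_one _ hi.opAt_eq, ih, hs _ hc]

/-- Updates act on the contents as specified, all other steps leave them alone, and the reads placed
at a configuration do not change the abstract state. The intermediate state between update and reads
is recorded too, because legality of the reads refers to it. -/
lemma Execution.isContents_order (E : Execution P K) (t : ℕ) :
    IsContents (E.heap t) (E.runOps (E.order t)) ∧
      IsContents (E.heap (t + 1)) (E.runOps (E.order t ++ E.updateList t)) ∧
      ∀ u op, E.UpdatesAt t u → E.Invokes (E.owner u) op →
        (spec (E.runOps (E.order t)) op).2 = op.updateResp := by
  have key : ∀ t, IsContents (E.heap t) (E.runOps (E.order t)) →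
      IsContents (E.heap (t + 1)) (E.runOps (E.order t ++ E.updateList t)) ∧
      ∀ u op, E.UpdatesAt t u → E.Invokes (E.owner u) op →
        (spec (E.runOps (E.order t)) op).2 = op.updateResp := by
    intro t ht
    have hS := E.ghost_inv t
    obtain ⟨l, he, hl⟩ := E.exists_effect t
    cases l with
    | none =>
      have hno : ∀ u, ¬ E.UpdatesAt t u := fun u hu => by simpa using (hl u).1 hu
      rw [updateList_eq_nil hno, List.append_nil]
      refine ⟨ht.congr (fun a => he.inList_iff hS) fun a ha => ?_,
        fun u _ hu => absurd hu (hno u)⟩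
      obtain ⟨h1, h2, -⟩ := he.fields_eq hS (hS.listed a ha)
      exact ⟨h1, h2⟩
    | some u =>
      have hu : E.UpdatesAt t u := (hl u).2 rfl
      obtain ⟨op, hop, h1, h2⟩ := he.contents hS ht
      rw [updateList_eq hu, runOps_append_one _ hop]
      refine ⟨h1, fun v op' hv hi => ?_⟩
      have huv := ((hl v).1 hv).symm
      cases huv
      have := hi.opAt_eq.symm.trans hop
      cases this
      exact h2
  have main : ∀ t, IsContents (E.heap t) (E.runOps (E.order t)) := by
    intro t
    induction t with
    | zero =>
      rw [heap, E.conf_zero]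
      exact isContents_initial
    | succ t ih =>
      have h1 := (key t ih).1
      rw [order, ← List.append_assoc,
        runOps_append_reads h1 fun i hi => readPoint_of_mem_readList hi]
      exact h1
  exact ⟨main t, key t (main t)⟩

/-- Peel off the block of the last step. If the instance lies in that block, it is either the
update, whose response `Effect.contents` determines, or a read, whose response is right for the
contents of that configuration. -/
lemma Execution.order_legal {t : ℕ} {l l' : List ℕ} {i : ℕ} {op : Op K} {j : ℕ} {v : Resp}
    (hl : E.order t = l ++ i :: l') (hi : E.Invokes i op) (hr : E.Returns i j v) :
    v = (spec (E.runOps l) op).2 := by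
  induction t generalizing l' with
  | zero => simp [order] at hl
  | succ t ih =>
    obtain ⟨-, hc, hresp⟩ := E.isContents_order t
    have hread : ∀ m l₁ l₂, E.readList (t + 1) = l₁ ++ i :: l₂ →
        m = E.order t ++ E.updateList t → v = (spec (E.runOps (m ++ l₁)) op).2 := by
      rintro m l₁ l₂ h rfl
      have hmem : ∀ x ∈ l₁, E.ReadPoint x (t + 1) := fun x hx =>
        readPoint_of_mem_readList (by rw [h]; exact List.mem_append_left _ hx)
      have hip : E.ReadPoint i (t + 1) := readPoint_of_mem_readList (by rw [h]; simp)
      obtain ⟨j', v', op', hr', hi', -, hs⟩ := hip.returns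
      rw [runOps_append_reads hc hmem, hi.unique hi', hs _ hc, (hr.unique hr').2]
    rw [order] at hl
    have hsplit : ∀ (A B : List ℕ) {l l' : List ℕ}, A ++ B = l ++ i :: l' →
        (∃ l'', A = l ++ i :: l'') ∨ ∃ l₁, l = A ++ l₁ ∧ B = l₁ ++ i :: l' := by
      intro A B l l' h
      rcases List.append_eq_append_iff.1 h with ⟨as, h1, h2⟩ | ⟨bs, h1, h2⟩
      · exact .inr ⟨as, h1, h2⟩
      · cases bs with
        | nil => exact .inr ⟨[], by simpa using h1.symm, by simpa using h2.symm⟩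
        | cons b bs =>
          rw [List.cons_append, List.cons.injEq] at h2
          rw [← h2.1] at h1
          exact .inl ⟨bs, h1⟩
    rcases hsplit _ _ hl with ⟨l'', h⟩ | ⟨l₁, rfl, h⟩
    · exact ih h
    · rcases hsplit _ _ h with ⟨l'', h⟩ | ⟨l₂, rfl, h'⟩
      · by_cases hex : ∃ u, E.UpdatesAt t u
        · obtain ⟨u, hu⟩ := hex
          rw [updateList_eq hu] at h
          cases l₁ with
          | cons x xs => simp at h
          | nil =>
            simp only [List.nil_append, List.cons.injEq] at h
            obtain ⟨rfl, -⟩ := h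
            rw [List.append_nil, hresp u op hu hi]
            rcases hr.cases with ⟨s, -, hs⟩ | ⟨s, -, u', op', -, -, hi', hv⟩
            · exact absurd rfl (hs.not_updates t u hu)
            · rw [hv, hi.unique hi']
        · rw [updateList_eq_nil fun u hu => hex ⟨u, hu⟩] at h
          simp at h
      · rw [← List.append_assoc]
        exact hread _ l₂ l' h' rfl

theorem Execution.isLinearization_order (E : Execution P K) : E.IsLinearization E.order where
  zero := rfl
  mono t := List.prefix_append _ _
  nodup := E.order_nodup
  invoked t i hi := by
    rcases mem_order.1 hi with ⟨s, hs, u, hu, rfl⟩ | ⟨h1, h2⟩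
    · exact ⟨hu.invokes.1.trans hs, hu.invokes.2⟩
    · have h := readPoint_of_ne_zero h1
      obtain ⟨j, v, op, -, hop, -⟩ := h.returns
      exact ⟨h.lt.trans_le h2, op, hop⟩
  complete i j v hr := by
    rw [mem_order]
    rcases hr.cases with ⟨s, -, hs⟩ | ⟨s, hs, u, op, hu, ho, -⟩
    · right
      -- The chosen read time need not be `s`, but every read point is bounded by the time of the
      -- return, which is unique.
      have h := readPoint_readTime hs
      refine ⟨(i.zero_le.trans_lt h.lt).ne', ?_⟩
      obtain ⟨j', v', op, hr', -, hle, -⟩ := h.returns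
      rw [(hr.unique hr').1]
      exact hle.trans j'.le_succ
    · exact .inl ⟨s, Nat.lt_succ_iff.2 hs, u, hu, ho⟩
  legal t l i op j v hl hi hr := by
    obtain ⟨l', hl⟩ := hl
    exact order_legal (l' := l') (by rw [← hl]; simp) hi hr

end Linearization

/-! ### Table entries are current when they are made. -/

section Freshness

variable {K : Type*}

/-- Only a successful rereading of `info` writes to the table, and at that step the stored record is
the `info` of the node. -/
lemma stepLLX_table (h : Heap K) (tbl : Table) (r : Ptr) (pc : LLXPC) :
    ((stepLLX h tbl r pc).2.1 = tbl ∧ ∀ c nx, (stepLLX h tbl r pc).2.2 ≠ .inr (.snapshot c nx)) ∨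
    ((∀ y ≠ r, (stepLLX h tbl r pc).2.1 y = tbl y) ∧
      ((stepLLX h tbl r pc).1.node r).info = ((stepLLX h tbl r pc).2.1 r).info) := by
  cases pc with
  | reread m i c nx =>
    simp only [stepLLX]
    split_ifs with hi
    · exact .inr ⟨fun y hy => Function.update_of_ne hy _ _, by simp [hi]⟩
    · exact .inl ⟨rfl, by simp⟩
  | helpFinal m u pc =>
    left
    simp only [stepLLX]
    rcases stepHelp h u pc with ⟨h₁, pc₁ | b⟩
    · exact ⟨rfl, by simp⟩
    · refine ⟨rfl, ?_⟩
      dsimp only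
      split_ifs <;> simp
  | helpFail u pc =>
    left
    simp only [stepLLX]
    rcases stepHelp h u pc with ⟨h₁, pc₁ | b⟩ <;> exact ⟨rfl, by simp⟩
  | readMarked2 m i st => left; simp only [stepLLX]; split_ifs <;> exact ⟨rfl, by simp⟩
  | testCommitted m i =>
    left
    simp only [stepLLX]
    split_ifs <;> exact ⟨rfl, by simp⟩
  | testInProgress m i => left; simp only [stepLLX]; split_ifs <;> exact ⟨rfl, by simp⟩
  | failState x => left; simp only [stepLLX]; split_ifs <;> exact ⟨rfl, by simp⟩
  | _ => exact .inl ⟨rfl, by simp [stepLLX]⟩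

variable [LinearOrder K]

/-- The new entries in the table are current. -/
lemma inLLX_entries {h h' : Heap K} {tbl tbl' : Table} {r : Ptr} {pc : LLXPC}
    {stay : LLXPC → PC} {exit : LLXResult → PC} {l : List Ptr} {pc' : PC}
    (hs : inLLX h tbl r pc stay exit = (h', tbl', .inl pc'))
    (h1 : ∀ pc, (stay pc).entries ⊆ l) (h2 : ∀ res, (exit res).entries ⊆ l ++ res.entries r) :
    ∀ y ∈ pc'.entries, (y ∈ l ∧ tbl' y = tbl y) ∨ (h'.node y).info = (tbl' y).info := by
  intro y hy
  rw [inLLX_eq] at hs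
  simp only [Prod.mk.injEq, Sum.inl.injEq] at hs
  obtain ⟨hh, ht, rfl⟩ := hs
  have htab := stepLLX_table h tbl r pc
  rw [hh, ht] at htab
  rcases htab with ⟨htt, hno⟩ | ⟨hne, hcur⟩
  · refine .inl ⟨?_, congrFun htt y⟩
    cases hres : (stepLLX h tbl r pc).2.2 with
    | inl pc₁ => rw [hres] at hy; exact h1 pc₁ hy
    | inr res =>
      rw [hres] at hy hno
      have := h2 res hy
      cases res with
      | snapshot c nx => exact absurd rfl (hno c nx)
      | _ => simpa [LLXResult.entries] using this
  · by_cases hyr : y = r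
    · subst hyr; exact .inr hcur
    · refine .inl ⟨?_, hne y hyr⟩
      cases hres : (stepLLX h tbl r pc).2.2 with
      | inl pc₁ => rw [hres] at hy; exact h1 pc₁ hy
      | inr res =>
        rw [hres] at hy
        have := h2 res hy
        rw [List.mem_append] at this
        refine this.resolve_right fun h => ?_
        cases res with
        | snapshot c nx => exact hyr (List.mem_singleton.1 h)
        | _ => cases h

/-- Within an iteration, an entry relied upon is either inherited from the previous step or has just
been read. Stale entries of earlier iterations are never used, since restarting empties the list
`entries`. -/
lemma stepOp_entries {h h' : Heap K} {tbl tbl' : Table} {op : Op K} {pc pc' : PC}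
    (hs : stepOp h tbl op pc = (h', tbl', .inl pc')) :
    ∀ y ∈ pc'.entries, (y ∈ pc.entries ∧ tbl' y = tbl y) ∨ (h'.node y).info = (tbl' y).info := by
  have hnil : pc'.entries = [] → ∀ y ∈ pc'.entries,
      (y ∈ pc.entries ∧ tbl' y = tbl y) ∨ (h'.node y).info = (tbl' y).info := by
    intro hn y hy
    rw [hn] at hy; cases hy
  cases pc with
  | start => simp only [stepOp] at hs; split at hs <;> cases hs <;> exact hnil rfl
  | search p r =>
    simp only [stepOp] at hs
    split_ifs at hs <;> [split at hs; skip] <;> cases hs <;> exact hnil rfl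
  | found p r =>
    cases op <;> simp only [stepOp, stepFound] at hs <;> (try split_ifs at hs) <;>
      cases hs <;> exact hnil rfl
  | insLLXr r pc =>
    exact inLLX_entries hs (fun _ => by simp [PC.entries]) fun res => by simp [PC.entries]
  | insLLXp p r pc =>
    exact inLLX_entries hs (fun _ => by simp [PC.entries]) fun res => by simp [PC.entries]
  | delLLXp p r pc =>
    exact inLLX_entries hs (fun _ => by simp [PC.entries]) fun res => by simp [PC.entries]
  | delLLXr p r lp pc =>
    exact inLLX_entries hs (fun _ => by simp [PC.entries]) fun res => by simp [PC.entries]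
  | delLLXn p r x pc =>
    exact inLLX_entries hs (fun _ => by simp [PC.entries]) fun res => by simp [PC.entries]
  | insR r res =>
    cases op <;> simp only [stepOp] at hs <;> cases res <;>
      simp only [stepInsR, callSCX, Prod.mk.injEq, Sum.inl.injEq] at hs <;>
      exact hnil (by rw [← hs.2.2]; rfl)
  | insP p r res =>
    cases op <;> simp only [stepOp] at hs <;> cases res <;>
      (try simp only [stepInsP, callSCX] at hs) <;> (try split_ifs at hs) <;>
      simp only [Prod.mk.injEq, Sum.inl.injEq] at hs <;>
      exact hnil (by rw [← hs.2.2]; rfl)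
  | delTest p r lp lr =>
    cases op <;> simp only [stepOp] at hs <;> cases lp <;> cases lr <;>
      (try simp only [stepDelTest, callSCX] at hs)
    case delete.snapshot.snapshot k n c₀ pn c rn =>
      by_cases h1 : pn = some r
      · rw [if_pos h1] at hs
        by_cases h2 : (k : WithBot (WithTop K)) ≠ (h.node r).key ∨ c < n
        · rw [if_pos h2] at hs; simp at hs
        · rw [if_neg h2] at hs
          by_cases h3 : n < c
          · rw [if_pos h3] at hs
            simp only [Prod.mk.injEq, Sum.inl.injEq] at hs
            exact hnil (by rw [← hs.2.2]; rfl)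
          · rw [if_neg h3] at hs
            split at hs <;> cases hs
            · exact fun y hy => .inl ⟨hy, rfl⟩
            · exact hnil rfl
      · rw [if_neg h1] at hs; cases hs; exact hnil rfl
    all_goals cases hs; exact hnil rfl
  | delN p r x res =>
    simp only [stepOp] at hs
    cases res <;> simp only [stepDelN, callSCX, Prod.mk.injEq, Sum.inl.injEq] at hs <;>
      exact hnil (by rw [← hs.2.2]; rfl)
  | scx u pc ret =>
    simp only [stepOp] at hs
    rcases hst : stepHelp h u pc with ⟨h₁, pc₁ | b⟩
    · rw [hst] at hs; cases hs; exact hnil rfl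
    · rw [hst] at hs
      cases b <;> cases hs
      exact hnil rfl
  | fault => cases hs; exact hnil rfl

end Freshness

/-! ### Late records contain the final values of `info` fields. -/

section EventuallyFresh

variable {P K : Type*} [DecidableEq P] [LinearOrder K] {E : Execution P K}

/-- The entries that the process uses in its current iteration have the values `v`. -/
def Execution.FreshEntries (E : Execution P K) (Y : Set Ptr) (v : Ptr → RecPtr) (p : P)
    (t : ℕ) : Prop :=
  ∀ op pc, ((E.conf t).proc p).cur = some (op, pc) → ∀ y ∈ pc.entries, y ∈ Y →
    (((E.conf t).proc p).table y).info = v y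

lemma Execution.FreshEntries.succ {Y : Set Ptr} {v : Ptr → RecPtr} {p : P} {t : ℕ}
    (hY : ∀ y ∈ Y, ((E.heap (t + 1)).node y).info = v y) (h : E.FreshEntries Y v p t) :
    E.FreshEntries Y v p (t + 1) := by
  by_cases hp : (E.act t).proc? = some p
  · cases ha : E.act t with
    | stutter => rw [ha] at hp; cases hp
    | invoke q op =>
      rw [ha] at hp; cases hp
      have hn := E.next t
      rw [ha] at hn
      intro op' pc hc
      rw [hn.2.2] at hc
      simp only [Config.set, Function.update_self, Option.some.injEq, Prod.mk.injEq] at hc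
      rw [← hc.2]
      simp [PC.entries]
    | respond q w =>
      rw [ha] at hp; cases hp
      obtain ⟨-, -, -, h2, -⟩ := respond_step ha
      intro op' pc hc
      rw [h2] at hc; cases hc
    | internal q =>
      rw [ha] at hp; cases hp
      obtain ⟨op, pc, pc', h1, h2, h3⟩ := internal_step ha
      intro op' pc'' hc y hy hyY
      rw [h2] at hc; cases hc
      rcases stepOp_entries h3 y hy with ⟨h4, h5⟩ | h4
      · rw [h5]; exact h op pc h1 y h4 hyY
      · rw [← h4]; exact hY y hyY
  · intro op pc hc
    rw [proc_eq_of_ne hp] at hc ⊢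
    exact h op pc hc

/-- If the `info` fields of the nodes in `Y` do not change any more, then they eventually agree
with those stored in new records. -/
lemma Execution.eventually_fresh [Finite P] {Y : Set Ptr} {v : Ptr → RecPtr}
    (hY : ∀ᶠ t in Filter.atTop, ∀ y ∈ Y, ((E.heap t).node y).info = v y) :
    ∀ᶠ t in Filter.atTop, ∀ u, (E.heap t).numRecs ≤ u → u < (E.heap (t + 1)).numRecs →
      ∀ y ∈ ((E.heap (t + 1)).scx u).V, y ∈ Y → ((E.heap (t + 1)).scx u).infoFields y = v y := by
  obtain ⟨T, hT⟩ := Filter.eventually_atTop.1 hY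
  have hp : ∀ p : P, ∀ᶠ t in Filter.atTop, E.act t = .internal p →
      (E.heap t).numRecs < (E.heap (t + 1)).numRecs → E.FreshEntries Y v p t := by
    intro p
    -- Once the entries of `p` are fresh after `T`, they remain so. If they never are, then `p`
    -- creates no record after `T`, because creating one leaves it without entries, which would
    -- count as fresh.
    by_cases hex : ∃ t ≥ T, E.FreshEntries Y v p t
    · obtain ⟨t₀, ht₀, hf⟩ := hex
      refine Filter.eventually_atTop.2 ⟨t₀, fun t ht => ?_⟩
      suffices E.FreshEntries Y v p t from fun _ _ => this
      induction t, ht using Nat.le_induction with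
      | base => exact hf
      | succ t ht ih =>
        exact ih.succ (hT _ (ht₀.trans (Nat.le_succ_of_le ht)))
    · refine Filter.eventually_atTop.2 ⟨T, fun t ht ha hlt => absurd ?_ hex⟩
      refine ⟨t + 1, ht.trans t.le_succ, ?_⟩
      obtain ⟨op, pc, pc', h1, h2, h3⟩ := internal_step ha
      rcases stepOp_numRecs (E.heap t) ((E.conf t).proc p).table op pc with h | h
      · rw [h3] at h; exact absurd h hlt.ne'
      · obtain ⟨ret, h4⟩ := h.pc_eq
        rw [h3] at h4
        simp only [Sum.inl.injEq] at h4
        intro op' pc'' hc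
        rw [h2] at hc; cases hc
        rw [h4]; simp [PC.entries]
  refine (Filter.eventually_all.2 hp).mono fun t ht u hu hlt => ?_
  rcases E.numRecs_succ t with h | ⟨i, p, op, pc, h1, h2, h3⟩
  · rw [h] at hlt; exact absurd hlt hu.not_gt
  · have hlt' := h1.2.2.2
    have hue : u = (E.heap t).numRecs := by omega
    subst hue
    intro y hy hyY
    obtain ⟨op', pc₁, pc', h4, h5, h6⟩ := internal_step h1.1
    rw [h2] at h4; cases h4
    have h7 := h3.infoFields y
    have h8 := h3.V_subset y
    rw [h6] at h7 h8
    rw [h7]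
    exact ht p h1.1 hlt op pc h2 y (h8 hy) hyY

/-- Translates "late" from times to record numbers. This is the form needed for a record known only
as the value of an `info` field. -/
lemma Execution.exists_fresh [Finite P] {Y : Set Ptr} {v : Ptr → RecPtr}
    (hY : ∀ᶠ t in Filter.atTop, ∀ y ∈ Y, ((E.heap t).node y).info = v y) :
    ∃ N, ∀ t u, N ≤ u → u < (E.heap t).numRecs →
      ∀ y ∈ ((E.heap t).scx u).V, y ∈ Y → ((E.heap t).scx u).infoFields y = v y := by
  obtain ⟨T, hT⟩ := Filter.eventually_atTop.1 (eventually_fresh hY)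
  refine ⟨(E.heap T).numRecs, fun t => ?_⟩
  induction t with
  | zero =>
    intro u hu hlt
    exact absurd (hu.trans_lt hlt) (not_lt.2 (E.numRecs_mono (Nat.zero_le T)))
  | succ t ih =>
    intro u hu hlt
    by_cases hlt' : u < (E.heap t).numRecs
    · have hm := E.ghost_mono t
      have h1 := hm.V u hlt'
      have h2 := hm.infoFields u hlt'
      simp only [Ghost.scx, ghost_heap] at h1 h2
      rw [h1, h2]
      exact ih u hu hlt'
    · by_cases htT : T ≤ t
      · exact hT t htT u (not_lt.1 hlt') hlt
      · exact absurd (hu.trans_lt hlt) (not_lt.2 (E.numRecs_mono (by omega)))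

end EventuallyFresh

/-! ### Without responses, the list and its `info` fields become constant. -/

section EventualStability

variable {P K : Type*} [DecidableEq P] [LinearOrder K] {E : Execution P K}

/-- After the last response each process can invoke at most one more operation, and there are
finitely many processes. -/
lemma Execution.eventually_not_invoke [Finite P]
    (hr : ∀ᶠ t in Filter.atTop, ∀ p v, E.act t ≠ .respond p v) :
    ∀ᶠ t in Filter.atTop, ∀ p op, E.act t ≠ .invoke p op := by
  obtain ⟨T, hT⟩ := Filter.eventually_atTop.1 hr
  refine Filter.eventually_all.2 fun p => ?_
  by_cases hex : ∃ t ≥ T, ∃ op, E.act t = .invoke p op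
  · obtain ⟨i, hi, op, ha⟩ := hex
    refine Filter.eventually_atTop.2 ⟨i + 1, fun t ht op' ha' => ?_⟩
    have hP : E.Pending p i op t := ⟨ha, ht, fun m h1 _ w => hT m (hi.trans h1.le) p w⟩
    obtain ⟨pc, hc⟩ := hP.cur
    have hn := E.next t
    rw [ha'] at hn
    rw [hn.1] at hc; cases hc
  · exact Filter.eventually_atTop.2 ⟨T, fun t ht op ha => hex ⟨t, ht, op, ha⟩⟩

/-- Only finitely many instances exist, and each has at most one successful update CAS. -/
lemma Execution.eventually_not_updatesAt
    (hi : ∀ᶠ t in Filter.atTop, ∀ p op, E.act t ≠ .invoke p op) :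
    ∀ᶠ t in Filter.atTop, ∀ u, ¬ E.UpdatesAt t u := by
  obtain ⟨T, hT⟩ := Filter.eventually_atTop.1 hi
  have h1 : ∀ i ∈ Finset.range T, ∀ᶠ t in Filter.atTop, ∀ u, E.UpdatesAt t u →
      E.owner u ≠ i := by
    intro i _
    by_cases hex : ∃ s u, E.UpdatesAt s u ∧ E.owner u = i
    · obtain ⟨s, u, hu, ho⟩ := hex
      refine Filter.eventually_atTop.2 ⟨s + 1, fun t ht v hv ho' => ?_⟩
      have := (hu.unique hv (ho.trans ho'.symm)).1
      omega
    · exact .of_forall fun t u hu ho => hex ⟨t, u, hu, ho⟩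
  refine ((Filter.eventually_all_finset _).2 h1).mono fun t ht u hu => ?_
  obtain ⟨-, op, p, ha⟩ := hu.invokes
  refine ht _ (Finset.mem_range.2 ?_) u hu rfl
  by_contra hle
  exact hT _ (not_lt.1 hle) p op ha

/-- From time `T` on, no update CAS succeeds. -/
def Execution.QuietFrom (E : Execution P K) (T : ℕ) : Prop :=
  ∀ t ≥ T, ∀ u, ¬ E.UpdatesAt t u

lemma Execution.QuietFrom.effect {T t : ℕ} (hq : E.QuietFrom T) (ht : T ≤ t) :
    Effect (E.ghost t) (E.heap (t + 1)) none := by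
  obtain ⟨l, he, hl⟩ := E.exists_effect t
  cases l with
  | none => exact he
  | some u => exact absurd ((hl u).2 rfl) (hq t ht u)

lemma Execution.QuietFrom.listed {T t : ℕ} (hq : E.QuietFrom T) (ht : T ≤ t) {a : Ptr} :
    (E.ghost t).listed a ↔ (E.ghost T).listed a := by
  induction t, ht using Nat.le_induction with
  | base => rfl
  | succ t ht ih =>
    rw [← ih]
    refine ⟨?_, listed_mono t.le_succ⟩
    rintro ⟨s, hs, h⟩
    rcases Nat.le_succ_iff.1 hs with hs | rfl
    · exact ⟨s, hs, h⟩
    · exact ⟨t, le_rfl, ((hq.effect ht).inList_iff (E.ghost_inv t)).1 h⟩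

lemma Execution.key_eq {s t : ℕ} (hst : s ≤ t) {a : Ptr} (ha : (E.ghost s).listed a) :
    ((E.heap t).node a).key = ((E.heap s).node a).key :=
  (E.inv t).history.key_eq hst ha

lemma Execution.record_eq {s t : ℕ} (hst : s ≤ t) {u : RecPtr} (hu : u < (E.heap s).numRecs) :
    ((E.heap t).scx u).V = ((E.heap s).scx u).V ∧
      ((E.heap t).scx u).infoFields = ((E.heap s).scx u).infoFields := by
  induction t, hst using Nat.le_induction with
  | base => exact ⟨rfl, rfl⟩
  | succ t ht ih =>
    have hlt := hu.trans_le (E.numRecs_mono ht)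
    exact ⟨((E.ghost_mono t).V u hlt).trans ih.1, ((E.ghost_mono t).infoFields u hlt).trans ih.2⟩

lemma Execution.listed_finite (E : Execution P K) (t : ℕ) : {a | (E.ghost t).listed a}.Finite :=
  (Set.finite_lt_nat _).subset fun _ ha => (E.ghost_inv t).listed_lt _ ha

/-- The nodes with a larger key than `a` that have been in the list. -/
def Execution.above (E : Execution P K) (T : ℕ) (a : Ptr) : Set Ptr :=
  {y | (E.ghost T).listed y ∧ ((E.heap T).node a).key < ((E.heap T).node y).key}

lemma Execution.above_finite (E : Execution P K) (T : ℕ) (a : Ptr) : (E.above T a).Finite :=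
  (E.listed_finite T).subset fun _ h => h.1

lemma Execution.ncard_above_lt {T : ℕ} {a y : Ptr} (h : y ∈ E.above T a) :
    (E.above T y).ncard < (E.above T a).ncard := by
  refine Set.ncard_lt_ncard ⟨fun z hz => ⟨hz.1, h.2.trans hz.2⟩, fun hs => ?_⟩
    (E.above_finite T a)
  exact lt_irrefl _ (hs h).2

lemma Execution.info_mono (E : Execution P K) (a : Ptr) :
    Monotone fun t => ((E.heap t).node a).info :=
  monotone_nat_of_le_succ fun t => (E.ghost_mono t).info_le a

/-- Induction on the number of nodes with larger keys. If `info` grew forever, some late record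
would freeze `a` and lose it. Being done without an update it is aborted, so it could not freeze
some node `r`. Freezing follows the key order, so `r` has a larger key and, by induction, a constant
`info`, which every late record expects. Hence it cannot have failed at `r`. -/
lemma Execution.QuietFrom.info_eventually_const [Finite P] {T : ℕ} (hq : E.QuietFrom T) {a : Ptr}
    (ha : (E.ghost T).listed a) : ∃ v, ∀ᶠ t in Filter.atTop, ((E.heap t).node a).info = v := by
  induction hn : (E.above T a).ncard using Nat.strong_induction_on generalizing a with
  | _ n ih =>
  subst hn
  have hY : ∀ y, ∃ v, y ∈ E.above T a → ∀ᶠ t in Filter.atTop, ((E.heap t).node y).info = v := by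
    intro y
    by_cases hy : y ∈ E.above T a
    · obtain ⟨v, hv⟩ := ih _ (ncard_above_lt hy) hy.1 rfl
      exact ⟨v, fun _ => hv⟩
    · exact ⟨0, fun h => absurd h hy⟩
  choose v hv using hY
  have hv' : ∀ᶠ t in Filter.atTop, ∀ y ∈ E.above T a, ((E.heap t).node y).info = v y :=
    (Filter.eventually_all_finite (E.above_finite T a)).2 hv
  obtain ⟨N, hN⟩ := exists_fresh hv'
  obtain ⟨T', hT'⟩ := Filter.eventually_atTop.1 hv'
  rcases tendsto_atTop_of_monotone (E.info_mono a) with htop | ⟨l, hl⟩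
  · exfalso
    obtain ⟨t₁, ht₁, hle₁⟩ := (((Filter.eventually_ge_atTop (max T T')).and
      (htop.eventually_ge_atTop (max N (E.heap T).numRecs)))).exists
    -- At `t₁` the node is frozen for a late record `u`; by `t₂` it has been frozen for a newer one.
    obtain ⟨t₂, ht₂, hlt₂⟩ := ((Filter.eventually_ge_atTop t₁).and
      (htop.eventually_gt_atTop ((E.heap t₁).node a).info)).exists
    generalize hu : ((E.heap t₁).node a).info = u at hle₁ hlt₂
    have hS := E.ghost_inv t₂
    have hf : (E.ghost t₂).froze a u := ⟨t₁, ht₂, hu⟩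
    have hlt := hS.froze_lt a u hf
    have hT₂ : T ≤ t₂ := (le_max_left _ _).trans (ht₁.trans ht₂)
    have hT₂' : T' ≤ t₂ := (le_max_right _ _).trans (ht₁.trans ht₂)
    have huN : N ≤ u := (le_max_left _ _).trans hle₁
    have huT : (E.heap T).numRecs ≤ u := (le_max_right _ _).trans hle₁
    have hd : u ≠ dummy := ((E.ghost_inv T).recs_pos.trans_le huT).ne'
    have hst := hS.froze_done a u hf hlt₂.ne'
    cases hstate : ((E.ghost t₂).scx u).state with
    | inProgress => exact hst hstate
    | committed =>
      obtain ⟨s, -, hs⟩ := hS.committed u hlt hstate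
      have hsT : s < T := not_le.1 fun h => hq s h u hs
      exact absurd (hs.not_updated.1.trans_le (E.numRecs_mono hsT.le)) huT.not_gt
    | aborted =>
      obtain ⟨r, hr, hlt', hnf⟩ := hS.aborted u hlt hd hstate
      obtain ⟨l₁, l₂, hV⟩ := List.append_of_mem (hS.froze_mem a u hf hd)
      have hrec := hS.record u hlt hd
      have hpw := hrec.pairwise
      have hlis := (hq.listed hT₂).1 (hS.mem_V_spec hlt hd hr).2
      rw [hV] at hr hpw
      -- Since `a` was frozen for `u`, so were all nodes before it in `V`; the missing node comes
      -- later.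
      have hr₂ : r ∈ l₂ := by
        rcases List.mem_append.1 hr with h | h
        · exact absurd (hS.froze_prefix u l₁ a l₂ hd hV hf r h) hnf
        · rcases List.mem_cons.1 h with rfl | h
          · exact absurd hf hnf
          · exact h
      have hkey : ((E.heap t₂).node a).key < ((E.heap t₂).node r).key :=
        (List.pairwise_cons.1 (List.pairwise_append.1 hpw).2.1).1 r hr₂
      have hmem : r ∈ E.above T a := by
        refine ⟨hlis, ?_⟩
        rwa [key_eq hT₂ ha, key_eq hT₂ hlis] at hkey
      have h1 := hN t₂ u huN hlt r (by
        change r ∈ ((E.ghost t₂).scx u).V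
        rw [hV]; exact hr) hmem
      have h2 := hT' t₂ hT₂' r hmem
      simp only [Ghost.scx, Ghost.node, ghost_heap] at hlt'
      rw [h1, h2] at hlt'
      exact lt_irrefl _ hlt'
  · exact ⟨l, by simpa using hl⟩

/-- The state changes at most once, since whatever replaces `inProgress` is final. -/
lemma Execution.state_eventually_const {u : RecPtr} {T : ℕ} (hu : u < (E.heap T).numRecs) :
    ∀ᶠ t in Filter.atTop, ((E.heap (t + 1)).scx u).state = ((E.heap t).scx u).state := by
  by_cases hex : ∃ t ≥ T, ((E.heap t).scx u).state ≠ .inProgress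
  · obtain ⟨t₀, ht₀, h⟩ := hex
    have key : ∀ t ≥ t₀, ((E.heap t).scx u).state = ((E.heap t₀).scx u).state := by
      intro t ht
      induction t, ht using Nat.le_induction with
      | base => rfl
      | succ t ht ih =>
        rw [← ih] at h ⊢
        exact (E.ghost_mono t).state u (hu.trans_le (E.numRecs_mono (ht₀.trans ht))) h
    exact Filter.eventually_atTop.2 ⟨t₀, fun t ht =>
      (key _ (ht.trans t.le_succ)).trans (key t ht).symm⟩
  · push Not at hex
    exact Filter.eventually_atTop.2 ⟨T, fun t ht =>
      (hex _ (ht.trans t.le_succ)).trans (hex t ht).symm⟩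

/-- Nothing that the outcome of an `LLX` depends on differs. -/
structure SameList (S T : Ghost K) : Prop where
  inList : ∀ a, InList T.heap a ↔ InList S.heap a
  next : ∀ a, S.listed a → (T.node a).next = (S.node a).next
  info : ∀ a, S.listed a → (T.node a).info = (S.node a).info
  state : ∀ a, S.listed a → (T.scx (S.node a).info).state = (S.scx (S.node a).info).state

/-- If no update CAS succeeds any more, then eventually the list is not changed any more, and
the `info` fields of new records are those of the nodes. -/
lemma Execution.QuietFrom.eventually_sameList [Finite P] {T : ℕ} (hq : E.QuietFrom T) :
    ∀ᶠ t in Filter.atTop, SameList (E.ghost t) (E.ghost (t + 1)) ∧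
      ∀ u, (E.heap t).numRecs ≤ u → u < (E.heap (t + 1)).numRecs →
        ∀ y ∈ ((E.heap (t + 1)).scx u).V,
          ((E.heap (t + 1)).scx u).infoFields y = ((E.heap (t + 1)).node y).info := by
  have hY : ∀ y, ∃ v, (E.ghost T).listed y → ∀ᶠ t in Filter.atTop,
      ((E.heap t).node y).info = v := by
    intro y
    by_cases hy : (E.ghost T).listed y
    · obtain ⟨v, hv⟩ := hq.info_eventually_const hy
      exact ⟨v, fun _ => hv⟩
    · exact ⟨0, fun h => absurd h hy⟩
  choose v hv using hY
  have hv' : ∀ᶠ t in Filter.atTop, ∀ y ∈ {a | (E.ghost T).listed a},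
      ((E.heap t).node y).info = v y :=
    (Filter.eventually_all_finite (E.listed_finite T)).2 hv
  have hstate : ∀ᶠ t in Filter.atTop, ∀ y ∈ {a | (E.ghost T).listed a},
      ((E.heap (t + 1)).scx (v y)).state = ((E.heap t).scx (v y)).state := by
    refine (Filter.eventually_all_finite (E.listed_finite T)).2 fun y hy => ?_
    obtain ⟨t, ht⟩ := (hv y hy).exists
    exact state_eventually_const (T := t) (ht ▸ (E.ghost_inv t).info_lt y)
  filter_upwards [hv', (Filter.tendsto_add_atTop_nat 1).eventually hv', hstate, eventually_fresh hv',
    Filter.eventually_ge_atTop T] with t h1 h2 h3 h4 ht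
  have hS := E.ghost_inv t
  have he := hq.effect ht
  refine ⟨⟨fun a => he.inList_iff hS, fun a ha => (he.fields_eq hS ha).2.2, fun a ha => ?_,
    fun a ha => ?_⟩, fun u hu hlt y hy => ?_⟩
  · rw [hq.listed ht] at ha
    exact (h2 a ha).trans (h1 a ha).symm
  · rw [hq.listed ht] at ha
    simp only [Ghost.scx, Ghost.node, ghost_heap]
    rw [h1 a ha]
    exact h3 a ha
  · have hd : u ≠ dummy := (hS.recs_pos.trans_le hu).ne'
    have hlis := (hq.listed (ht.trans t.le_succ)).1 ((E.ghost_inv (t + 1)).mem_V_spec hlt hd hy).2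
    exact (h4 u hu hlt y hy hlis).trans (h2 y hlis).symm

end EventualStability

/-! ### A measure that decreases within an iteration. -/

section Measure

/-- A bound on the number of steps until `Help` returns. -/
def HelpPC.size : HelpPC → ℕ
  -- Each node costs at most two steps, the CAS and the check of its failure. The constant leaves
  -- room for what follows, where `R` has at most two elements.
  | .freeze todo => 2 * todo.length + 10
  | .checkFrozen _ todo => 2 * todo.length + 11
  | .frozen => 9
  | .mark todo => todo.length + 5
  | .updateCAS => 4
  | .commit => 3
  | .frozenCheck => 4
  | .abort => 3

/-- A bound on the number of steps until `LLX` returns. -/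
def LLXPC.size : LLXPC → ℕ
  | .helpFail _ pc => pc.size
  -- One more than the size of a fresh `Help`, which is at most `2 * 3 + 10` because `V` has at most
  -- three elements.
  | .failInfoAgain => 17
  | .failState _ => 18
  | .failInfo => 19
  -- When this `Help` returns, `LLX` may go on to `failInfo`, of size `19`; the offset keeps the
  -- measure decreasing.
  | .helpFinal _ _ pc => 20 + pc.size
  | .testInProgress _ _ => 37
  | .testCommitted _ _ => 38
  | .reread _ _ _ _ => 39
  | .readNext _ _ _ => 40
  | .readCount _ _ => 41
  | .readMarked2 _ _ _ => 42
  | .readState _ _ => 43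
  | .readInfo _ => 44
  | .readMarked1 => 45

/-- A bound on the number of steps until the operation returns, starts its main loop anew or
creates a record; `D r` bounds the number of steps of a search from `r`. -/
def PC.size (D : Ptr → ℕ) (M : ℕ) : PC → ℕ
  -- The constants leave room for the phases that follow: a fresh `LLX` has size `45`, `Delete` may
  -- need three of them in succession, and the search costs at most `M` more.
  | .start => M + 200
  | .search _ r => D r + 160
  | .found _ _ => 150
  | .insLLXr _ pc => 1 + pc.size
  | .insR _ _ => 1
  | .insLLXp _ _ pc => 1 + pc.size
  | .insP _ _ _ => 1
  | .delLLXp _ _ pc => 100 + pc.size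
  | .delLLXr _ _ _ pc => 50 + pc.size
  | .delTest _ _ _ _ => 50
  | .delLLXn _ _ _ pc => 1 + pc.size
  | .delN _ _ _ _ => 1
  | .scx _ pc _ => pc.size
  | .fault => 0

variable {K : Type*} [LinearOrder K] {S : Ghost K}

lemma HelpPC.size_pos (pc : HelpPC) : 0 < pc.size := by
  cases pc <;> simp [HelpPC.size]

lemma LLXPC.size_pos (pc : LLXPC) : 0 < pc.size := by
  cases pc <;> simp [LLXPC.size, HelpPC.size_pos]

lemma HelpInv.size_lt (hS : S.Inv) {u : RecPtr} {pc pc' : HelpPC} (h : HelpInv S u pc)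
    (hs : (stepHelp S.heap u pc).2 = .inl pc') : pc'.size < pc.size := by
  have hR : (S.scx u).R.length ≤ 2 := (hS.record u h.1 h.2.1).length_le.2
  cases pc with
  | freeze todo =>
    cases todo <;> simp only [stepHelp] at hs <;> (try split_ifs at hs) <;> cases hs <;>
      simp only [HelpPC.size, List.length_cons, List.length_nil] <;> omega
  | mark todo => cases todo <;> cases hs; all_goals simp [HelpPC.size]
  | updateCAS =>
    simp only [stepHelp] at hs; split_ifs at hs <;> cases hs; all_goals simp [HelpPC.size]
  | checkFrozen r todo =>
    simp only [stepHelp] at hs; split_ifs at hs <;> cases hs; all_goals simp [HelpPC.size]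
  | frozenCheck => simp only [stepHelp] at hs; split_ifs at hs; cases hs; simp [HelpPC.size]
  | abort => cases hs
  | frozen => cases hs; simp only [HelpPC.size]; simp only [Ghost.scx] at hR; omega
  | commit => cases hs

lemma HelpInv.startHelp_size {u : RecPtr} (hS : S.Inv) (hu : u < S.heap.numRecs)
    (hd : u ≠ dummy) : (startHelp S.heap u).size ≤ 16 := by
  have := (hS.record u hu hd).length_le.1
  simp only [startHelp, HelpPC.size]
  simp only [Ghost.scx] at this
  omega

lemma LLXInv.size_lt (hS : S.Inv) {r : Ptr} {tbl : Table} {pc pc' : LLXPC}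
    (h : LLXInv S r pc) (hs : (stepLLX S.heap tbl r pc).2.2 = .inl pc') : pc'.size < pc.size := by
  have hstart : ∀ u < S.heap.numRecs, u ≠ dummy → (startHelp S.heap u).size ≤ 16 :=
    fun u hu hd => HelpInv.startHelp_size hS hu hd
  cases pc with
  | reread m i c nx =>
    simp only [stepLLX] at hs; split_ifs at hs; cases hs; simp [LLXPC.size]
  | readMarked2 m i st =>
    simp only [stepLLX] at hs; split_ifs at hs <;> cases hs <;> simp [LLXPC.size]
  | testCommitted m i =>
    simp only [stepLLX] at hs; split_ifs at hs <;> cases hs <;> simp [LLXPC.size]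
  | testInProgress m i =>
    simp only [stepLLX] at hs
    split_ifs at hs with hi <;> cases hs
    · have := hstart i (hS.froze_lt _ _ h) (by
        rintro rfl
        rw [hS.dummy_state] at hi; cases hi)
      simp only [LLXPC.size]; omega
    · simp [LLXPC.size]
  | failState x =>
    simp only [stepLLX] at hs; split_ifs at hs; cases hs; simp [LLXPC.size]
  | failInfoAgain =>
    cases hs
    have := hstart _ (hS.info_lt r) h
    simp only [LLXPC.size]; simp only [Ghost.node] at this; omega
  | helpFinal m u pc =>
    have hlt := fun pc' => HelpInv.size_lt (pc' := pc') hS h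
    simp only [stepLLX] at hs
    rcases hst : stepHelp S.heap u pc with ⟨h₁, pc₁ | b⟩
    · rw [hst] at hs hlt
      cases hs
      simpa [LLXPC.size] using hlt pc₁ rfl
    · rw [hst] at hs
      dsimp only at hs
      split_ifs at hs; cases hs
      simp only [LLXPC.size]
      cases pc with
      | commit => simp [HelpPC.size]
      | abort => simp [HelpPC.size]
      | frozenCheck => simp [HelpPC.size]
      | _ => simp only [HelpPC.size]; omega
  | helpFail u pc =>
    have hlt := fun pc' => HelpInv.size_lt (pc' := pc') hS h
    simp only [stepLLX] at hs
    rcases hst : stepHelp S.heap u pc with ⟨h₁, pc₁ | b⟩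
    · rw [hst] at hs hlt
      cases hs
      exact hlt pc₁ rfl
    · rw [hst] at hs; cases hs
  | _ => cases hs; simp [LLXPC.size]

variable {P : Type*} [DecidableEq P] {E : Execution P K}

lemma inLLX_size_lt (hS : S.Inv) {tbl : Table} {r : Ptr} {pc : LLXPC} {stay : LLXPC → PC}
    {exit : LLXResult → PC} {D : Ptr → ℕ} {M c : ℕ} {h' : Heap K} {tbl' : Table} {pc' : PC}
    (hs : inLLX S.heap tbl r pc stay exit = (h', tbl', .inl pc')) (h : LLXInv S r pc)
    (h1 : ∀ pc, (stay pc).size D M = c + pc.size) (h2 : ∀ res, (exit res).size D M ≤ c) :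
    pc'.size D M < c + pc.size := by
  rw [inLLX_eq] at hs
  simp only [Prod.mk.injEq, Sum.inl.injEq] at hs
  rw [← hs.2.2]
  cases hres : (stepLLX S.heap tbl r pc).2.2 with
  | inl pc₁ =>
    have := h.size_lt hS hres
    simp only [Sum.elim_inl, h1]
    omega
  | inr res =>
    have := pc.size_pos
    have := h2 res
    simp only [Sum.elim_inr]
    omega

/-- The size of the program counter decreases in every step, except when the main loop is
started anew or a record is created. -/
lemma Execution.PCInv.size_lt {t i : ℕ} {op : Op K} {tbl tbl' : Table} {pc pc' : PC} {h' : Heap K}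
    (hS : (E.ghost t).Inv) (h : E.PCInv t i op tbl pc) {D : Ptr → ℕ} {M : ℕ}
    (hM : ∀ r, D r ≤ M)
    (hD : ∀ r x, (E.ghost t).listed r → ((E.heap t).node r).next = some x → D x < D r)
    (hs : stepOp (E.heap t) tbl op pc = (h', tbl', .inl pc'))
    (hno : h'.numRecs = (E.heap t).numRecs) : pc' = .start ∨ pc'.size D M < pc.size D M := by
  cases pc with
  | start =>
    right
    simp only [stepOp] at hs
    split at hs
    · rename_i r _
      cases hs
      have := hM r
      simp only [PC.size]; omega
    · cases hs; simp [PC.size]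
  | search p r =>
    right
    simp only [stepOp] at hs
    split_ifs at hs
    · split at hs
      · rename_i x hx
        cases hs
        have := hD r x h.1.listed.2 hx
        simp only [PC.size]; omega
      · cases hs; simp [PC.size]
    · cases hs; simp only [PC.size]; omega
  | found p r =>
    right
    cases op <;> simp only [stepOp, stepFound] at hs <;> (try split_ifs at hs) <;> cases hs <;>
      simp [PC.size, LLXPC.size]
  | insLLXr r pc =>
    obtain ⟨k, n, -, -, -, h⟩ := h
    exact .inr (inLLX_size_lt hS hs h (fun _ => rfl) fun _ => le_rfl)
  | insLLXp p r pc =>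
    obtain ⟨k, n, -, -, -, h⟩ := h
    exact .inr (inLLX_size_lt hS hs h (fun _ => rfl) fun _ => le_rfl)
  | delLLXp p r pc =>
    obtain ⟨k, n, -, -, h⟩ := h
    exact .inr (inLLX_size_lt hS hs h (fun _ => rfl) fun _ => by simp [PC.size, LLXPC.size])
  | delLLXr p r lp pc =>
    obtain ⟨k, n, -, -, -, h⟩ := h
    exact .inr (inLLX_size_lt hS hs h (fun _ => rfl) fun _ => by simp [PC.size])
  | delLLXn p r x pc =>
    obtain ⟨k, n, -, -, h⟩ := h
    exact .inr (inLLX_size_lt hS hs h (fun _ => rfl) fun _ => le_rfl)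
  | insR r res =>
    obtain ⟨k, n, rfl, -⟩ := h
    left
    cases res with
    | snapshot c nx =>
      simp only [stepOp, stepInsR, callSCX, Prod.mk.injEq] at hs
      rw [← hs.1] at hno
      exact absurd hno (Nat.succ_ne_self _)
    | _ => simp only [stepOp, stepInsR] at hs; cases hs; rfl
  | insP p r res =>
    obtain ⟨k, n, rfl, -⟩ := h
    left
    cases res with
    | snapshot c nx =>
      simp only [stepOp, stepInsP, callSCX] at hs
      split_ifs at hs
      · simp only [Prod.mk.injEq] at hs
        rw [← hs.1] at hno
        exact absurd hno (Nat.succ_ne_self _)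
      · cases hs; rfl
    | _ => simp only [stepOp, stepInsP] at hs; cases hs; rfl
  | delTest p r lp lr =>
    obtain ⟨k, n, rfl, -⟩ := h
    cases lp with
    | snapshot c₀ pn =>
      cases lr with
      | snapshot c rn =>
        simp only [stepOp, stepDelTest, callSCX] at hs
        by_cases h1 : pn = some r
        · rw [if_pos h1] at hs
          by_cases h2 : (k : WithBot (WithTop K)) ≠ ((E.heap t).node r).key ∨ c < n
          · rw [if_pos h2] at hs; simp at hs
          · rw [if_neg h2] at hs
            by_cases h3 : n < c
            · rw [if_pos h3] at hs
              simp only [Prod.mk.injEq] at hs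
              rw [← hs.1] at hno
              exact absurd hno (Nat.succ_ne_self _)
            · rw [if_neg h3] at hs
              right
              split at hs <;> cases hs <;> simp [PC.size, LLXPC.size]
        · rw [if_neg h1] at hs; cases hs; exact .inl rfl
      | _ => simp only [stepOp, stepDelTest] at hs; cases hs; exact .inl rfl
    | _ => simp only [stepOp, stepDelTest] at hs; cases hs; exact .inl rfl
  | delN p r x res =>
    left
    cases res with
    | snapshot c nx =>
      simp only [stepOp, stepDelN, callSCX, Prod.mk.injEq] at hs
      rw [← hs.1] at hno
      exact absurd hno (Nat.succ_ne_self _)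
    | _ => simp only [stepOp, stepDelN] at hs; cases hs; rfl
  | scx u pc ret =>
    have hlt := fun pc' => HelpInv.size_lt (pc' := pc') hS h.1
    simp only [stepOp] at hs
    rcases hst : stepHelp (E.heap t) u pc with ⟨h₁, pc₁ | b⟩
    · rw [hst] at hs
      cases hs
      exact .inr (hlt pc₁ (by rw [ghost_heap, hst]))
    · rw [hst] at hs
      cases b <;> cases hs
      exact .inl rfl
  | fault => exact absurd h id

end Measure

/-! ### In a stable memory an iteration cannot fail. -/

section Stable

variable {K : Type*} [LinearOrder K] {S T : Ghost K}

/-- A node in the list whose `info` record is committed is not marked. -/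
lemma Ghost.Inv.not_marked (hS : S.Inv) {r : Ptr} (hr : InList S.heap r)
    (hst : (S.scx (S.node r).info).state = .committed) : (S.node r).marked = false := by
  by_contra hm
  rw [Bool.not_eq_false] at hm
  obtain ⟨u, hu, haf, hR⟩ := hS.marked r hm
  have hd : u ≠ dummy := by
    rintro rfl
    rw [hS.dummy_allFrozen] at haf; cases haf
  have hnu : ¬ S.updated u := fun h => hS.removed u r h hR hr
  have hf := hS.allFrozen u hu haf r ((hS.record u hu hd).R_subset hR)
  have hip : (S.scx u).state = .inProgress := by
    cases h : (S.scx u).state with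
    | inProgress => rfl
    | committed => exact absurd (hS.committed u hu h) hnu
    | aborted => exact absurd (hS.aborted u hu hd h) (hS.not_cannotFreeze hu haf)
  have hi : (S.node r).info = u := by
    by_contra hne
    exact hS.froze_done r u hf hne hip
  rw [hi, hip] at hst; cases hst

/-- In an execution in which the list does not change any more, the `LLX` will give a snapshot. -/
def LLXSucceeds (S : Ghost K) (r : Ptr) : LLXPC → Prop
  | .readMarked1 => True
  | .readInfo _ => True
  | .readState _ i => i = (S.node r).info
  | .readMarked2 _ i st => i = (S.node r).info ∧ st = (S.scx i).state
  | .readCount _ i => i = (S.node r).info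
  | .readNext _ i _ => i = (S.node r).info
  | .reread _ i _ nx => i = (S.node r).info ∧ nx = (S.node r).next
  | .testCommitted _ i => i = (S.node r).info ∧ (S.scx i).state = .inProgress
  | .testInProgress _ i => i = (S.node r).info ∧ (S.scx i).state = .inProgress
  | .helpFinal _ i _ => i = (S.node r).info ∧ (S.scx i).state = .inProgress
  | _ => False

lemma LLXSucceeds.mono (h : SameList S T) {r : Ptr} (hr : S.listed r) {pc : LLXPC}
    (hpc : LLXSucceeds S r pc) : LLXSucceeds T r pc := by
  have h1 := h.info r hr
  have h2 := h.next r hr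
  have h3 := h.state r hr
  cases pc <;> simp only [LLXSucceeds] at hpc ⊢
  case readMarked2 => obtain ⟨rfl, h5⟩ := hpc; exact ⟨h1.symm, h5.trans h3.symm⟩
  case reread => exact ⟨hpc.1.trans h1.symm, hpc.2.trans h2.symm⟩
  case testCommitted => obtain ⟨rfl, h5⟩ := hpc; exact ⟨h1.symm, h3.trans h5⟩
  case testInProgress => obtain ⟨rfl, h5⟩ := hpc; exact ⟨h1.symm, h3.trans h5⟩
  case helpFinal => obtain ⟨rfl, h5⟩ := hpc; exact ⟨h1.symm, h3.trans h5⟩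
  all_goals exact hpc.trans h1.symm

/-- The outcome of a step of an `LLX` that will give a snapshot. -/
def LLXSucceedsPost (T : Ghost K) (r : Ptr) : LLXPC ⊕ LLXResult → Prop
  | .inl pc => LLXSucceeds T r pc
  | .inr res => ∃ c, res = .snapshot c (T.node r).next

/-- An `LLX` could fail only by finding a changed `info`, a finalized node, or a helped record that
gets done. The first contradicts stability and the second membership in the list. The third would
change the state of a record that `SameList` keeps in progress, so that `Help` does not return at
all. -/
lemma LLXSucceeds.step (hS : S.Inv) (hT : SameList S T) {r : Ptr} (hr : InList S.heap r)
    {tbl : Table} {pc : LLXPC} (hinv : LLXInv S r pc) (h : LLXSucceeds S r pc)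
    (hh : T.heap = (stepLLX S.heap tbl r pc).1) :
    LLXSucceedsPost T r (stepLLX S.heap tbl r pc).2.2 := by
  have hl := hS.listed r hr
  have h1 := hT.info r hl
  have h2 := hT.next r hl
  have h3 := hT.state r hl
  -- A return from `Help` leaves the record committed or aborted, whereas its state is not allowed
  -- to change.
  have hhelp : ∀ i pc', HelpInv S i pc' → i = (S.node r).info → (S.scx i).state = .inProgress →
      T.heap = (stepHelp S.heap i pc').1 → ∀ b, (stepHelp S.heap i pc').2 ≠ .inr b := by
    rintro i pc' hi rfl hst heq b hb
    have hp := hi.post hS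
    rw [hb] at hp
    have : (T.scx (S.node r).info).state ≠ .inProgress := by
      rw [Ghost.scx, heq]
      cases b <;> simp only [HelpPost, Ghost.next_scx] at hp <;> rw [hp] <;> simp
    exact this (h3.trans hst)
  cases pc with
  | readMarked1 => trivial
  | readInfo m => exact h1.symm
  | readState m i =>
    subst h
    exact ⟨h1.symm, h3.symm⟩
  | readMarked2 m i st =>
    obtain ⟨rfl, rfl⟩ := h
    by_cases hc : (S.scx (S.node r).info).state = .aborted ∨
        ((S.scx (S.node r).info).state = .committed ∧ (S.heap.node r).marked = false)
    · simp only [stepLLX]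
      rw [if_pos hc]; exact h1.symm
    · simp only [stepLLX]
      rw [if_neg hc]
      refine ⟨h1.symm, h3.trans ?_⟩
      cases hst : (S.scx (S.node r).info).state with
      | inProgress => rfl
      | aborted => exact absurd (.inl hst) hc
      | committed => exact absurd (.inr ⟨hst, hS.not_marked hr hst⟩) hc
  | readCount m i => exact h.trans h1.symm
  | readNext m i c => exact ⟨h.trans h1.symm, h2.symm⟩
  | reread m i c nx =>
    simp only [stepLLX]
    rw [if_pos h.1.symm]
    exact ⟨c, by rw [h2, h.2]⟩
  | testCommitted m i =>
    obtain ⟨rfl, h5⟩ := h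
    have hne : ¬ (S.heap.scx (S.node r).info).state = .committed := by
      change ¬ (S.scx (S.node r).info).state = .committed
      rw [h5]; simp
    simp only [stepLLX]
    rw [if_neg hne]
    exact ⟨h1.symm, h3.trans h5⟩
  | testInProgress m i =>
    obtain ⟨rfl, h5⟩ := h
    simp only [stepLLX]
    rw [if_pos h5]
    exact ⟨h1.symm, h3.trans h5⟩
  | helpFinal m i pc =>
    have hno := hhelp i pc hinv h.1 h.2
    obtain ⟨rfl, h5⟩ := h
    revert hno
    simp only [stepLLX] at hh ⊢
    rcases hst : stepHelp S.heap (S.node r).info pc with ⟨h₁, pc₁ | b⟩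
    · exact fun _ => ⟨h1.symm, h3.trans h5⟩
    · rw [hst] at hh
      exact fun hno => absurd rfl (hno hh b)
  | failInfo => exact absurd h id
  | failState x => exact absurd h id
  | failInfoAgain => exact absurd h id
  | helpFail u pc => exact absurd h id

/-- In an execution in which the list does not change any more, the current iteration of the main
loop will not fail. -/
def PCSucceeds (S : Ghost K) : PC → Prop
  | .start => True
  | .search p r => InList S.heap p ∧ (S.node p).next = some r
  | .found p r => InList S.heap p ∧ (S.node p).next = some r
  | .insLLXr r pc => InList S.heap r ∧ LLXSucceeds S r pc
  | .insR _ res => ∃ c nx, res = .snapshot c nx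
  | .insLLXp p r pc => InList S.heap p ∧ (S.node p).next = some r ∧ LLXSucceeds S p pc
  | .insP _ r res => ∃ c, res = .snapshot c (some r)
  | .delLLXp p r pc => InList S.heap p ∧ (S.node p).next = some r ∧ LLXSucceeds S p pc
  | .delLLXr _ r lp pc => InList S.heap r ∧ (∃ c, lp = .snapshot c (some r)) ∧ LLXSucceeds S r pc
  | .delTest _ r lp lr => InList S.heap r ∧ (∃ c, lp = .snapshot c (some r)) ∧
      ∃ c, lr = .snapshot c (S.node r).next
  | .delLLXn _ _ x pc => InList S.heap x ∧ LLXSucceeds S x pc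
  | .delN _ _ _ res => ∃ c nx, res = .snapshot c nx
  -- Entering this state means creating a record, an outcome that is excluded separately.
  | .scx _ _ _ => False
  | .fault => False

lemma PCSucceeds.mono (hS : S.Inv) (h : SameList S T) {pc : PC} (hpc : PCSucceeds S pc) :
    PCSucceeds T pc := by
  have hin : ∀ {a}, InList S.heap a → InList T.heap a := fun ha => (h.inList _).2 ha
  have hnext : ∀ {a}, InList S.heap a → (T.node a).next = (S.node a).next :=
    fun ha => h.next _ (hS.listed _ ha)
  have hl : ∀ {a pc}, InList S.heap a → LLXSucceeds S a pc → LLXSucceeds T a pc :=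
    fun ha hp => hp.mono h (hS.listed _ ha)
  cases pc with
  | start => trivial
  | search p r => exact ⟨hin hpc.1, (hnext hpc.1).trans hpc.2⟩
  | found p r => exact ⟨hin hpc.1, (hnext hpc.1).trans hpc.2⟩
  | insLLXr r pc => exact ⟨hin hpc.1, hl hpc.1 hpc.2⟩
  | insR r res => exact hpc
  | insLLXp p r pc => exact ⟨hin hpc.1, (hnext hpc.1).trans hpc.2.1, hl hpc.1 hpc.2.2⟩
  | insP p r res => exact hpc
  | delLLXp p r pc => exact ⟨hin hpc.1, (hnext hpc.1).trans hpc.2.1, hl hpc.1 hpc.2.2⟩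
  | delLLXr p r lp pc => exact ⟨hin hpc.1, hpc.2.1, hl hpc.1 hpc.2.2⟩
  | delTest p r lp lr =>
    refine ⟨hin hpc.1, hpc.2.1, ?_⟩
    rw [hnext hpc.1]; exact hpc.2.2
  | delLLXn p r x pc => exact ⟨hin hpc.1, hl hpc.1 hpc.2⟩
  | delN p r x res => exact hpc
  | scx u pc ret => exact hpc
  | fault => exact hpc

variable {P : Type*} [DecidableEq P] {E : Execution P K}

/-- In an execution in which the list does not change any more, an iteration of the main loop
leads to a response or to the creation of a record. -/
lemma Execution.PCInv.succeeds {t i : ℕ} {op : Op K} {tbl tbl' : Table} {pc pc' : PC}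
    (hS : (E.ghost t).Inv) (h : E.PCInv t i op tbl pc)
    (hT : SameList (E.ghost t) (E.ghost (t + 1))) (hpc : PCSucceeds (E.ghost t) pc)
    (hs : stepOp (E.heap t) tbl op pc = (E.heap (t + 1), tbl', .inl pc'))
    (hno : (E.heap (t + 1)).numRecs = (E.heap t).numRecs) :
    PCSucceeds (E.ghost (t + 1)) pc' ∧ pc' ≠ .start := by
  have hin : ∀ {a}, InList (E.heap t) a → InList (E.heap (t + 1)) a :=
    fun ha => (hT.inList _).2 ha
  have hnext : ∀ {a}, InList (E.heap t) a →
      ((E.heap (t + 1)).node a).next = ((E.heap t).node a).next :=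
    fun ha => hT.next _ (hS.listed _ ha)
  -- `LLX` inside an operation
  have hllx : ∀ {r : Ptr} {pc₀ : LLXPC} {stay : LLXPC → PC} {exit : LLXResult → PC},
      inLLX (E.heap t) tbl r pc₀ stay exit = (E.heap (t + 1), tbl', .inl pc') →
      InList (E.heap t) r → LLXInv (E.ghost t) r pc₀ → LLXSucceeds (E.ghost t) r pc₀ →
      (∃ pc₁, LLXSucceeds (E.ghost (t + 1)) r pc₁ ∧ pc' = stay pc₁) ∨
        ∃ c, pc' = exit (.snapshot c ((E.heap (t + 1)).node r).next) := by
    intro r pc₀ stay exit hs hr h1 h2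
    rw [inLLX_eq] at hs
    simp only [Prod.mk.injEq, Sum.inl.injEq] at hs
    have := h2.step (T := E.ghost (t + 1)) (tbl := tbl) hS hT hr h1 hs.1.symm
    rw [ghost_heap] at this
    rw [← hs.2.2]
    cases hres : (stepLLX (E.heap t) tbl r pc₀).2.2 with
    | inl pc₁ => rw [hres] at this; exact .inl ⟨pc₁, this, rfl⟩
    | inr res =>
      rw [hres] at this
      obtain ⟨c, rfl⟩ := this
      exact .inr ⟨c, rfl⟩
  cases pc with
  | start =>
    simp only [stepOp] at hs
    split at hs
    · rename_i r hr
      simp only [Prod.mk.injEq, Sum.inl.injEq] at hs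
      obtain ⟨-, -, rfl⟩ := hs
      exact ⟨⟨.head, (hnext .head).trans hr⟩, by simp⟩
    · rename_i hr
      obtain ⟨b, hb, h1, h2⟩ := (hS.sorted.2.2 head hS.sorted.1).2 (by
        rw [hS.sorted.2.1]; exact WithBot.bot_ne_coe)
      rw [ghost_heap, hr] at h1; cases h1
  | search p r =>
    obtain ⟨h1, h2⟩ := hpc
    simp only [stepOp] at hs
    split_ifs at hs with hk
    · split at hs
      · rename_i x hx
        simp only [Prod.mk.injEq, Sum.inl.injEq] at hs
        obtain ⟨-, -, rfl⟩ := hs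
        exact ⟨⟨hin (h1.next h2), (hnext (h1.next h2)).trans hx⟩, by simp⟩
      · rename_i hx
        obtain ⟨b, hb, h3, h4⟩ := (hS.sorted.2.2 r (hS.listed_lt r (hS.listed _ (h1.next h2)))).2 (by
          intro htop
          rw [ghost_heap] at htop
          rw [htop] at hk
          exact absurd hk (not_lt.2 le_top))
        rw [ghost_heap, hx] at h3; cases h3
    · simp only [Prod.mk.injEq, Sum.inl.injEq] at hs
      obtain ⟨-, -, rfl⟩ := hs
      exact ⟨⟨hin h1, (hnext h1).trans h2⟩, by simp⟩
  | found p r =>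
    obtain ⟨h1, h2⟩ := hpc
    have h3 := hin h1
    have h4 : ((E.heap (t + 1)).node p).next = some r := (hnext h1).trans h2
    cases op with
    | get k => simp only [stepOp, stepFound] at hs; split_ifs at hs <;> simp at hs
    | insert k n =>
      simp only [stepOp, stepFound] at hs
      split_ifs at hs <;> simp only [Prod.mk.injEq, Sum.inl.injEq] at hs <;> rw [← hs.2.2]
      · exact ⟨⟨h3.next h4, trivial⟩, by simp⟩
      · exact ⟨⟨h3, h4, trivial⟩, by simp⟩
    | delete k n =>
      simp only [stepOp, stepFound, Prod.mk.injEq, Sum.inl.injEq] at hs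
      rw [← hs.2.2]
      exact ⟨⟨h3, h4, trivial⟩, by simp⟩
  | insLLXr r pc =>
    obtain ⟨k, n, -, -, -, h⟩ := h
    rcases hllx hs hpc.1 h hpc.2 with ⟨pc₁, h1, rfl⟩ | ⟨c, rfl⟩
    · exact ⟨⟨hin hpc.1, h1⟩, by simp⟩
    · exact ⟨⟨c, _, rfl⟩, by simp⟩
  | insLLXp p r pc =>
    obtain ⟨k, n, -, -, -, h⟩ := h
    have hn := (hnext hpc.1).trans hpc.2.1
    rcases hllx hs hpc.1 h hpc.2.2 with ⟨pc₁, h1, rfl⟩ | ⟨c, rfl⟩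
    · exact ⟨⟨hin hpc.1, hn, h1⟩, by simp⟩
    · rw [hn]; exact ⟨⟨c, rfl⟩, by simp⟩
  | delLLXp p r pc =>
    obtain ⟨k, n, -, -, h⟩ := h
    have hn := (hnext hpc.1).trans hpc.2.1
    rcases hllx hs hpc.1 h hpc.2.2 with ⟨pc₁, h1, rfl⟩ | ⟨c, rfl⟩
    · exact ⟨⟨hin hpc.1, hn, h1⟩, by simp⟩
    · rw [hn]; exact ⟨⟨(hin hpc.1).next hn, ⟨c, rfl⟩, trivial⟩, by simp⟩
  | delLLXr p r lp pc =>
    obtain ⟨k, n, -, -, -, h⟩ := h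
    rcases hllx hs hpc.1 h hpc.2.2 with ⟨pc₁, h1, rfl⟩ | ⟨c, rfl⟩
    · exact ⟨⟨hin hpc.1, hpc.2.1, h1⟩, by simp⟩
    · exact ⟨⟨hin hpc.1, hpc.2.1, c, rfl⟩, by simp⟩
  | delLLXn p r x pc =>
    obtain ⟨k, n, -, -, h⟩ := h
    rcases hllx hs hpc.1 h hpc.2 with ⟨pc₁, h1, rfl⟩ | ⟨c, rfl⟩
    · exact ⟨⟨hin hpc.1, h1⟩, by simp⟩
    · exact ⟨⟨c, _, rfl⟩, by simp⟩
  | insR r res =>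
    obtain ⟨k, n, rfl, -⟩ := h
    obtain ⟨c, nx, rfl⟩ := hpc
    simp only [stepOp, stepInsR, callSCX, Prod.mk.injEq] at hs
    rw [← hs.1] at hno
    exact absurd hno (Nat.succ_ne_self _)
  | insP p r res =>
    obtain ⟨k, n, rfl, -⟩ := h
    obtain ⟨c, rfl⟩ := hpc
    simp only [stepOp, stepInsP, callSCX, if_true, Prod.mk.injEq] at hs
    rw [← hs.1] at hno
    exact absurd hno (Nat.succ_ne_self _)
  | delTest p r lp lr =>
    obtain ⟨k, n, rfl, -, -, h4, -⟩ := h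
    obtain ⟨hr, ⟨c₀, rfl⟩, c, rfl⟩ := hpc
    simp only [stepOp, stepDelTest, callSCX, if_true] at hs
    by_cases h2 : (k : WithBot (WithTop K)) ≠ ((E.heap t).node r).key ∨ c < n
    · rw [if_pos h2] at hs; simp at hs
    · rw [if_neg h2] at hs
      by_cases h3 : n < c
      · rw [if_pos h3] at hs
        simp only [Prod.mk.injEq] at hs
        rw [← hs.1] at hno
        exact absurd hno (Nat.succ_ne_self _)
      · rw [if_neg h3] at hs
        push Not at h2
        split at hs
        · rename_i x hx
          simp only [Prod.mk.injEq, Sum.inl.injEq] at hs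
          rw [← hs.2.2]
          exact ⟨⟨hin (hr.next hx), trivial⟩, by simp⟩
        · rename_i hx
          obtain ⟨b, -, h6, -⟩ := (hS.nextOK (hS.listed r hr)).2 (by
            change ((E.heap t).node r).key ≠ _
            rw [← h2.1]; exact coe_ne_top k)
          rw [hx] at h6; cases h6
  | delN p r x res =>
    obtain ⟨c, nx, rfl⟩ := hpc
    simp only [stepOp, stepDelN, callSCX, Prod.mk.injEq] at hs
    rw [← hs.1] at hno
    exact absurd hno (Nat.succ_ne_self _)
  | scx u pc ret => exact absurd hpc id
  | fault => exact absurd hpc id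

end Stable

/-! ### Operations complete infinitely often. -/

section Progress

variable {P K : Type*} [DecidableEq P] [LinearOrder K] {E : Execution P K}

/-- From time `T` on, operations are neither invoked nor do they return, and the list and the
`info` fields of its nodes do not change. -/
structure Execution.StableFrom (E : Execution P K) (T : ℕ) : Prop where
  quiet : E.QuietFrom T
  not_invoke : ∀ t ≥ T, ∀ p op, E.act t ≠ .invoke p op
  not_respond : ∀ t ≥ T, ∀ p v, E.act t ≠ .respond p v
  same : ∀ t ≥ T, SameList (E.ghost t) (E.ghost (t + 1))
  fresh : ∀ t ≥ T, ∀ u, (E.heap t).numRecs ≤ u → u < (E.heap (t + 1)).numRecs →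
    ∀ y ∈ ((E.heap (t + 1)).scx u).V,
      ((E.heap (t + 1)).scx u).infoFields y = ((E.heap (t + 1)).node y).info

lemma Execution.exists_stableFrom [Finite P]
    (hr : ∀ᶠ t in Filter.atTop, ∀ p v, E.act t ≠ .respond p v) : ∃ T, E.StableFrom T := by
  have hi := eventually_not_invoke hr
  obtain ⟨T₀, hq⟩ := Filter.eventually_atTop.1 (eventually_not_updatesAt hi)
  have hq : E.QuietFrom T₀ := hq
  obtain ⟨T, hT⟩ := Filter.eventually_atTop.1
    ((hr.and hi).and (hq.eventually_sameList.and (Filter.eventually_ge_atTop T₀)))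
  exact ⟨T, fun t ht => hq t (hT t ht).2.2, fun t ht => (hT t ht).1.2, fun t ht => (hT t ht).1.1,
    fun t ht => (hT t ht).2.1.1, fun t ht => (hT t ht).2.1.2⟩

/-- Between two consecutive steps of `p` only other processes act, so its local state is unchanged
and its run can be followed step by step. -/
lemma Execution.StableFrom.next_step {T : ℕ} (h : E.StableFrom T) {p : P}
    (hp : ∃ᶠ t in Filter.atTop, E.act t = .internal p) {t : ℕ} (ht : T ≤ t) :
    ∃ t' ≥ t, E.act t' = .internal p ∧ (E.conf t').proc p = (E.conf t).proc p := by
  classical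
  have hex : ∃ t', t ≤ t' ∧ E.act t' = .internal p := Filter.frequently_atTop.1 hp t
  obtain ⟨h1, h2⟩ := Nat.find_spec hex
  refine ⟨Nat.find hex, h1, h2, ?_⟩
  have key : ∀ s, t ≤ s → s ≤ Nat.find hex → (E.conf s).proc p = (E.conf t).proc p := by
    intro s hs
    induction s, hs using Nat.le_induction with
    | base => intro _; rfl
    | succ s hs ih =>
      intro hle
      rw [← ih (Nat.le_of_succ_le hle)]
      refine proc_eq_of_ne fun hproc => ?_
      cases ha : E.act s with
      | stutter => rw [ha] at hproc; cases hproc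
      | invoke q op => exact h.not_invoke s (ht.trans hs) q op ha
      | respond q v => exact h.not_respond s (ht.trans hs) q v ha
      | internal q =>
        rw [ha] at hproc
        cases hproc
        exact Nat.find_min hex hle ⟨hs, ha⟩
  exact key _ h1 le_rfl

lemma Execution.StableFrom.info_eq {T : ℕ} (h : E.StableFrom T) {s t : ℕ} (hs : T ≤ s)
    (hst : s ≤ t) {a : Ptr} (ha : (E.ghost s).listed a) :
    ((E.heap t).node a).info = ((E.heap s).node a).info := by
  induction t, hst using Nat.le_induction with
  | base => rfl
  | succ t ht ih => exact ((h.same t (hs.trans ht)).info a (listed_mono ht ha)).trans ih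

/-- The freezing CAS of the owner of a new record would succeed. -/
lemma Execution.StableFrom.numRecs_eq {T : ℕ} (h : E.StableFrom T) {p : P}
    (hp : ∃ᶠ t in Filter.atTop, E.act t = .internal p) {t : ℕ} (ht : T ≤ t)
    (ha : E.act t = .internal p) : (E.heap (t + 1)).numRecs = (E.heap t).numRecs := by
  obtain ⟨op, pc, pc', h1, h2, h3⟩ := internal_step ha
  rcases stepOp_numRecs (E.heap t) ((E.conf t).proc p).table op pc with hn | hn
  · rw [h3] at hn; exact hn
  exfalso
  have hnum := hn.numRecs
  obtain ⟨ret, hpc⟩ := hn.pc_eq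
  rw [h3] at hnum hpc
  simp only [Sum.inl.injEq] at hnum hpc
  obtain ⟨t', ht', ha', hproc⟩ := h.next_step hp (ht.trans t.le_succ)
  obtain ⟨op', pc₁, pc₂, h4, h5, h6⟩ := internal_step ha'
  rw [hproc, h2] at h4
  simp only [Option.some.injEq, Prod.mk.injEq] at h4
  obtain ⟨rfl, rfl⟩ := h4
  generalize hu : (E.heap t).numRecs = u at hnum hpc
  have hlt : u < (E.heap (t + 1)).numRecs := hnum ▸ u.lt_succ_self
  have hd : u ≠ dummy := hu ▸ (E.ghost_inv t).recs_pos.ne'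
  have hS := E.ghost_inv (t + 1)
  obtain ⟨hV, hI⟩ := record_eq ht' hlt
  have hrec := hS.record u hlt hd
  obtain ⟨r, rs, hrs⟩ : ∃ r rs, ((E.heap (t + 1)).scx u).V = r :: rs :=
    List.exists_cons_of_ne_nil (List.ne_nil_of_mem hrec.fld_mem)
  have hr : r ∈ ((E.heap (t + 1)).scx u).V := by rw [hrs]; exact List.mem_cons_self
  have hl := (hS.mem_V_spec hlt hd hr).2
  have hf := h.fresh t ht u hu.le hlt r hr
  have hinfo := h.info_eq (ht.trans t.le_succ) ht' hl
  have hinfo' := h.info_eq (ht.trans t.le_succ) (ht'.trans t'.le_succ) hl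
  -- The new record stores the present `info` of its first node, and this is still the value when
  -- the process next moves.
  have hcas : ((E.heap t').node r).info = ((E.heap t').scx u).infoFields r := by
    rw [hinfo, hI, hf]
  rw [hpc] at h6
  simp only [startHelp, hrs, stepOp, stepHelp, if_pos hcas, Prod.mk.injEq] at h6
  -- The CAS would set `info` to `u`, while stability says that it stays below `u`.
  rw [← h6.1] at hinfo'
  simp only [Heap.setNode, Function.update_self] at hinfo'
  have := hrec.info_lt r hr
  simp only [Ghost.scx, ghost_heap] at this
  rw [hf, ← hinfo'] at this
  exact lt_irrefl _ this

/-- A bound on the number of steps of a process in its current iteration. -/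
noncomputable def Execution.pcSize (E : Execution P K) (T : ℕ) (pc : PC) : ℕ :=
  pc.size (fun r => (E.above T r).ncard) {a | (E.ghost T).listed a}.ncard

/-- The length of a search is measured by the number of listed nodes with a larger key. This also
bounds a walk through removed nodes, since the set of listed nodes is fixed from `T` on. -/
lemma Execution.StableFrom.pcSize_lt {T : ℕ} (h : E.StableFrom T) {p : P}
    (hp : ∃ᶠ t in Filter.atTop, E.act t = .internal p) {t : ℕ} (ht : T ≤ t)
    (ha : E.act t = .internal p) {op op' : Op K} {pc pc' : PC}
    (h1 : ((E.conf t).proc p).cur = some (op, pc))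
    (h2 : ((E.conf (t + 1)).proc p).cur = some (op', pc')) :
    (pc' = .start ∨ E.pcSize T pc' < E.pcSize T pc) ∧
      (PCSucceeds (E.ghost t) pc → PCSucceeds (E.ghost (t + 1)) pc' ∧ pc' ≠ .start) := by
  have hno := h.numRecs_eq hp ht ha
  have hS := E.ghost_inv t
  obtain ⟨i, -, hinv⟩ := (E.inv t).procs p op pc h1
  obtain ⟨op₁, pc₁, pc₁', h3, h4, h5⟩ := internal_step ha
  rw [h1] at h3; cases h3
  rw [h2] at h4; cases h4
  refine ⟨hinv.size_lt hS ?_ ?_ h5 hno, fun hsucc => hinv.succeeds hS (h.same t ht) hsucc h5 hno⟩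
  · exact fun r => Set.ncard_le_ncard (fun y hy => hy.1) (E.listed_finite T)
  · intro r x hr hx
    have hn := hS.nextOK hr
    rw [show ((E.ghost t).node r).next = some x from hx] at hn
    obtain ⟨h6, -, h7⟩ := hn.key_lt
    rw [h.quiet.listed ht] at hr h7
    refine ncard_above_lt ⟨h7, ?_⟩
    rwa [← key_eq ht hr, ← key_eq ht h7]

/-- A process that takes infinitely many steps starts its main loop anew. -/
lemma Execution.StableFrom.exists_start {T : ℕ} (h : E.StableFrom T) {p : P}
    (hp : ∃ᶠ t in Filter.atTop, E.act t = .internal p) {t : ℕ} (ht : T ≤ t) {op : Op K} {pc : PC}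
    (hc : ((E.conf t).proc p).cur = some (op, pc)) :
    ∃ t' ≥ T, ∃ op', ((E.conf t').proc p).cur = some (op', .start) := by
  induction hn : E.pcSize T pc using Nat.strong_induction_on generalizing t op pc with
  | _ n ih =>
  subst hn
  obtain ⟨t', ht', ha, hproc⟩ := h.next_step hp ht
  obtain ⟨op₁, pc₁, pc', h1, h2, -⟩ := internal_step ha
  have h1' := h1
  rw [hproc, hc] at h1'
  cases h1'
  rcases (h.pcSize_lt hp (ht.trans ht') ha h1 h2).1 with rfl | hlt
  · exact ⟨t' + 1, ht.trans (ht'.trans t'.le_succ), _, h2⟩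
  · exact ih _ hlt (ht.trans (ht'.trans t'.le_succ)) h2 rfl

/-- A process that takes infinitely many steps does not start its main loop anew. -/
lemma Execution.StableFrom.not_pcSucceeds {T : ℕ} (h : E.StableFrom T) {p : P}
    (hp : ∃ᶠ t in Filter.atTop, E.act t = .internal p) {t : ℕ} (ht : T ≤ t) {op : Op K} {pc : PC}
    (hc : ((E.conf t).proc p).cur = some (op, pc)) : ¬ PCSucceeds (E.ghost t) pc := by
  intro hsucc
  induction hn : E.pcSize T pc using Nat.strong_induction_on generalizing t op pc with
  | _ n ih =>
  subst hn
  obtain ⟨t', ht', ha, hproc⟩ := h.next_step hp ht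
  obtain ⟨op₁, pc₁, pc', h1, h2, -⟩ := internal_step ha
  have h1' := h1
  rw [hproc, hc] at h1'
  cases h1'
  have hs : PCSucceeds (E.ghost t') pc := by
    clear ha hproc h1 h2
    induction t', ht' using Nat.le_induction with
    | base => exact hsucc
    | succ s hs ih => exact ih.mono (E.ghost_inv s) (h.same s (ht.trans hs))
  obtain ⟨h3, h4⟩ := h.pcSize_lt hp (ht.trans ht') ha h1 h2
  obtain ⟨h5, h6⟩ := h4 hs
  -- The iteration never restarts, so the measure would have to decrease forever.
  exact ih _ (h3.resolve_left h6) (ht.trans (ht'.trans t'.le_succ)) h2 h5 rfl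

theorem Execution.nonBlocking [Finite P] (E : Execution P K) : E.NonBlocking := by
  intro hinf T
  by_contra hcon
  push Not at hcon
  obtain ⟨T, h⟩ := exists_stableFrom (Filter.eventually_atTop.2 ⟨T, hcon⟩)
  -- With finitely many processes, one of them takes infinitely many of the steps, all of which are
  -- eventually internal.
  have hp : ∃ p, ∃ᶠ t in Filter.atTop, E.act t = .internal p := by
    by_contra hno
    push Not at hno
    obtain ⟨T', hT'⟩ := Filter.eventually_atTop.1 (Filter.eventually_all.2 hno)
    obtain ⟨t, ht, hne⟩ := hinf (max T T')
    have h1 := (le_max_left _ _).trans ht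
    cases ha : E.act t with
    | stutter => exact hne ha
    | invoke q op => exact h.not_invoke t h1 q op ha
    | respond q v => exact h.not_respond t h1 q v ha
    | internal q => exact hT' t ((le_max_right _ _).trans ht) q ha
  obtain ⟨p, hp⟩ := hp
  obtain ⟨t, ht, ha, -⟩ := h.next_step hp le_rfl
  obtain ⟨op, pc, pc', hc, -⟩ := internal_step ha
  obtain ⟨t', ht', op', hc'⟩ := h.exists_start hp ht hc
  -- At the start of the main loop nothing has been read that could be outdated, so `PCSucceeds`
  -- holds trivially.
  exact h.not_pcSucceeds hp ht' hc' trivial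

end Progress

end LLXMultiset

theorem theorem2 {P K : Type*} [DecidableEq P] [Finite P] [LinearOrder K]
    (E : LLXMultiset.Execution P K) :
    (∀ t, LLXMultiset.Sorted (E.conf t).heap) ∧
    E.RemovesFinalized ∧
    (∃ σ : ℕ → List ℕ, E.IsLinearization σ ∧
      ∀ t, LLXMultiset.IsContents (E.conf t).heap (E.runOps (σ t))) ∧
    E.NonBlocking :=
  ⟨fun t => (E.ghost_inv t).sorted, E.removesFinalized,
    ⟨E.order, E.isLinearization_order, fun t => (E.isContents_order t).1⟩, E.nonBlocking⟩
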